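/- **Theorem 1 (Concentration of the entropy mv solution).** Let $f\in C^1(\mathbb R)$ and $y_0\in L^1(\mathbb R)\cap L^\infty(\mathbb R)$, and let $\mathbb R_+=[0,\infty)$. An *entropy pair* is a pair $\eta,q\in C^1(\mathbb R)$ with $\eta$ strictly convex and $q'=f'\eta'$. Test functions are the elements of $C^1_c(\mathbb R_+\times\mathbb R)$ (they need not vanish at $t=0$). Let $y\in L^\infty(\mathbb R_+\times\mathbb R)$ be an *entropy solution* of $\partial_t y+\partial_x f(y)=0$, $y(0,\cdot)=y_0$: for all test functions $\psi$, $$\int_{\mathbb R_+}\!\int_{\mathbb R}\big(\partial_t\psi\, y+\partial_x\psi\, f(y)\big)\,dx\,dt+\int_{\mathbb R}\psi(0,x)\,y_0(x)\,dx=0,$$ and for all entropy pairs $(\eta,q)$ and all test functions $\psi\ge 0$, $$\int_{\mathbb R_+}\!\int_{\mathbb R}\big(\partial_t\psi\,\eta(y)+\partial_x\psi\, q(y)\big)\,dx\,dt+\int_{\mathbb R}\psi(0,x)\,\eta(y_0(x))\,dx\ge 0.$$ A *Young measure* is a family $\xi\mapsto\nu_\xi$ of probability measures on $\mathbb R$ such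 that $\xi\mapsto\langle\nu_\xi,g\rangle=\int g\,d\nu_\xi$ is measurable for every $g\in C_0(\mathbb R)$. Let $\sigma_0=(\sigma_{0,x})_{x\in\mathbb R}$ and $\mu=(\mu_{(t,x)})_{(t,x)\in\mathbb R_+\times\mathbb R}$ be Young measures such that $\mu$ is an *entropy measure-valued solution* with initial datum $\sigma_0$: for all test functions $\psi$, $$\int_{\mathbb R_+}\!\int_{\mathbb R}\big(\partial_t\psi\,\langle\mu_{(t,x)},u\rangle+\partial_x\psi\,\langle\mu_{(t,x)},f(u)\rangle\big)\,dx\,dt+\int_{\mathbb R}\psi(0,x)\langle\sigma_{0,x},u\rangle\,dx=0,$$ and for all entropy pairs $(\eta,q)$ and all test functions $\psi\ge0$, $$\int_{\mathbb R_+}\!\int_{\mathbb R}\big(\partial_t\psi\,\langle\mu_{(t,x)},\eta\rangle+\partial_x\psi\,\langle\mu_{(t,x)},q\rangle\big)\,dx\,dt+\int_{\mathbb R}\psi(0,x)\langle\sigma_{0,x},\eta\rangle\,dx\ge 0,$$ where it is understood that the pairings occurring here exist and are locally integrable (i.e. $\langle\mu,|g|\rangle\in L^1_{loc}(\mathbb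 R_+\times\mathbb R)$ for $g=u,f,\eta,q$, and $\langle\sigma_0,|g|\rangle\in L^1_{loc}(\mathbb R)$ for $g=u,\eta$). Let $C\ge 0$ be a Lipschitz constant of $f$ on an interval $I\subseteq\mathbb R$ (for instance $I=\mathbb R$) such that $y(t,x)\in I$ and $\mu_{(t,x)}(I)=1$ for almost every $(t,x)$. Then: 1. (Contraction.) For almost every $T\ge0$, and for all $r\ge 0$, $$\int_{|x|\le r}\langle\mu_{(T,x)},|u-y(T,x)|\rangle\,dx\;\le\;\int_{|x|\le r+CT}\langle\sigma_{0,x},|u-y_0(x)|\rangle\,dx\;<\;\infty .$$ The same holds, for all $r\ge0$, at every single $T\ge0$ at which $y$ and $\mu$ are normalized as right limits in time, that is, $y(T,\cdot)=\operatorname{ess\,lim}_{t\downarrow T}y(t,\cdot)$ in $L^1_{loc}(\mathbb R)$, and $\mu_{(T,\cdot)}$ is a Young measure with $\int\varphi(x)\langle\mu_{(T,x)},g\rangle dx=\operatorname{ess\,lim}_{t\downarrow T}\int\varphi(x)\langle\mu_{(t,x)},g\rangle dx$ for all $\varphi\in C_c(\mathbb R)$, $g\in C_0(\mathbb R)$.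 2. (Concentration.) Let $T,r\ge 0$. If $\sigma_{0,x}=\delta_{y_0(x)}$ for almost every $x$ with $|x|\le r+CT$, then $\mu_{(t,x)}=\delta_{y(t,x)}$ for almost every $(t,x)$ in the cone of dependence $0\le t\le T$, $|x|\le r+C(T-t)$ (in particular for almost every $(t,x)\in[0,T]\times[-r,r]$). Moreover, at every $t\in[0,T]$ at which $y$ and $\mu$ are normalized as right limits in time, $\mu_{(t,x)}=\delta_{y(t,x)}$ for almost every $x$ with $|x|\le r+C(T-t)$. -/

import Mathlib

open MeasureTheory Filter Topology
open scoped ENNReal NNReal ZeroAtInfty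

/-- The closed space-time half plane `ℝ₊ × ℝ`, with points `p = (t, x)`. -/
def halfPlane : Set (ℝ × ℝ) := Set.Ici (0 : ℝ) ×ˢ Set.univ

/-- Lebesgue measure on `ℝ₊ × ℝ`. -/
noncomputable def halfVol : Measure (ℝ × ℝ) := volume.restrict halfPlane

/-- The time derivative of a function of `(t, x)`. -/
noncomputable def timeDeriv (ψ : ℝ × ℝ → ℝ) (p : ℝ × ℝ) : ℝ := fderiv ℝ ψ p (1, 0)

/-- The space derivative of a function of `(t, x)`. -/
noncomputable def spaceDeriv (ψ : ℝ × ℝ → ℝ) (p : ℝ × ℝ) : ℝ := fderiv ℝ ψ p (0, 1)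

/-- Test functions: restrictions to `ℝ₊ × ℝ` of `C¹` functions with compact support in the plane.
They need not vanish at `t = 0`. -/
structure IsTestFunction (ψ : ℝ × ℝ → ℝ) : Prop where
  contDiff : ContDiff ℝ 1 ψ
  hasCompactSupport : HasCompactSupport ψ

/-- Entropy pairs for the flux `f`: `C¹` functions with `η` strictly convex and `q' = f' η'`. -/
structure IsEntropyPair (f η q : ℝ → ℝ) : Prop where
  contDiff_entropy : ContDiff ℝ 1 η
  contDiff_flux : ContDiff ℝ 1 q
  strictConvex : StrictConvexOn ℝ Set.univ η
  deriv_eq : ∀ u, deriv q u = deriv f u * deriv η u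

/-- Weak solutions in `L^∞(ℝ₊ × ℝ)` of `∂ₜ y + ∂ₓ f(y) = 0`, `y(0, ·) = y₀`. -/
structure IsWeakSolution (f y₀ : ℝ → ℝ) (y : ℝ × ℝ → ℝ) : Prop where
  memLp_top : MemLp y ∞ halfVol
  weak_eq : ∀ ψ : ℝ × ℝ → ℝ, IsTestFunction ψ →
    (∫ p, (timeDeriv ψ p * y p + spaceDeriv ψ p * f (y p)) ∂halfVol) + (∫ x, ψ (0, x) * y₀ x) = 0

/-- Entropy solutions of `∂ₜ y + ∂ₓ f(y) = 0`, `y(0, ·) = y₀`. -/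
structure IsEntropySolution (f y₀ : ℝ → ℝ) (y : ℝ × ℝ → ℝ) : Prop
    extends IsWeakSolution f y₀ y where
  entropy_ineq : ∀ η q : ℝ → ℝ, IsEntropyPair f η q →
    ∀ ψ : ℝ × ℝ → ℝ, IsTestFunction ψ → (∀ p ∈ halfPlane, 0 ≤ ψ p) →
      0 ≤ (∫ p, (timeDeriv ψ p * η (y p) + spaceDeriv ψ p * q (y p)) ∂halfVol)
        + (∫ x, ψ (0, x) * η (y₀ x))

/-- Young measures: families of probability measures on `ℝ` such that `ξ ↦ ⟨μ_ξ, g⟩` is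
(Lebesgue, i.e. `ν`-almost everywhere) measurable for all continuous `g` vanishing at infinity. -/
def IsYoungMeasure {X : Type*} [MeasurableSpace X] (ν : Measure X)
    (μ : X → ProbabilityMeasure ℝ) : Prop :=
  ∀ g : C₀(ℝ, ℝ), AEMeasurable (fun ξ => ∫ u, g u ∂(μ ξ : Measure ℝ)) ν

/-- The pairing `ξ ↦ ⟨μ_ξ, |g|⟩` has finite integral over compact sets, so that `⟨μ_ξ, g⟩` exists
for almost every `ξ` and is locally integrable. -/
def HasLocalPairing {X : Type*} [MeasurableSpace X] [TopologicalSpace X] (ν : Measure X)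
    (μ : X → ProbabilityMeasure ℝ) (g : ℝ → ℝ) : Prop :=
  ∀ K : Set X, IsCompact K → ∫⁻ ξ in K, ∫⁻ u, ‖g u‖ₑ ∂(μ ξ : Measure ℝ) ∂ν < ∞

/-- Measure-valued solutions of `∂ₜ ⟨μ, u⟩ + ∂ₓ ⟨μ, f(u)⟩ = 0`, `μ_{(0, x)} = σ₀(x)`.
The pairings that occur in the equation are required to exist. -/
structure IsMVSolution (f : ℝ → ℝ) (σ₀ : ℝ → ProbabilityMeasure ℝ)
    (μ : ℝ × ℝ → ProbabilityMeasure ℝ) : Prop where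
  young : IsYoungMeasure halfVol μ
  young_init : IsYoungMeasure volume σ₀
  pairing_id : HasLocalPairing halfVol μ (fun u => u)
  pairing_flux : HasLocalPairing halfVol μ f
  pairing_init : HasLocalPairing volume σ₀ (fun u => u)
  weak_eq : ∀ ψ : ℝ × ℝ → ℝ, IsTestFunction ψ →
    (∫ p, (timeDeriv ψ p * (∫ u, u ∂(μ p : Measure ℝ))
          + spaceDeriv ψ p * (∫ u, f u ∂(μ p : Measure ℝ))) ∂halfVol)
      + (∫ x, ψ (0, x) * (∫ u, u ∂(σ₀ x : Measure ℝ))) = 0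

/-- Entropy measure-valued solutions. -/
structure IsEntropyMVSolution (f : ℝ → ℝ) (σ₀ : ℝ → ProbabilityMeasure ℝ)
    (μ : ℝ × ℝ → ProbabilityMeasure ℝ) : Prop extends IsMVSolution f σ₀ μ where
  pairing_entropy : ∀ η q : ℝ → ℝ, IsEntropyPair f η q →
    HasLocalPairing halfVol μ η ∧ HasLocalPairing halfVol μ q ∧ HasLocalPairing volume σ₀ η
  entropy_ineq : ∀ η q : ℝ → ℝ, IsEntropyPair f η q →
    ∀ ψ : ℝ × ℝ → ℝ, IsTestFunction ψ → (∀ p ∈ halfPlane, 0 ≤ ψ p) →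
      0 ≤ (∫ p, (timeDeriv ψ p * (∫ u, η u ∂(μ p : Measure ℝ))
            + spaceDeriv ψ p * (∫ u, q u ∂(μ p : Measure ℝ))) ∂halfVol)
        + (∫ x, ψ (0, x) * (∫ u, η u ∂(σ₀ x : Measure ℝ)))

/-- `y(T, ·)` is the essential limit of `y(t, ·)` as `t ↓ T`, in `L¹_loc(ℝ)`. -/
def IsRightTrace (y : ℝ × ℝ → ℝ) (T : ℝ) : Prop :=
  AEMeasurable (fun x => y (T, x)) volume ∧
  ∀ R : ℝ, Tendsto (fun t => ∫⁻ x in {x : ℝ | |x| ≤ R}, ‖y (t, x) - y (T, x)‖ₑ)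
    (𝓝[>] T ⊓ ae volume) (𝓝 0)

/-- `μ_{(T, ·)}` is the essential limit of `μ_{(t, ·)}` as `t ↓ T`, in the weak-* sense of Young
measures on `ℝ`. -/
def IsRightYoungTrace (μ : ℝ × ℝ → ProbabilityMeasure ℝ) (T : ℝ) : Prop :=
  IsYoungMeasure volume (fun x => μ (T, x)) ∧
  ∀ φ : ℝ → ℝ, Continuous φ → HasCompactSupport φ → ∀ g : C₀(ℝ, ℝ),
    Tendsto (fun t => ∫ x, φ x * ∫ u, g u ∂(μ (t, x) : Measure ℝ))
      (𝓝[>] T ⊓ ae volume) (𝓝 (∫ x, φ x * ∫ u, g u ∂(μ (T, x) : Measure ℝ)))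

/-- `∫_{|x| ≤ R} ⟨σ_x, |u - w(x)|⟩ dx`, as an integral with values in `[0, ∞]`. -/
noncomputable def meanDeviation (σ : ℝ → ProbabilityMeasure ℝ) (w : ℝ → ℝ) (R : ℝ) : ℝ≥0∞ :=
  ∫⁻ x in {x : ℝ | |x| ≤ R}, ∫⁻ u, ENNReal.ofReal |u - w x| ∂(σ x : Measure ℝ)

/-! The theorem is Kruzhkov's L¹ contraction with one of the two solutions replaced by a Young
measure. Doubling the variables survives the replacement: the entropy inequality for `μ` is used at
a point `p` with the constant `k = y q`, the one for `y` at `q` with the constant `k = u`, and the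
sum is integrated over `(p, u)` against Lebesgue measure times `μ`, and over `q`. Letting `q → p`
then needs continuity of translations in L¹ for the function `y` alone and no regularity of `μ`. The
outcome is Kato's inequality `∂ₜ⟨μ, |u - y|⟩ + ∂ₓ⟨μ, sgn(u - y)(f u - f y)⟩ ≤ 0`
(`KruzhkovIneq.kato`).

No trace at `t = 0` is used. Both solutions are continued to negative times by their initial data,
constant in time, with the flux set to zero there. The initial term becomes an integral of `∂ₜψ`
over the past, and the inequalities hold on the whole plane without boundary term
(`kruzhkovIneq_pastExtension`). The price is a flux that jumps at `t = 0`. A mollifier supported in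
positive times makes `q` earlier than `p`, so that the jump is felt only for `p` in a layer `0 < t <
ε`; the mollifier is narrowed in time alone, its `x`-derivative stays bounded in L¹, and the
contribution of the layer tends to zero.

Since `|f u - f y| ≤ C |u - y|` on `I`, Kato's inequality tested with `θ(t)` times a cutoff of the
cone `|x| ≤ R - C t` leaves only the term with `θ'` (`cone_inequality`). A `θ` that rises in
negative times and falls with slope `-1` on `[a, b]` bounds the time average of the deviation by its
initial value; Lebesgue differentiation gives the contraction at almost every time
(`ae_contraction`), and lower semicontinuity carries it to right limits
(`meanDeviation_le_of_isRightTrace`). If the initial deviation vanishes, then `⟨μ, |u - y|⟩ = 0` in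
the cone, which forces a Dirac mass at `y`. -/

section

open ProbabilityTheory

/-! ### Young measures as Markov kernels -/

/-- A continuous function with compact support, as a function vanishing at infinity. -/
def compactSupportC₀ (g : ℝ → ℝ) (hg : Continuous g) (hs : HasCompactSupport g) : C₀(ℝ, ℝ) where
  toFun := g
  continuous_toFun := hg
  zero_at_infty' := hs.is_zero_at_infty

/-- Trapezoidal approximations of the indicator of `Iic a`. -/
noncomputable def trapezoid (a : ℝ) (n : ℕ) (u : ℝ) : ℝ :=
  -- The first factor cuts off to the right of `a`, the second truncates to `|u| ≤ n + 1`, because a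
  -- Young measure is tested only against functions vanishing at infinity.
  max 0 (1 - n * max (u - a) 0) * max 0 (1 - |u| / (n + 1))

theorem continuous_trapezoid (a : ℝ) (n : ℕ) : Continuous (trapezoid a n) := by
  unfold trapezoid; fun_prop

theorem hasCompactSupport_trapezoid (a : ℝ) (n : ℕ) : HasCompactSupport (trapezoid a n) := by
  refine HasCompactSupport.intro (isCompact_Icc (a := -((n : ℝ) + 1)) (b := n + 1)) fun u hu => ?_
  have hn : (0 : ℝ) < n + 1 := by positivity
  have h1 : (n : ℝ) + 1 < |u| := by
    by_contra! h
    exact hu ⟨(abs_le.1 h).1, (abs_le.1 h).2⟩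
  have h2 : 1 - |u| / ((n : ℝ) + 1) ≤ 0 := by
    rw [sub_nonpos, le_div_iff₀ hn]; linarith
  simp [trapezoid, max_eq_left h2]

theorem trapezoid_nonneg (a : ℝ) (n : ℕ) (u : ℝ) : 0 ≤ trapezoid a n u :=
  mul_nonneg (le_max_left _ _) (le_max_left _ _)

theorem trapezoid_le_one (a : ℝ) (n : ℕ) (u : ℝ) : trapezoid a n u ≤ 1 := by
  refine mul_le_one₀ (max_le zero_le_one ?_) (le_max_left _ _) (max_le zero_le_one ?_)
  · have : 0 ≤ (n : ℝ) * max (u - a) 0 := by positivity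
    linarith
  · have : 0 ≤ |u| / ((n : ℝ) + 1) := by positivity
    linarith

theorem tendsto_trapezoid (a u : ℝ) :
    Tendsto (fun n => trapezoid a n u) atTop (𝓝 ((Set.Iic a).indicator (fun _ => (1 : ℝ)) u)) := by
  have hN : Tendsto (fun n : ℕ => (n : ℝ)) atTop atTop := tendsto_natCast_atTop_atTop
  have h2 : Tendsto (fun n : ℕ => max 0 (1 - |u| / ((n : ℝ) + 1))) atTop (𝓝 1) := by
    have := (tendsto_const_nhds (x := |u|)).div_atTop (tendsto_atTop_add_const_right _ (1 : ℝ) hN)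
    simpa using (tendsto_const_nhds (x := (0 : ℝ))).max (this.const_sub 1)
  by_cases hu : u ≤ a
  · have h0 : max (u - a) 0 = 0 := max_eq_right (by linarith)
    simpa [trapezoid, h0, hu] using h2
  · have hpos : 0 < u - a := by linarith [not_le.1 hu]
    have : ∀ᶠ n : ℕ in atTop, trapezoid a n u = 0 := by
      filter_upwards [hN.eventually_ge_atTop (1 / (u - a))] with n hn
      rw [div_le_iff₀ hpos] at hn
      have : 1 - (n : ℝ) * max (u - a) 0 ≤ 0 := by rw [max_eq_left hpos.le]; linarith
      simp [trapezoid, max_eq_left this]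
    simpa [hu] using (tendsto_congr' this).2 tendsto_const_nhds

theorem IsYoungMeasure.aemeasurable_Iic {X : Type*} [MeasurableSpace X] {ν : Measure X}
    {μ : X → ProbabilityMeasure ℝ} (h : IsYoungMeasure ν μ) (a : ℝ) :
    AEMeasurable (fun ξ => (μ ξ : Measure ℝ) (Set.Iic a)) ν := by
  have hreal : AEMeasurable (fun ξ => (μ ξ : Measure ℝ).real (Set.Iic a)) ν := by
    refine aemeasurable_of_tendsto_metrizable_ae atTop (fun n => h (compactSupportC₀ _
      (continuous_trapezoid a n) (hasCompactSupport_trapezoid a n))) (ae_of_all _ fun ξ => ?_)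
    rw [← integral_indicator_one measurableSet_Iic]
    refine tendsto_integral_of_dominated_convergence (fun _ => (1 : ℝ))
      (fun n => (continuous_trapezoid a n).aestronglyMeasurable) (integrable_const _)
      (fun n => ae_of_all _ fun u => ?_) (ae_of_all _ fun u => tendsto_trapezoid a u)
    change ‖trapezoid a n u‖ ≤ 1
    rw [Real.norm_of_nonneg (trapezoid_nonneg a n u)]
    exact trapezoid_le_one a n u
  simpa [Measure.real] using hreal.ennreal_ofReal

/-- A Young measure agrees almost everywhere with a Markov kernel. -/
theorem IsYoungMeasure.exists_kernel {X : Type*} [MeasurableSpace X] {ν : Measure X}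
    {μ : X → ProbabilityMeasure ℝ} (h : IsYoungMeasure ν μ) :
    ∃ κ : Kernel X ℝ, IsMarkovKernel κ ∧ ∀ᵐ ξ ∂ν, κ ξ = μ ξ := by
  classical
  have hae : ∀ᵐ ξ ∂ν, ∀ q : ℚ, (μ ξ : Measure ℝ) (Set.Iic (q : ℝ))
      = (h.aemeasurable_Iic q).mk _ ξ := ae_all_iff.2 fun q => (h.aemeasurable_Iic q).ae_eq_mk
  -- Countably many half-lines leave one measurable null set `N`. Putting a Dirac mass there keeps
  -- every fibre a probability measure, so measurability has to be checked only on the π-system of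
  -- rational half-lines.
  obtain ⟨N, hN, hNm, hN0⟩ := exists_measurable_superset_of_null (ae_iff.1 hae)
  set κ : X → Measure ℝ := fun ξ => if ξ ∈ N then Measure.dirac 0 else μ ξ with hκ
  have hprob : ∀ ξ, IsProbabilityMeasure (κ ξ) := fun ξ => by
    simp only [hκ]; split_ifs <;> infer_instance
  have hmeas : Measurable κ := by
    refine Measurable.measure_of_isPiSystem_of_isProbabilityMeasure
      (BorelSpace.measurable_eq.trans Real.borel_eq_generateFrom_Iic_rat) Real.isPiSystem_Iic_rat ?_
    intro s hs
    obtain ⟨q, rfl⟩ : ∃ q : ℚ, Set.Iic (q : ℝ) = s := by simpa using hs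
    have : (fun ξ => κ ξ (Set.Iic (q : ℝ))) = fun ξ => if ξ ∈ N then
        (Measure.dirac (0 : ℝ)) (Set.Iic (q : ℝ)) else (h.aemeasurable_Iic q).mk _ ξ := by
      funext ξ
      by_cases hξ : ξ ∈ N
      · simp [hκ, hξ]
      · have := not_not.1 fun h' => hξ (hN h')
        simp only [hκ, hξ, if_false]
        exact this q
    rw [this]
    exact Measurable.ite hNm measurable_const (h.aemeasurable_Iic q).measurable_mk
  refine ⟨⟨κ, hmeas⟩, ⟨hprob⟩, ?_⟩
  filter_upwards [compl_mem_ae_iff.2 hN0] with ξ hξ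
  exact if_neg hξ

/-! ### Kruzhkov entropies and their strictly convex regularizations -/

/-- The entropy flux of the Kruzhkov entropy `u ↦ |u - k|`. -/
def kruzhkovFlux (f : ℝ → ℝ) (u k : ℝ) : ℝ := f (max u k) - f (min u k)

/-- Increasing approximations of the sign of `v - k`. -/
noncomputable def smoothSign (n : ℕ) (k v : ℝ) : ℝ := 2 / Real.pi * Real.arctan ((n + 1) * (v - k))

theorem continuous_smoothSign (n : ℕ) (k : ℝ) : Continuous (smoothSign n k) := by
  unfold smoothSign; fun_prop

theorem abs_smoothSign_le (n : ℕ) (k v : ℝ) : |smoothSign n k v| ≤ 1 := by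
  have hpi := Real.pi_pos
  rw [smoothSign, abs_mul, abs_of_pos (by positivity), div_mul_eq_mul_div, div_le_one hpi]
  have := abs_le.2 ⟨(Real.neg_pi_div_two_lt_arctan ((n + 1) * (v - k))).le,
    (Real.arctan_lt_pi_div_two ((n + 1) * (v - k))).le⟩
  linarith

/-- Strictness is what makes the regularized entropies strictly convex, as entropy pairs require.
The scale `n + 1` instead of `n` keeps it for `n = 0`. -/
theorem strictMono_smoothSign (n : ℕ) (k : ℝ) : StrictMono (smoothSign n k) := by
  intro v w h
  have hpi := Real.pi_pos
  refine mul_lt_mul_of_pos_left (Real.arctan_strictMono ?_) (by positivity)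
  exact mul_lt_mul_of_pos_left (by linarith) (by positivity)

theorem tendsto_smoothSign_of_lt {k v : ℝ} (h : k < v) :
    Tendsto (fun n => smoothSign n k v) atTop (𝓝 1) := by
  have h1 : Tendsto (fun n : ℕ => ((n : ℝ) + 1) * (v - k)) atTop atTop :=
    (tendsto_atTop_add_const_right _ _ tendsto_natCast_atTop_atTop).atTop_mul_const (by linarith)
  have := ((Real.tendsto_arctan_atTop.mono_right nhdsWithin_le_nhds).comp h1).const_mul
    (2 / Real.pi)
  simpa [smoothSign, Function.comp_def, Real.pi_ne_zero] using this

theorem tendsto_smoothSign_of_gt {k v : ℝ} (h : v < k) :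
    Tendsto (fun n => smoothSign n k v) atTop (𝓝 (-1)) := by
  have := (tendsto_smoothSign_of_lt h).neg
  refine this.congr fun n => ?_
  rw [smoothSign, smoothSign, ← mul_neg, ← Real.arctan_neg]
  ring_nf

/-- Regularizations of the Kruzhkov entropies and of their fluxes. -/
noncomputable def smoothEntropy (h : ℝ → ℝ) (n : ℕ) (k u : ℝ) : ℝ :=
  ∫ v in k..u, h v * smoothSign n k v

theorem hasDerivAt_smoothEntropy {h : ℝ → ℝ} (hh : Continuous h) (n : ℕ) (k u : ℝ) :
    HasDerivAt (smoothEntropy h n k) (h u * smoothSign n k u) u :=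
  (hh.mul (continuous_smoothSign n k)).integral_hasStrictDerivAt k u |>.hasDerivAt

theorem contDiff_smoothEntropy {h : ℝ → ℝ} (hh : Continuous h) (n : ℕ) (k : ℝ) :
    ContDiff ℝ 1 (smoothEntropy h n k) := by
  rw [contDiff_one_iff_deriv]
  refine ⟨fun u => (hasDerivAt_smoothEntropy hh n k u).differentiableAt, ?_⟩
  have : deriv (smoothEntropy h n k) = fun u => h u * smoothSign n k u :=
    funext fun u => (hasDerivAt_smoothEntropy hh n k u).deriv
  rw [this]
  exact hh.mul (continuous_smoothSign n k)

theorem isEntropyPair_smoothEntropy {f : ℝ → ℝ} (hf : ContDiff ℝ 1 f) (n : ℕ) (k : ℝ) :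
    IsEntropyPair f (smoothEntropy (fun _ => 1) n k) (smoothEntropy (deriv f) n k) where
  contDiff_entropy := contDiff_smoothEntropy continuous_const n k
  contDiff_flux := contDiff_smoothEntropy (hf.continuous_deriv le_rfl) n k
  strictConvex := by
    refine StrictMono.strictConvexOn_univ_of_deriv
      (contDiff_smoothEntropy continuous_const n k).continuous ?_
    have : deriv (smoothEntropy (fun _ => 1) n k) = smoothSign n k :=
      funext fun u => by simpa using
        (hasDerivAt_smoothEntropy (h := fun _ => 1) continuous_const n k u).deriv
    rw [this]
    exact strictMono_smoothSign n k
  deriv_eq := fun u => by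
    rw [(hasDerivAt_smoothEntropy (hf.continuous_deriv le_rfl) n k u).deriv,
      (hasDerivAt_smoothEntropy continuous_const n k u).deriv, one_mul]

/-- Between `k` and `u` the smooth signs converge to a constant `s = ±1`, so the limit is `s * (F u
- F k)`, which is `F (max u k) - F (min u k)`. The choice `F = id` yields the Kruzhkov entropy and
`F = f` its flux. -/
theorem tendsto_smoothEntropy {F : ℝ → ℝ} (hF : ContDiff ℝ 1 F) (k u : ℝ) :
    Tendsto (fun n => smoothEntropy (deriv F) n k u) atTop (𝓝 (kruzhkovFlux F u k)) := by
  have hc : Continuous (deriv F) := hF.continuous_deriv le_rfl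
  have key : ∀ s : ℝ, (∀ v ∈ Set.uIoc k u, v ≠ k → v ≠ u →
      Tendsto (fun n => smoothSign n k v) atTop (𝓝 s)) →
      Tendsto (fun n => smoothEntropy (deriv F) n k u) atTop (𝓝 (s * (F u - F k))) := by
    intro s hs
    have h1 : s * (F u - F k) = ∫ v in k..u, deriv F v * s := by
      rw [intervalIntegral.integral_mul_const, intervalIntegral.integral_deriv_eq_sub
        (fun x _ => hF.differentiable one_ne_zero x) (hc.intervalIntegrable _ _), mul_comm]
    rw [h1]
    refine intervalIntegral.tendsto_integral_filter_of_dominated_convergence (fun v => |deriv F v|)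
      (Eventually.of_forall fun n => (hc.mul (continuous_smoothSign n k)).aestronglyMeasurable)
      (Eventually.of_forall fun n => ae_of_all _ fun v _ => ?_) (hc.abs.intervalIntegrable _ _) ?_
    · rw [norm_mul]
      exact mul_le_of_le_one_right (norm_nonneg _) (abs_smoothSign_le n k v)
    · have h1 : ∀ᵐ v : ℝ, v ≠ k := by simp [ae_iff]
      have h2 : ∀ᵐ v : ℝ, v ≠ u := by simp [ae_iff]
      filter_upwards [h1, h2] with v h1 h2 hv
      exact (hs v hv h1 h2).const_mul _
  rcases le_total k u with h | h
  · have := key 1 fun v hv h1 _ => tendsto_smoothSign_of_lt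
      (by rw [Set.uIoc_of_le h] at hv; exact hv.1)
    simpa [kruzhkovFlux, h] using this
  · have := key (-1) fun v hv h1 _ => tendsto_smoothSign_of_gt
      (by rw [Set.uIoc_of_ge h] at hv; exact lt_of_le_of_ne hv.2 h1)
    simpa [kruzhkovFlux, h] using this

theorem kruzhkovFlux_id (u k : ℝ) : kruzhkovFlux id u k = |u - k| := by
  simp [kruzhkovFlux, max_sub_min_eq_abs, abs_sub_comm]

theorem tendsto_smoothEntropy_one (k u : ℝ) :
    Tendsto (fun n => smoothEntropy (fun _ => 1) n k u) atTop (𝓝 |u - k|) := by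
  simpa [kruzhkovFlux_id] using tendsto_smoothEntropy contDiff_id k u

theorem abs_smoothEntropy_one_le (n : ℕ) (k u : ℝ) :
    |smoothEntropy (fun _ => 1) n k u| ≤ |u - k| := by
  have := intervalIntegral.norm_integral_le_of_norm_le_const (a := k) (b := u) (C := 1)
    (f := fun v => 1 * smoothSign n k v) fun v _ => by
      simpa using abs_smoothSign_le n k v
  simpa [smoothEntropy] using this

/-- The constant `k` may lie outside `I`, where `f'` is only locally bounded. Passing through a
point `c` of `I` costs a constant independent of `u` and `n`; from `c` to `u` the path stays in `I`,
where `|f'| ≤ C`. The resulting growth is linear, which first moments can absorb. -/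
theorem abs_smoothEntropy_deriv_le {f : ℝ → ℝ} (hf : ContDiff ℝ 1 f) {C : ℝ≥0} {I : Set ℝ}
    (hI : I.OrdConnected) (hC : LipschitzOnWith C f I) {c : ℝ} (hc : c ∈ I) (n : ℕ) (k : ℝ)
    {u : ℝ} (hu : u ∈ I) :
    |smoothEntropy (deriv f) n k u| ≤ abs (∫ v in k..c, abs (deriv f v)) + C * |u - c| := by
  have hcont : Continuous fun v => deriv f v * smoothSign n k v :=
    (hf.continuous_deriv le_rfl).mul (continuous_smoothSign n k)
  have hle : ∀ v, ‖deriv f v * smoothSign n k v‖ ≤ |deriv f v| := fun v => by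
    rw [norm_mul]; exact mul_le_of_le_one_right (norm_nonneg _) (abs_smoothSign_le n k v)
  have hsplit : smoothEntropy (deriv f) n k u = (∫ v in k..c, deriv f v * smoothSign n k v)
      + ∫ v in c..u, deriv f v * smoothSign n k v :=
    (intervalIntegral.integral_add_adjacent_intervals (hcont.intervalIntegrable _ _)
      (hcont.intervalIntegrable _ _)).symm
  rw [hsplit]
  refine (abs_add_le _ _).trans (add_le_add ?_ ?_)
  · refine intervalIntegral.norm_integral_le_abs_of_norm_le (ae_of_all _ fun v => hle v)
      ((hf.continuous_deriv le_rfl).abs.intervalIntegrable _ _)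
  · refine intervalIntegral.norm_integral_le_of_norm_le_const_ae (C := (C : ℝ)) (a := c) (b := u)
      (f := fun v => deriv f v * smoothSign n k v) ?_
    -- Without the endpoint, `v` is interior to the interval between `c` and `u`, and the Lipschitz
    -- bound on `I` controls the derivative at `v`.
    have h1 : ∀ᵐ v : ℝ, v ≠ max c u := by simp [ae_iff]
    filter_upwards [h1] with v h1 hv
    refine (hle v).trans (norm_deriv_le_of_lipschitzOn (s := I) ?_ hC)
    have hv' : v ∈ Set.Ioo (min c u) (max c u) := ⟨hv.1, lt_of_le_of_ne hv.2 h1⟩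
    refine mem_of_superset (isOpen_Ioo.mem_nhds hv') (Set.Ioo_subset_Icc_self.trans ?_)
    exact hI.uIcc_subset hc hu

/-! ### Bounds on test functions -/

theorem IsTestFunction.continuous_timeDeriv {ψ : ℝ × ℝ → ℝ} (h : IsTestFunction ψ) :
    Continuous (timeDeriv ψ) :=
  (h.contDiff.continuous_fderiv one_ne_zero).clm_apply continuous_const

theorem IsTestFunction.continuous_spaceDeriv {ψ : ℝ × ℝ → ℝ} (h : IsTestFunction ψ) :
    Continuous (spaceDeriv ψ) :=
  (h.contDiff.continuous_fderiv one_ne_zero).clm_apply continuous_const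

theorem IsTestFunction.exists_bound {ψ : ℝ × ℝ → ℝ} (h : IsTestFunction ψ) :
    ∃ B : ℝ, 0 ≤ B ∧ ∀ p, |ψ p| ≤ (tsupport ψ).indicator (fun _ => B) p ∧
      |timeDeriv ψ p| ≤ (tsupport ψ).indicator (fun _ => B) p ∧
      |spaceDeriv ψ p| ≤ (tsupport ψ).indicator (fun _ => B) p := by
  have hK : IsCompact (tsupport ψ) := h.hasCompactSupport
  obtain ⟨B₀, hB₀⟩ := hK.exists_bound_of_continuousOn h.contDiff.continuous.continuousOn
  obtain ⟨B₁, hB₁⟩ := hK.exists_bound_of_continuousOn h.continuous_timeDeriv.continuousOn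
  obtain ⟨B₂, hB₂⟩ := hK.exists_bound_of_continuousOn h.continuous_spaceDeriv.continuousOn
  refine ⟨max 0 (max B₀ (max B₁ B₂)), le_max_left _ _, fun p => ?_⟩
  by_cases hp : p ∈ tsupport ψ
  · simp only [Set.indicator_of_mem hp]
    refine ⟨(hB₀ p hp).trans ?_, (hB₁ p hp).trans ?_, (hB₂ p hp).trans ?_⟩ <;> simp
  · have h0 : fderiv ℝ ψ p = 0 :=
      Function.notMem_support.1 fun h' => hp (support_fderiv_subset ℝ h')
    simp [hp, timeDeriv, spaceDeriv, h0, image_eq_zero_of_notMem_tsupport hp]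

/-! ### Extension to negative times and Kruzhkov inequalities on the whole plane -/

/-- The flux of the Kruzhkov entropy, switched off before the initial time. -/
noncomputable def causalFlux (f : ℝ → ℝ) (p : ℝ × ℝ) (u k : ℝ) : ℝ :=
  if 0 < p.1 then kruzhkovFlux f u k else 0

/-- The first moments of the kernel are locally integrable. -/
def HasLocalMoment {X : Type*} [MeasurableSpace X] [TopologicalSpace X] (ν : Measure X)
    (κ : Kernel X ℝ) : Prop :=
  ∀ K : Set X, IsCompact K → ∫⁻ ξ in K, ∫⁻ u, ‖u‖ₑ ∂κ ξ ∂ν < ∞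

/-- The universal majorant: the integrands to come are compactly supported in `(t, x)` and grow at
most linearly in `u`. -/
theorem HasLocalMoment.integrable {κ : Kernel (ℝ × ℝ) ℝ} [IsMarkovKernel κ]
    (h : HasLocalMoment volume κ) {K : Set (ℝ × ℝ)} (hK : IsCompact K) (B : ℝ) :
    Integrable (fun z : (ℝ × ℝ) × ℝ => K.indicator (fun _ => B) z.1 * (1 + |z.2|))
      (volume ⊗ₘ κ) := by
  have hKm := hK.measurableSet
  have hmeas : Measurable fun z : (ℝ × ℝ) × ℝ => K.indicator (fun _ => B) z.1 * (1 + |z.2|) :=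
    ((measurable_const.indicator hKm).comp measurable_fst).mul (by fun_prop)
  refine ⟨hmeas.aestronglyMeasurable, ?_⟩
  rw [HasFiniteIntegral, Measure.lintegral_compProd (by fun_prop)]
  have : ∀ p : ℝ × ℝ, ∫⁻ u, ‖K.indicator (fun _ => B) p * (1 + |u|)‖ₑ ∂κ p
      ≤ K.indicator (fun p => ‖B‖ₑ * (1 + ∫⁻ u, ‖u‖ₑ ∂κ p)) p := fun p => by
    by_cases hp : p ∈ K
    · simp only [Set.indicator_of_mem hp, enorm_mul]
      rw [lintegral_const_mul _ (by fun_prop)]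
      gcongr
      calc ∫⁻ u, ‖1 + |u|‖ₑ ∂κ p ≤ ∫⁻ u, (1 + ‖u‖ₑ) ∂κ p := by
            refine lintegral_mono fun u => (enorm_add_le _ _).trans ?_
            simp
        _ = 1 + ∫⁻ u, ‖u‖ₑ ∂κ p := by
            rw [lintegral_add_left measurable_const]; simp
    · simp [hp]
  refine (lintegral_mono this).trans_lt ?_
  rw [lintegral_indicator hKm, lintegral_const_mul' _ _ enorm_ne_top,
    lintegral_add_left measurable_const]
  refine ENNReal.mul_lt_top enorm_lt_top (ENNReal.add_lt_top.2 ⟨?_, h K hK⟩)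
  simpa using hK.measure_lt_top

theorem continuous_kruzhkovFlux {f : ℝ → ℝ} (hf : Continuous f) :
    Continuous fun z : ℝ × ℝ => kruzhkovFlux f z.1 z.2 := by
  unfold kruzhkovFlux; fun_prop

theorem measurable_causalFlux {f : ℝ → ℝ} (hf : Continuous f) :
    Measurable fun z : (ℝ × ℝ) × ℝ × ℝ => causalFlux f z.1 z.2.1 z.2.2 := by
  unfold causalFlux
  exact Measurable.ite (measurableSet_lt measurable_const (by fun_prop))
    ((continuous_kruzhkovFlux hf).measurable.comp measurable_snd) measurable_const

/-- The Kruzhkov entropy inequalities on the whole plane for a kernel that does not depend on time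
before time zero; the initial condition is encoded by the values at negative times. -/
def KruzhkovIneq (f : ℝ → ℝ) (κ : Kernel (ℝ × ℝ) ℝ) : Prop :=
  ∀ (k : ℝ) (ψ : ℝ × ℝ → ℝ), IsTestFunction ψ → (∀ p, 0 ≤ ψ p) →
    0 ≤ ∫ z, (timeDeriv ψ z.1 * |z.2 - k| + spaceDeriv ψ z.1 * causalFlux f z.1 z.2 k)
      ∂(volume ⊗ₘ κ)

theorem measurableSet_past : MeasurableSet {p : ℝ × ℝ | p.1 < 0} :=
  measurableSet_lt measurable_fst measurable_const

open Classical in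
/-- The extension of a kernel on the half plane to negative times by its initial datum. -/
noncomputable def pastExtension (σ : Kernel ℝ ℝ) (κ : Kernel (ℝ × ℝ) ℝ) : Kernel (ℝ × ℝ) ℝ :=
  Kernel.piecewise measurableSet_past (σ.comap Prod.snd measurable_snd) κ

theorem pastExtension_of_neg (σ : Kernel ℝ ℝ) (κ : Kernel (ℝ × ℝ) ℝ) {p : ℝ × ℝ} (h : p.1 < 0) :
    pastExtension σ κ p = σ p.2 := by
  simp [pastExtension, Kernel.piecewise_apply, h]

theorem pastExtension_of_nonneg (σ : Kernel ℝ ℝ) (κ : Kernel (ℝ × ℝ) ℝ) {p : ℝ × ℝ}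
    (h : 0 ≤ p.1) : pastExtension σ κ p = κ p := by
  simp [pastExtension, Kernel.piecewise_apply, h]

instance (σ : Kernel ℝ ℝ) (κ : Kernel (ℝ × ℝ) ℝ) [IsMarkovKernel σ] [IsMarkovKernel κ] :
    IsMarkovKernel (pastExtension σ κ) := by
  unfold pastExtension; infer_instance

theorem compl_past : {p : ℝ × ℝ | p.1 < 0}ᶜ = halfPlane := by
  ext p; simp [halfPlane]

theorem measurableSet_halfPlane : MeasurableSet halfPlane := by
  rw [← compl_past]; exact measurableSet_past.compl

theorem restrict_past : (volume : Measure (ℝ × ℝ)).restrict {p : ℝ × ℝ | p.1 < 0}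
    = (volume.restrict (Set.Iio (0 : ℝ))).prod (volume : Measure ℝ) := by
  have : {p : ℝ × ℝ | p.1 < 0} = Set.Iio 0 ×ˢ Set.univ := by ext p; simp
  rw [this, Measure.volume_eq_prod, ← Measure.prod_restrict, Measure.restrict_univ]

theorem HasLocalMoment.pastExtension {σ : Kernel ℝ ℝ} {κ : Kernel (ℝ × ℝ) ℝ}
    (hσ : HasLocalMoment volume σ) (hκ : HasLocalMoment halfVol κ) :
    HasLocalMoment volume (pastExtension σ κ) := by
  intro K hK
  have hKm := hK.measurableSet
  rw [← lintegral_add_compl _ measurableSet_past, compl_past, Measure.restrict_restrict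
    measurableSet_past, Measure.restrict_restrict measurableSet_halfPlane]
  refine ENNReal.add_lt_top.2 ⟨?_, ?_⟩
  · have h1 : IsCompact (Prod.fst '' K) := hK.image continuous_fst
    have h2 : IsCompact (Prod.snd '' K) := hK.image continuous_snd
    calc ∫⁻ p in {p : ℝ × ℝ | p.1 < 0} ∩ K, ∫⁻ u, ‖u‖ₑ ∂_root_.pastExtension σ κ p
        = ∫⁻ p in {p : ℝ × ℝ | p.1 < 0} ∩ K, ∫⁻ u, ‖u‖ₑ ∂σ p.2 := by
          refine setLIntegral_congr_fun (measurableSet_past.inter hKm) fun p hp => ?_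
          simp only [pastExtension_of_neg σ κ hp.1]
      _ ≤ ∫⁻ p in (Prod.fst '' K) ×ˢ (Prod.snd '' K), 1 * ∫⁻ u, ‖u‖ₑ ∂σ p.2 := by
          simp only [one_mul]
          exact lintegral_mono_set fun p hp => ⟨⟨p, hp.2, rfl⟩, ⟨p, hp.2, rfl⟩⟩
      _ = volume (Prod.fst '' K) * ∫⁻ x in Prod.snd '' K, ∫⁻ u, ‖u‖ₑ ∂σ x := by
          rw [Measure.volume_eq_prod, ← Measure.prod_restrict,
            lintegral_prod_mul (f := fun _ => 1) (g := fun x => ∫⁻ u, ‖u‖ₑ ∂σ x)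
              aemeasurable_const ((measurable_enorm.lintegral_kernel).aemeasurable)]
          simp
      _ < ∞ := ENNReal.mul_lt_top h1.measure_lt_top (hσ _ h2)
  · calc ∫⁻ p in halfPlane ∩ K, ∫⁻ u, ‖u‖ₑ ∂_root_.pastExtension σ κ p
        = ∫⁻ p in halfPlane ∩ K, ∫⁻ u, ‖u‖ₑ ∂κ p := by
          refine setLIntegral_congr_fun (measurableSet_halfPlane.inter hKm) fun p hp => ?_
          simp only [pastExtension_of_nonneg σ κ hp.1.1]
      _ = ∫⁻ p in K, ∫⁻ u, ‖u‖ₑ ∂κ p ∂halfVol := by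
          rw [halfVol, Measure.restrict_restrict hKm, Set.inter_comm]
      _ < ∞ := hκ K hK

theorem ae_pastExtension {σ : Kernel ℝ ℝ} {κ : Kernel (ℝ × ℝ) ℝ} [IsMarkovKernel σ]
    [IsMarkovKernel κ] {I : Set ℝ}
    (h : ∀ᵐ p ∂halfVol, ∀ᵐ u ∂κ p, u ∈ I) :
    ∀ᵐ p : ℝ × ℝ, 0 < p.1 → ∀ᵐ u ∂pastExtension σ κ p, u ∈ I := by
  rw [halfVol, ae_restrict_iff' measurableSet_halfPlane] at h
  filter_upwards [h] with p hp h0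
  rw [pastExtension_of_nonneg σ κ h0.le]
  exact hp ⟨h0.le, trivial⟩

theorem ae_compProd_future {κ : Kernel (ℝ × ℝ) ℝ} {I : Set ℝ}
    (hI : I.OrdConnected) (h : ∀ᵐ p : ℝ × ℝ, 0 < p.1 → ∀ᵐ u ∂κ p, u ∈ I) :
    ∀ᵐ z ∂((volume : Measure (ℝ × ℝ)) ⊗ₘ κ), 0 < z.1.1 → z.2 ∈ I := by
  refine Measure.ae_compProd_of_ae_ae ?_ ?_
  · have h1 : MeasurableSet {z : (ℝ × ℝ) × ℝ | 0 < z.1.1} :=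
      measurableSet_lt measurable_const (by fun_prop)
    have h2 : MeasurableSet {z : (ℝ × ℝ) × ℝ | z.2 ∈ I} := measurable_snd hI.measurableSet
    exact h1.imp h2
  · filter_upwards [h] with p hp
    by_cases h0 : 0 < p.1
    · filter_upwards [hp h0] with u hu _ using hu
    · exact ae_of_all _ fun u h' => absurd h' h0

theorem timeDeriv_eq_deriv {ψ : ℝ × ℝ → ℝ} (h : IsTestFunction ψ) (t x : ℝ) :
    timeDeriv ψ (t, x) = deriv (fun s => ψ (s, x)) t := by
  have h1 : HasFDerivAt ψ (fderiv ℝ ψ (t, x)) (t, x) :=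
    (h.contDiff.differentiable one_ne_zero _).hasFDerivAt
  have h2 : HasDerivAt (fun s : ℝ => (s, x)) (1, 0) t :=
    (hasDerivAt_id t).prodMk (hasDerivAt_const t x)
  exact (h1.comp_hasDerivAt t h2).deriv.symm

theorem setIntegral_timeDeriv {ψ : ℝ × ℝ → ℝ} (h : IsTestFunction ψ) (x : ℝ) :
    ∫ t in Set.Iio (0 : ℝ), timeDeriv ψ (t, x) = ψ (0, x) := by
  rw [← integral_Iic_eq_integral_Iio]
  simp only [timeDeriv_eq_deriv h]
  refine HasCompactSupport.integral_Iic_deriv_eq (f := fun s => ψ (s, x)) ?_ ?_ 0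
  · exact h.contDiff.comp (contDiff_id.prodMk contDiff_const)
  · refine HasCompactSupport.intro (h.hasCompactSupport.image continuous_fst) fun t ht => ?_
    by_contra h0
    exact ht ⟨(t, x), subset_tsupport _ h0, rfl⟩


/-- The majorant is chosen before `a` and `b` and depends on their growth constant only; one `D`
therefore serves a whole sequence in dominated convergence. -/
theorem IsTestFunction.exists_dominating {ψ : ℝ × ℝ → ℝ} (hψ : IsTestFunction ψ)
    {κ : Kernel (ℝ × ℝ) ℝ} [IsMarkovKernel κ] (hm : HasLocalMoment volume κ) (A : ℝ) :
    ∃ D : (ℝ × ℝ) × ℝ → ℝ, Integrable D (volume ⊗ₘ κ) ∧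
      ∀ a b : (ℝ × ℝ) × ℝ → ℝ, (∀ᵐ z ∂((volume : Measure (ℝ × ℝ)) ⊗ₘ κ),
        |a z| ≤ A * (1 + |z.2|) ∧ |b z| ≤ A * (1 + |z.2|)) →
      ∀ᵐ z ∂((volume : Measure (ℝ × ℝ)) ⊗ₘ κ),
        ‖timeDeriv ψ z.1 * a z + spaceDeriv ψ z.1 * b z‖ ≤ D z := by
  obtain ⟨B, hB, hψB⟩ := hψ.exists_bound
  have hD := hm.integrable hψ.hasCompactSupport (2 * A * B)
  refine ⟨_, hD, ?_⟩
  intro a b hab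
  filter_upwards [hab] with z hz
  obtain ⟨-, h1, h2⟩ := hψB z.1
  by_cases hp : z.1 ∈ tsupport ψ
  · simp only [Set.indicator_of_mem hp] at h1 h2 ⊢
    refine (norm_add_le _ _).trans ?_
    rw [norm_mul, norm_mul, Real.norm_eq_abs, Real.norm_eq_abs, Real.norm_eq_abs,
      Real.norm_eq_abs]
    have e1 := mul_le_mul h1 hz.1 (abs_nonneg _) hB
    have e2 := mul_le_mul h2 hz.2 (abs_nonneg _) hB
    linarith
  · simp only [Set.indicator_of_notMem hp, abs_nonpos_iff] at h1 h2 ⊢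
    simp [h1, h2]

theorem IsTestFunction.integrable {ψ : ℝ × ℝ → ℝ} (hψ : IsTestFunction ψ)
    {κ : Kernel (ℝ × ℝ) ℝ} [IsMarkovKernel κ] (hm : HasLocalMoment volume κ)
    {a b : (ℝ × ℝ) × ℝ → ℝ} (ha : Measurable a) (hb : Measurable b) {A : ℝ}
    (hab : ∀ᵐ z ∂((volume : Measure (ℝ × ℝ)) ⊗ₘ κ),
      |a z| ≤ A * (1 + |z.2|) ∧ |b z| ≤ A * (1 + |z.2|)) :
    Integrable (fun z => timeDeriv ψ z.1 * a z + spaceDeriv ψ z.1 * b z) (volume ⊗ₘ κ) := by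
  obtain ⟨D, hD, hle⟩ := hψ.exists_dominating hm A
  have h1 := hψ.continuous_timeDeriv.measurable
  have h2 := hψ.continuous_spaceDeriv.measurable
  exact hD.mono' (Measurable.aestronglyMeasurable (by fun_prop)) (hle a b hab)

/-- In the past the flux is off and the pairing with `η` does not depend on time; integrating `∂ₜψ`
over negative times at fixed `x` produces `ψ (0, x)`, hence the initial term. The growth bound on
`q` is needed only on `I`, since the flux acts only at positive times, where `κ` is carried by `I`.
-/
theorem integral_pastExtension {σ : Kernel ℝ ℝ} {κ : Kernel (ℝ × ℝ) ℝ} [IsMarkovKernel σ]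
    [IsMarkovKernel κ] (hσ : HasLocalMoment volume σ) (hκ : HasLocalMoment halfVol κ)
    {I : Set ℝ} (hI : I.OrdConnected) (hκI : ∀ᵐ p ∂halfVol, ∀ᵐ u ∂κ p, u ∈ I)
    {η q : ℝ → ℝ} (hη : Continuous η) (hq : Continuous q) {A : ℝ}
    (hηA : ∀ u, |η u| ≤ A * (1 + |u|)) (hqA : ∀ u ∈ I, |q u| ≤ A * (1 + |u|))
    {ψ : ℝ × ℝ → ℝ} (hψ : IsTestFunction ψ) :
    ∫ z, (timeDeriv ψ z.1 * η z.2 + spaceDeriv ψ z.1 * (if 0 < z.1.1 then q z.2 else 0))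
        ∂(volume ⊗ₘ pastExtension σ κ)
      = (∫ p, (timeDeriv ψ p * (∫ u, η u ∂κ p) + spaceDeriv ψ p * (∫ u, q u ∂κ p)) ∂halfVol)
        + ∫ x, ψ (0, x) * ∫ u, η u ∂σ x := by
  have hm := hσ.pastExtension hκ
  have hA : 0 ≤ A := by have := (abs_nonneg _).trans (hηA 0); simpa using this
  have hfut := ae_compProd_future hI (ae_pastExtension (σ := σ) hκI)
  have hint : Integrable (fun z : (ℝ × ℝ) × ℝ => timeDeriv ψ z.1 * η z.2
      + spaceDeriv ψ z.1 * (if 0 < z.1.1 then q z.2 else 0))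
      (volume ⊗ₘ pastExtension σ κ) := by
    have h := hψ.integrable hm (a := fun z => η z.2)
      (b := fun z => if 0 < z.1.1 then q z.2 else 0) (A := A) (hη.measurable.comp measurable_snd)
      (Measurable.ite (measurableSet_lt measurable_const (by fun_prop))
        (hq.measurable.comp measurable_snd) measurable_const) ?_
    · exact h
    · filter_upwards [hfut] with z hz
      refine ⟨hηA _, ?_⟩
      split_ifs with h0
      · exact hqA _ (hz h0)
      · simp only [abs_zero]; positivity
  rw [Measure.integral_compProd hint]
  have hint' : Integrable (fun p => ∫ u, (timeDeriv ψ p * η u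
      + spaceDeriv ψ p * (if 0 < p.1 then q u else 0)) ∂pastExtension σ κ p) volume :=
    Integrable.integral_compProd (κ := Kernel.const Unit volume)
      (η := Kernel.prodMkLeft Unit (pastExtension σ κ)) (a := ()) hint
  rw [← integral_add_compl measurableSet_past hint', compl_past, add_comm]
  congr 1
  · refine integral_congr_ae ?_
    -- Exhausting by balls turns locally integrable first moments into finite first moments almost
    -- everywhere, so `η` and `q` can be integrated separately.
    have hfin : ∀ᵐ p ∂halfVol, ∫⁻ u, ‖u‖ₑ ∂κ p < ∞ := by
      have : ∀ n : ℕ, ∀ᵐ p ∂halfVol, p ∈ Metric.closedBall (0 : ℝ × ℝ) n →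
          ∫⁻ u, ‖u‖ₑ ∂κ p < ∞ := fun n => by
        rw [← ae_restrict_iff' Metric.isClosed_closedBall.measurableSet]
        exact ae_lt_top (measurable_enorm.lintegral_kernel)
          (hκ _ (isCompact_closedBall _ _)).ne
      filter_upwards [ae_all_iff.2 this] with p hp
      obtain ⟨n, hn⟩ := exists_nat_ge ‖p‖
      exact hp n (by simpa using hn)
    have hpos : ∀ᵐ p ∂halfVol, 0 < p.1 := by
      rw [halfVol, ae_restrict_iff' measurableSet_halfPlane]
      have h0 : ∀ᵐ p : ℝ × ℝ, p.1 ≠ 0 := by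
        have : Measure.QuasiMeasurePreserving (Prod.fst : ℝ × ℝ → ℝ) volume volume :=
          Measure.quasiMeasurePreserving_fst
        exact this.ae (p := fun t => t ≠ 0) (by simp [ae_iff])
      filter_upwards [h0] with p hp hp'
      exact lt_of_le_of_ne hp'.1 (Ne.symm hp)
    filter_upwards [hfin, hpos, hκI] with p hp h0 hpI
    have hu : Integrable (fun u : ℝ => A * (1 + |u|)) (κ p) := by
      have : Integrable (fun u : ℝ => u) (κ p) := ⟨by fun_prop, hp⟩
      exact ((integrable_const _).add this.abs).const_mul _
    have h1 : Integrable η (κ p) :=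
      hu.mono' hη.aestronglyMeasurable (ae_of_all _ hηA)
    have h2 : Integrable q (κ p) := by
      refine hu.mono' hq.aestronglyMeasurable ?_
      filter_upwards [hpI] with u hu using hqA u hu
    simp only [pastExtension_of_nonneg σ κ h0.le, h0, if_true]
    rw [integral_add (h1.const_mul _) (h2.const_mul _), integral_const_mul, integral_const_mul]
  · have hcongr : ∀ p ∈ {p : ℝ × ℝ | p.1 < 0}, ∫ u, (timeDeriv ψ p * η u
        + spaceDeriv ψ p * (if 0 < p.1 then q u else 0)) ∂pastExtension σ κ p
        = timeDeriv ψ p * ∫ u, η u ∂σ p.2 := fun p hp => by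
      have hp' : p.1 < 0 := hp
      simp only [pastExtension_of_neg σ κ hp', hp'.not_gt, if_false, mul_zero, add_zero]
      rw [integral_const_mul]
    rw [setIntegral_congr_fun measurableSet_past hcongr]
    have hint'' := (integrableOn_congr_fun hcongr measurableSet_past).1 hint'.integrableOn
    rw [IntegrableOn, restrict_past] at hint''
    rw [restrict_past, integral_prod_symm _ hint'']
    refine integral_congr_ae (ae_of_all _ fun x => ?_)
    simp only
    rw [integral_mul_const, setIntegral_timeDeriv hψ]

theorem kruzhkovIneq_pastExtension {f : ℝ → ℝ} (hf : ContDiff ℝ 1 f) {σ : Kernel ℝ ℝ}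
    {κ : Kernel (ℝ × ℝ) ℝ} [IsMarkovKernel σ] [IsMarkovKernel κ] (hσ : HasLocalMoment volume σ)
    (hκ : HasLocalMoment halfVol κ) {C : ℝ≥0} {I : Set ℝ} (hI : I.OrdConnected)
    (hC : LipschitzOnWith C f I) {c : ℝ} (hc : c ∈ I)
    (hκI : ∀ᵐ p ∂halfVol, ∀ᵐ u ∂κ p, u ∈ I)
    (hent : ∀ η q : ℝ → ℝ, IsEntropyPair f η q →
      ∀ ψ : ℝ × ℝ → ℝ, IsTestFunction ψ → (∀ p ∈ halfPlane, 0 ≤ ψ p) →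
      0 ≤ (∫ p, (timeDeriv ψ p * (∫ u, η u ∂κ p) + spaceDeriv ψ p * (∫ u, q u ∂κ p)) ∂halfVol)
        + ∫ x, ψ (0, x) * ∫ u, η u ∂σ x) :
    KruzhkovIneq f (pastExtension σ κ) := by
  intro k ψ hψ hψ0
  have hm := hσ.pastExtension hκ
  have hfut := ae_compProd_future hI (ae_pastExtension (σ := σ) hκI)
  set A₁ : ℝ := abs (∫ v in k..c, abs (deriv f v))
  -- A growth constant valid for all regularizations at once: `1 + |k|` serves the entropies, `A₁`
  -- the part of the flux from `k` to `c`, and `C * (1 + |c|)` the part from `c` to `u`.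
  set A : ℝ := 1 + |k| + A₁ + C * (1 + |c|) with hAdef
  have hA₁ : 0 ≤ A₁ := abs_nonneg _
  have hCA : 0 ≤ (C : ℝ) * (1 + |c|) := by positivity
  have hηA : ∀ n u, |smoothEntropy (fun _ => 1) n k u| ≤ A * (1 + |u|) := fun n u => by
    refine (abs_smoothEntropy_one_le n k u).trans ((abs_sub u k).trans ?_)
    nlinarith [abs_nonneg u, abs_nonneg k, mul_nonneg (abs_nonneg u) (abs_nonneg k),
      mul_nonneg hA₁ (abs_nonneg u), mul_nonneg hCA (abs_nonneg u)]
  have hqA : ∀ n, ∀ u ∈ I, |smoothEntropy (deriv f) n k u| ≤ A * (1 + |u|) := fun n u hu => by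
    refine (abs_smoothEntropy_deriv_le hf hI hC hc n k hu).trans ?_
    have h1 : (C : ℝ) * |u - c| ≤ C * (1 + |c|) * (1 + |u|) := by
      rw [mul_assoc]
      refine mul_le_mul_of_nonneg_left ((abs_sub u c).trans ?_) C.2
      nlinarith [abs_nonneg u, abs_nonneg c, mul_nonneg (abs_nonneg u) (abs_nonneg c)]
    have h2 : A₁ ≤ (1 + |k| + A₁) * (1 + |u|) := by
      nlinarith [abs_nonneg u, abs_nonneg k, mul_nonneg (abs_nonneg u) (abs_nonneg k),
        mul_nonneg hA₁ (abs_nonneg u)]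
    rw [hAdef, add_mul _ ((C : ℝ) * (1 + |c|))]
    linarith
  have hAb : ∀ n, ∀ᵐ z ∂((volume : Measure (ℝ × ℝ)) ⊗ₘ pastExtension σ κ),
      |smoothEntropy (fun _ => 1) n k z.2| ≤ A * (1 + |z.2|) ∧
      |if 0 < z.1.1 then smoothEntropy (deriv f) n k z.2 else 0| ≤ A * (1 + |z.2|) := fun n => by
    filter_upwards [hfut] with z hz
    refine ⟨hηA n z.2, ?_⟩
    split_ifs with h0
    · exact hqA n z.2 (hz h0)
    · rw [abs_zero]; positivity
  have hpair := fun n => isEntropyPair_smoothEntropy hf n k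
  have hηc := fun n => (hpair n).contDiff_entropy.continuous
  have hqc := fun n => (hpair n).contDiff_flux.continuous
  have hmeas1 : ∀ n, Measurable fun z : (ℝ × ℝ) × ℝ => smoothEntropy (fun _ => 1) n k z.2 :=
    fun n => (hηc n).measurable.comp measurable_snd
  have hmeas2 : ∀ n, Measurable fun z : (ℝ × ℝ) × ℝ =>
      if 0 < z.1.1 then smoothEntropy (deriv f) n k z.2 else 0 := fun n =>
    Measurable.ite (measurableSet_lt measurable_const (by fun_prop))
      ((hqc n).measurable.comp measurable_snd) measurable_const
  obtain ⟨D, hD, hDle⟩ := hψ.exists_dominating hm A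
  have hnonneg : ∀ n, 0 ≤ ∫ z, (timeDeriv ψ z.1 * smoothEntropy (fun _ => 1) n k z.2
      + spaceDeriv ψ z.1 * (if 0 < z.1.1 then smoothEntropy (deriv f) n k z.2 else 0))
        ∂(volume ⊗ₘ pastExtension σ κ) := fun n => by
    rw [integral_pastExtension hσ hκ hI hκI (hηc n) (hqc n) (hηA n) (hqA n) hψ]
    exact hent _ _ (hpair n) ψ hψ fun p _ => hψ0 p
  refine ge_of_tendsto' (tendsto_integral_of_dominated_convergence D (fun n => ?_) hD
    (fun n => hDle _ _ (hAb n)) (ae_of_all _ fun z => ?_)) hnonneg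
  · exact (((hψ.continuous_timeDeriv.measurable.comp measurable_fst).mul (hmeas1 n)).add
      ((hψ.continuous_spaceDeriv.measurable.comp measurable_fst).mul
        (hmeas2 n))).aestronglyMeasurable
  · refine ((tendsto_smoothEntropy_one k z.2).const_mul _).add (Tendsto.const_mul _ ?_)
    unfold causalFlux
    split_ifs with h0
    · exact tendsto_smoothEntropy hf k z.2
    · exact tendsto_const_nhds

/-! ### Tools for doubling the variables: translations, mollifiers, flux bounds -/

/-- Continuity of translations in `L¹` on compact sets. -/
theorem exists_translation_le {y : ℝ × ℝ → ℝ} (hy : Measurable y) {M : ℝ} (hM : ∀ p, |y p| ≤ M)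
    {K : Set (ℝ × ℝ)} (hK : IsCompact K) {η : ℝ} (hη : 0 < η) :
    ∃ δ > 0, ∀ w : ℝ × ℝ, ‖w‖ ≤ δ → ∫⁻ p in K, ‖y (p - w) - y p‖ₑ ≤ ENNReal.ofReal η := by
  -- A bounded `y` need not be integrable on the plane. Cutting it off outside the `1`-neighbourhood
  -- of `K` changes nothing for `p ∈ K` and `‖w‖ ≤ 1`, and the truncated function is close in L¹ to
  -- a uniformly continuous one.
  set K' := Metric.cthickening 1 K with hK'
  have hK'c : IsCompact K' := hK.cthickening
  have hgint : Integrable (K'.indicator y) volume := by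
    rw [integrable_indicator_iff hK'c.measurableSet]
    exact Measure.integrableOn_of_bounded hK'c.measure_lt_top.ne hy.aestronglyMeasurable
      (ae_of_all _ hM)
  have hη3 : ENNReal.ofReal (η / 3) ≠ 0 := by simpa using by positivity
  obtain ⟨v, hvs, hv, hvc, hvi⟩ := hgint.exists_hasCompactSupport_lintegral_sub_le hη3
  have huc : UniformContinuous v := hvs.uniformContinuous_of_continuous hvc
  set b := η / 3 / (volume.real K + 1) with hb
  have hvolK : 0 ≤ volume.real K := measureReal_nonneg
  obtain ⟨δ, hδ, huc'⟩ := Metric.uniformContinuous_iff.1 huc b (by positivity)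
  refine ⟨min 1 (δ / 2), by positivity, fun w hw => ?_⟩
  set g := K'.indicator y with hg
  have hle : ∀ p ∈ K, ‖y (p - w) - y p‖ₑ
      ≤ ‖g (p - w) - v (p - w)‖ₑ + ENNReal.ofReal b + ‖g p - v p‖ₑ := fun p hp => by
    have e1 : g p = y p := Set.indicator_of_mem (Metric.self_subset_cthickening K hp) y
    have e2 : g (p - w) = y (p - w) := by
      refine Set.indicator_of_mem (Metric.mem_cthickening_of_dist_le _ p _ _ hp ?_) y
      rw [dist_eq_norm, sub_sub_cancel_left, norm_neg]
      exact hw.trans (min_le_left _ _)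
    have e3 : ‖v (p - w) - v p‖ₑ ≤ ENNReal.ofReal b := by
      rw [← ofReal_norm]
      refine ENNReal.ofReal_le_ofReal ?_
      rw [← dist_eq_norm]
      refine (huc' ?_).le
      rw [dist_eq_norm, sub_sub_cancel_left, norm_neg]
      exact (hw.trans (min_le_right _ _)).trans_lt (by linarith)
    have e4 : y (p - w) - y p
        = (g (p - w) - v (p - w)) + (v (p - w) - v p) + -(g p - v p) := by rw [e1, e2]; ring
    rw [e4]
    refine (enorm_add_le _ _).trans (add_le_add ((enorm_add_le _ _).trans ?_) (by rw [enorm_neg]))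
    exact add_le_add le_rfl e3
  have hgm : Measurable g := hy.indicator hK'c.measurableSet
  have hvm : Measurable v := hvc.measurable
  calc ∫⁻ p in K, ‖y (p - w) - y p‖ₑ
      ≤ ∫⁻ p in K, (‖g (p - w) - v (p - w)‖ₑ + ENNReal.ofReal b + ‖g p - v p‖ₑ) :=
        setLIntegral_mono (by fun_prop) hle
    _ = (∫⁻ p in K, ‖g (p - w) - v (p - w)‖ₑ) + ENNReal.ofReal b * volume K
          + (∫⁻ p in K, ‖g p - v p‖ₑ) := by
        rw [lintegral_add_left (by fun_prop), lintegral_add_left (by fun_prop)]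
        simp
    _ ≤ ENNReal.ofReal (η / 3) + ENNReal.ofReal (η / 3) + ENNReal.ofReal (η / 3) := by
        refine add_le_add (add_le_add ?_ ?_) ((setLIntegral_le_lintegral _ _).trans hv)
        · refine (setLIntegral_le_lintegral _ _).trans ?_
          rw [lintegral_sub_right_eq_self (fun p => ‖g p - v p‖ₑ) w]
          exact hv
        · rw [← ENNReal.ofReal_toReal hK.measure_lt_top.ne, ← ENNReal.ofReal_mul (by positivity)]
          refine ENNReal.ofReal_le_ofReal ?_
          change b * volume.real K ≤ η / 3
          rw [hb, div_mul_eq_mul_div, div_le_iff₀ (by positivity)]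
          nlinarith
    _ = ENNReal.ofReal η := by
        rw [← ENNReal.ofReal_add (by positivity) (by positivity),
          ← ENNReal.ofReal_add (by positivity) (by positivity)]
        congr 1; ring

/-- Smooth anisotropic mollifiers with support in positive times. The bound on the space derivative
does not depend on the width in time. -/
theorem exists_mollifier {δ : ℝ} (hδ : 0 < δ) : ∃ c : ℝ, 0 ≤ c ∧ ∀ ε > 0, ∃ J : ℝ × ℝ → ℝ,
    IsTestFunction J ∧ (∀ p, 0 ≤ J p) ∧ (∀ p, J p ≠ 0 → 0 < p.1 ∧ p.1 < ε ∧ |p.2| ≤ δ) ∧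
    (∀ p, spaceDeriv J p ≠ 0 → 0 < p.1 ∧ p.1 < ε) ∧ ∫ p, J p = 1 ∧
    ∫ p, |spaceDeriv J p| ≤ c := by
  let ωb : ContDiffBump (0 : ℝ) := ⟨δ / 2, δ, by positivity, by linarith⟩
  set ω := ωb.normed volume with hω
  have hωc : ContDiff ℝ 1 ω := ωb.contDiff_normed
  -- The spatial profile `ω` is fixed before `ε`, and the temporal profile `ρ` below has mass one,
  -- so the L¹ norm of the space derivative is `∫ |ω'|` for every `ε`.
  refine ⟨∫ x, |deriv ω x|, integral_nonneg fun _ => abs_nonneg _, fun ε hε => ?_⟩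
  let ρb : ContDiffBump (ε / 2) := ⟨ε / 8, ε / 4, by positivity, by linarith⟩
  set ρ := ρb.normed volume with hρ
  have hρc : ContDiff ℝ 1 ρ := ρb.contDiff_normed
  have hρsupp : ∀ t, ρ t ≠ 0 → 0 < t ∧ t < ε := fun t ht => by
    have : t ∈ Function.support ρ := ht
    rw [hρ, ρb.support_normed_eq, Metric.mem_ball, Real.dist_eq, abs_lt] at this
    have h1 : ρb.rOut = ε / 4 := rfl
    rw [h1] at this
    constructor <;> linarith [this.1, this.2]
  have hderiv : ∀ p : ℝ × ℝ, spaceDeriv (fun p => ρ p.1 * ω p.2) p = ρ p.1 * deriv ω p.2 := by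
    intro p
    have h1 : HasFDerivAt (fun p : ℝ × ℝ => ρ p.1) (deriv ρ p.1 • ContinuousLinearMap.fst ℝ ℝ ℝ) p :=
      (hρc.differentiable one_ne_zero p.1).hasDerivAt.comp_hasFDerivAt p hasFDerivAt_fst
    have h2 : HasFDerivAt (fun p : ℝ × ℝ => ω p.2) (deriv ω p.2 • ContinuousLinearMap.snd ℝ ℝ ℝ) p :=
      (hωc.differentiable one_ne_zero p.2).hasDerivAt.comp_hasFDerivAt p hasFDerivAt_snd
    have h3 : HasFDerivAt (fun p : ℝ × ℝ => ρ p.1 * ω p.2) _ p := h1.mul h2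
    rw [spaceDeriv, h3.fderiv]
    simp
  refine ⟨fun p => ρ p.1 * ω p.2, ⟨?_, ?_⟩, fun p => ?_, fun p hp => ?_, fun p hp => ?_, ?_, ?_⟩
  · exact (hρc.comp contDiff_fst).mul (hωc.comp contDiff_snd)
  · refine HasCompactSupport.intro
      (ρb.hasCompactSupport_normed (μ := volume) |>.prod (ωb.hasCompactSupport_normed (μ := volume)))
      fun p hp => ?_
    by_contra h0
    exact hp ⟨subset_tsupport _ (left_ne_zero_of_mul h0), subset_tsupport _ (right_ne_zero_of_mul h0)⟩
  · exact mul_nonneg (ρb.nonneg_normed _) (ωb.nonneg_normed _)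
  · refine ⟨(hρsupp _ (left_ne_zero_of_mul hp)).1, (hρsupp _ (left_ne_zero_of_mul hp)).2, ?_⟩
    have : p.2 ∈ Function.support ω := right_ne_zero_of_mul hp
    rw [hω, ωb.support_normed_eq, Metric.mem_ball, Real.dist_eq, sub_zero] at this
    exact this.le
  · rw [hderiv] at hp
    exact hρsupp _ (left_ne_zero_of_mul hp)
  · rw [Measure.volume_eq_prod, integral_prod_mul, ρb.integral_normed, ωb.integral_normed, one_mul]
  · simp only [hderiv, abs_mul]
    rw [Measure.volume_eq_prod, integral_prod_mul (fun t => |ρ t|) (fun x => |deriv ω x|)]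
    have : ∫ t, |ρ t| = 1 := by
      rw [← ρb.integral_normed (μ := volume)]
      exact integral_congr_ae (ae_of_all _ fun t => abs_of_nonneg (ρb.nonneg_normed t))
    rw [this, one_mul]

theorem abs_kruzhkovFlux (f : ℝ → ℝ) (u k : ℝ) : |kruzhkovFlux f u k| = |f u - f k| := by
  rcases le_total u k with h | h <;> simp [kruzhkovFlux, h, abs_sub_comm]

theorem kruzhkovFlux_comm (f : ℝ → ℝ) (u k : ℝ) : kruzhkovFlux f u k = kruzhkovFlux f k u := by
  simp [kruzhkovFlux, max_comm, min_comm]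

/-- If `u` is not between `k` and `l`, then `f u` cancels and only `f k - f l` remains up to sign;
if it is, then `u ∈ S` by convexity and both increments are controlled. Hence `u` itself is
unrestricted. -/
theorem abs_kruzhkovFlux_sub_le {f : ℝ → ℝ} {L : ℝ≥0} {S : Set ℝ} (hS : S.OrdConnected)
    (hL : LipschitzOnWith L f S) (u : ℝ) {k l : ℝ} (hk : k ∈ S) (hl : l ∈ S) :
    |kruzhkovFlux f u k - kruzhkovFlux f u l| ≤ L * |k - l| := by
  have hLip : ∀ {a b}, a ∈ S → b ∈ S → |f a - f b| ≤ L * |a - b| := fun ha hb => by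
    simpa [Real.dist_eq] using hL.dist_le_mul _ ha _ hb
  wlog hkl : k ≤ l generalizing k l
  · rw [abs_sub_comm, abs_sub_comm k]; exact this hl hk (le_of_not_ge hkl)
  rcases le_total u k with h1 | h1
  · have h2 : u ≤ l := h1.trans hkl
    simpa [kruzhkovFlux, h1, h2] using hLip hk hl
  · rcases le_total u l with h2 | h2
    · have hu : u ∈ S := hS.out hk hl ⟨h1, h2⟩
      have e1 := abs_le.1 (hLip hu hk)
      have e2 := abs_le.1 (hLip hl hu)
      rw [abs_of_nonneg (sub_nonneg.2 h1)] at e1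
      rw [abs_of_nonneg (sub_nonneg.2 h2)] at e2
      rw [abs_sub_comm k l, abs_of_nonneg (sub_nonneg.2 hkl)]
      simp only [kruzhkovFlux, max_eq_left h1, min_eq_right h1, max_eq_right h2, min_eq_left h2]
      rw [abs_le]
      constructor <;> linarith [e1.1, e1.2, e2.1, e2.2]
    · have := hLip hl hk
      simpa [kruzhkovFlux, h1, h2, abs_sub_comm] using this

/-- In the doubling, `k` is a value of the extended `y`; at negative times this is a value of the
initial datum, not known to lie in `I`. So `f k` is bounded by compactness of `[-M, M]`, and only
`u` uses the Lipschitz bound on `I`. -/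
theorem exists_kruzhkovFlux_bound {f : ℝ → ℝ} (hf : Continuous f) {C : ℝ≥0} {I : Set ℝ}
    (hC : LipschitzOnWith C f I) {c : ℝ} (hc : c ∈ I) (M : ℝ) :
    ∃ A, 0 ≤ A ∧ ∀ u k, |k| ≤ M → |u - k| ≤ A * (1 + |u|) ∧
      (u ∈ I → |kruzhkovFlux f u k| ≤ A * (1 + |u|)) := by
  obtain ⟨B, hB⟩ := (isCompact_Icc (a := -M) (b := M)).exists_bound_of_continuousOn hf.continuousOn
  refine ⟨1 + |M| + C * (1 + |c|) + |f c| + |B|, by positivity, fun u k hk => ⟨?_, fun hu => ?_⟩⟩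
  · have hA : 0 ≤ C * (1 + |c|) + |f c| + |B| := by positivity
    have h1 : |k| ≤ |M| := hk.trans (le_abs_self M)
    have := abs_sub u k
    nlinarith [abs_nonneg u, mul_nonneg hA (abs_nonneg u), mul_nonneg (abs_nonneg M) (abs_nonneg u)]
  · rw [abs_kruzhkovFlux]
    have h1 : |f u - f c| ≤ C * |u - c| := by simpa [Real.dist_eq] using hC.dist_le_mul _ hu _ hc
    have h2 : |f k| ≤ |B| := (hB k (abs_le.1 hk)).trans (le_abs_self B)
    have h3 : |f u - f k| ≤ |f u - f c| + |f c| + |f k| := by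
      have e : f u - f k = (f u - f c) + f c + -f k := by ring
      rw [e, ← abs_neg (f k)]
      exact abs_add_three _ _ _
    have h4 : (C : ℝ) * |u - c| ≤ C * ((1 + |c|) * (1 + |u|)) := by
      refine mul_le_mul_of_nonneg_left ((abs_sub u c).trans ?_) C.2
      nlinarith [abs_nonneg u, abs_nonneg c, mul_nonneg (abs_nonneg u) (abs_nonneg c)]
    nlinarith [abs_nonneg u, mul_nonneg (abs_nonneg M) (abs_nonneg u), abs_nonneg M,
      mul_nonneg (abs_nonneg (f c)) (abs_nonneg u), mul_nonneg (abs_nonneg B) (abs_nonneg u)]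

theorem IsTestFunction.mul_comp_sub {φ J : ℝ × ℝ → ℝ} (hφ : IsTestFunction φ)
    (hJ : IsTestFunction J) (q : ℝ × ℝ) : IsTestFunction (fun p => φ p * J (p - q)) :=
  ⟨hφ.contDiff.mul (hJ.contDiff.comp (contDiff_id.sub contDiff_const)),
    hφ.hasCompactSupport.mul_right⟩

theorem IsTestFunction.const_mul_comp_sub {J : ℝ × ℝ → ℝ} (hJ : IsTestFunction J) (a : ℝ)
    (p : ℝ × ℝ) : IsTestFunction (fun q => a * J (p - q)) := by
  refine ⟨contDiff_const.mul (hJ.contDiff.comp (contDiff_const.sub contDiff_id)), ?_⟩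
  exact (hJ.hasCompactSupport.comp_homeomorph (Homeomorph.subLeft p)).mul_left (f := fun _ => a)

theorem fderiv_mul_comp_sub {φ J : ℝ × ℝ → ℝ} (hφ : IsTestFunction φ)
    (hJ : IsTestFunction J) (p q v : ℝ × ℝ) : fderiv ℝ (fun p => φ p * J (p - q)) p v
      = fderiv ℝ φ p v * J (p - q) + φ p * fderiv ℝ J (p - q) v := by
  have h1 := (hφ.contDiff.differentiable one_ne_zero p).hasFDerivAt
  have h2 : HasFDerivAt (fun p => J (p - q)) _ p :=
    (hJ.contDiff.differentiable one_ne_zero (p - q)).hasFDerivAt.comp p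
      ((hasFDerivAt_id p).sub_const q)
  have h3 : HasFDerivAt (fun p => φ p * J (p - q)) _ p := h1.mul h2
  rw [h3.fderiv]
  simp
  ring

theorem fderiv_const_mul_comp_sub {J : ℝ × ℝ → ℝ} (hJ : IsTestFunction J) (a : ℝ)
    (p q v : ℝ × ℝ) :
    fderiv ℝ (fun q => a * J (p - q)) q v = -(a * fderiv ℝ J (p - q) v) := by
  have h2 : HasFDerivAt (fun q => J (p - q)) _ q :=
    (hJ.contDiff.differentiable one_ne_zero (p - q)).hasFDerivAt.comp q
      ((hasFDerivAt_id q).const_sub p)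
  have h3 : HasFDerivAt (fun q => a * J (p - q)) _ q := h2.const_mul a
  rw [h3.fderiv]
  simp

/-- The layers decrease to the empty set because time zero is excluded. -/
theorem exists_setIntegral_initial_layer_lt {ν : Measure ((ℝ × ℝ) × ℝ)} {W : (ℝ × ℝ) × ℝ → ℝ}
    (hW : Integrable W ν) {η : ℝ} (hη : 0 < η) :
    ∃ ε > 0, ∫ z in {z : (ℝ × ℝ) × ℝ | 0 < z.1.1 ∧ z.1.1 < ε}, W z ∂ν < η := by
  set S : ℕ → Set ((ℝ × ℝ) × ℝ) := fun n => {z | 0 < z.1.1 ∧ z.1.1 < 1 / ((n : ℝ) + 1)} with hS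
  have hmeas : ∀ n, MeasurableSet (S n) := fun n =>
    (measurableSet_lt (f := fun _ => (0 : ℝ)) (g := fun z : (ℝ × ℝ) × ℝ => z.1.1)
      (by fun_prop) (by fun_prop)).inter (measurableSet_lt (f := fun z : (ℝ × ℝ) × ℝ => z.1.1)
      (g := fun _ => 1 / ((n : ℝ) + 1)) (by fun_prop) (by fun_prop))
  have hanti : Antitone S := fun m n hmn z hz =>
    ⟨hz.1, hz.2.trans_le (one_div_le_one_div_of_le (by positivity) (by gcongr))⟩
  have hlim := tendsto_setIntegral_of_antitone hmeas hanti ⟨0, hW.integrableOn⟩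
  have hempty : ⋂ n, S n = ∅ := by
    refine Set.eq_empty_of_forall_notMem fun z hz => ?_
    rw [Set.mem_iInter] at hz
    obtain ⟨n, hn⟩ := exists_nat_one_div_lt (hz 0).1
    exact absurd (hz n).2 hn.le.not_gt
  rw [hempty, setIntegral_empty] at hlim
  obtain ⟨n, hn⟩ := (hlim.eventually_lt_const hη).exists
  exact ⟨1 / ((n : ℝ) + 1), by positivity, hn⟩

/-- An integral of translation increments against a mollifier. -/
theorem lintegral_mollified_increment_le {κ : Kernel (ℝ × ℝ) ℝ} [IsMarkovKernel κ]
    {J y : ℝ × ℝ → ℝ} (hJ : Measurable J) (hJ0 : ∀ p, 0 ≤ J p) (hJ1 : ∫ p, J p = 1)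
    (hJi : Integrable J) (hy : Measurable y) {K : Set (ℝ × ℝ)} (hK : MeasurableSet K) {a : ℝ≥0∞}
    (h : ∀ w, J w ≠ 0 → ∫⁻ p in K, ‖y (p - w) - y p‖ₑ ≤ a) :
    ∫⁻ s : ((ℝ × ℝ) × ℝ) × (ℝ × ℝ), ENNReal.ofReal (J (s.1.1 - s.2))
      * K.indicator (fun p => ‖y s.2 - y p‖ₑ) s.1.1 ∂((volume ⊗ₘ κ).prod volume) ≤ a := by
  have hind : Measurable fun s : (ℝ × ℝ) × (ℝ × ℝ) =>
      K.indicator (fun p => ‖y s.2 - y p‖ₑ) s.1 := by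
    have : (fun s : (ℝ × ℝ) × (ℝ × ℝ) => K.indicator (fun p => ‖y s.2 - y p‖ₑ) s.1)
        = (K ×ˢ Set.univ).indicator fun s => ‖y s.2 - y s.1‖ₑ := by
      funext s; by_cases hs : s.1 ∈ K <;> simp [hs]
    rw [this]
    exact Measurable.indicator (by fun_prop) (hK.prod MeasurableSet.univ)
  have hG : Measurable fun s : (ℝ × ℝ) × (ℝ × ℝ) => ENNReal.ofReal (J (s.1 - s.2))
      * K.indicator (fun p => ‖y s.2 - y p‖ₑ) s.1 := by fun_prop
  have hG' : Measurable fun s : ((ℝ × ℝ) × ℝ) × (ℝ × ℝ) => ENNReal.ofReal (J (s.1.1 - s.2))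
      * K.indicator (fun p => ‖y s.2 - y p‖ₑ) s.1.1 :=
    hG.comp (f := fun s : ((ℝ × ℝ) × ℝ) × (ℝ × ℝ) => (s.1.1, s.2)) (by fun_prop)
  rw [lintegral_prod _ hG'.aemeasurable,
    Measure.lintegral_compProd hG'.lintegral_prod_right']
  -- The integrand does not involve `u`, so the probability measures `κ p` integrate out. The
  -- substitution `q = p - w` and Tonelli then leave the increments over `K` for each fixed `w`,
  -- averaged against `J`.
  simp only [lintegral_const, measure_univ, mul_one]
  have hshift : ∀ p : ℝ × ℝ, ∫⁻ q, ENNReal.ofReal (J (p - q))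
      * K.indicator (fun p => ‖y q - y p‖ₑ) p
      = ∫⁻ w, ENNReal.ofReal (J w) * K.indicator (fun p => ‖y (p - w) - y p‖ₑ) p := fun p => by
    have := lintegral_sub_left_eq_self (μ := (volume : Measure (ℝ × ℝ)))
      (fun q => ENNReal.ofReal (J (p - q)) * K.indicator (fun p => ‖y q - y p‖ₑ) p) p
    simp only [sub_sub_cancel] at this
    exact this.symm
  simp only [hshift]
  have hind2 : Measurable fun s : (ℝ × ℝ) × (ℝ × ℝ) =>
      K.indicator (fun p => ‖y (p - s.2) - y p‖ₑ) s.1 :=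
    hind.comp (f := fun s : (ℝ × ℝ) × (ℝ × ℝ) => (s.1, s.1 - s.2)) (by fun_prop)
  rw [lintegral_lintegral_swap (by fun_prop)]
  calc ∫⁻ w, ∫⁻ p, ENNReal.ofReal (J w) * K.indicator (fun p => ‖y (p - w) - y p‖ₑ) p
      ≤ ∫⁻ w, ENNReal.ofReal (J w) * a := by
        refine lintegral_mono fun w => ?_
        rw [lintegral_const_mul' _ _ ENNReal.ofReal_ne_top, lintegral_indicator hK]
        by_cases hw : J w = 0
        · simp [hw]
        · exact mul_le_mul_right (h w hw) _
    _ = a := by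
        rw [lintegral_mul_const _ (by fun_prop),
          ← ofReal_integral_eq_lintegral_ofReal hJi (ae_of_all _ hJ0), hJ1]
        simp

/-! ### Kato's inequality -/

/-- Kato's inequality for a kernel and a function satisfying the Kruzhkov inequalities, obtained by
doubling the variables. -/
theorem KruzhkovIneq.kato {f : ℝ → ℝ} (hf : ContDiff ℝ 1 f) {κ : Kernel (ℝ × ℝ) ℝ}
    [IsMarkovKernel κ] (h1 : KruzhkovIneq f κ) (hm : HasLocalMoment volume κ) {C : ℝ≥0} {I : Set ℝ}
    (hC : LipschitzOnWith C f I) {c : ℝ} (hc : c ∈ I)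
    (hκI : ∀ᵐ z ∂((volume : Measure (ℝ × ℝ)) ⊗ₘ κ), 0 < z.1.1 → z.2 ∈ I) {y : ℝ × ℝ → ℝ}
    (hy : Measurable y) {M : ℝ} (hM : ∀ p, |y p| ≤ M)
    (h2 : ∀ (k : ℝ) (ψ : ℝ × ℝ → ℝ), IsTestFunction ψ → (∀ p, 0 ≤ ψ p) →
      0 ≤ ∫ p, (timeDeriv ψ p * |y p - k| + spaceDeriv ψ p * causalFlux f p (y p) k))
    {φ : ℝ × ℝ → ℝ} (hφ : IsTestFunction φ) (hφ0 : ∀ p, 0 ≤ φ p) :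
    0 ≤ ∫ z, (timeDeriv φ z.1 * |z.2 - y z.1| + spaceDeriv φ z.1 * causalFlux f z.1 z.2 (y z.1))
      ∂(volume ⊗ₘ κ) := by
  have hM0 : 0 ≤ M := (abs_nonneg _).trans (hM 0)
  obtain ⟨A, hA, hAb⟩ := exists_kruzhkovFlux_bound hf.continuous hC hc M
  obtain ⟨L, hL⟩ : ∃ L : ℝ≥0, LipschitzOnWith L f (Set.Icc (-M) M) :=
    hf.contDiffOn.exists_lipschitzOnWith one_ne_zero (convex_Icc _ _) isCompact_Icc
  obtain ⟨B, hB, hφB⟩ := hφ.exists_bound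
  set K := tsupport φ with hKdef
  have hK : IsCompact K := hφ.hasCompactSupport
  have hKm : MeasurableSet K := hK.measurableSet
  set m := (volume : Measure (ℝ × ℝ)) ⊗ₘ κ with hmdef
  have hW := hm.integrable hK 1
  rw [← hmdef] at hW
  set W : (ℝ × ℝ) × ℝ → ℝ := fun z => K.indicator (fun _ => 1) z.1 * (1 + |z.2|) with hWdef
  have hWm : Measurable W :=
    ((measurable_const.indicator hKm).comp measurable_fst).mul (by fun_prop)
  have hWle : ∀ z, W z ≤ 1 + |z.2| := fun z => by
    by_cases hp : z.1 ∈ K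
    · simp [hWdef, hp]
    · simp only [hWdef, Set.indicator_of_notMem hp, zero_mul]; positivity
  have hW0 : ∀ z, 0 ≤ W z := fun z =>
    mul_nonneg (Set.indicator_nonneg (fun _ _ => zero_le_one) _) (by positivity)
  refine le_of_forall_pos_le_add fun η hη => ?_
  set b : ℝ := B * (1 + L) with hb
  have hb0 : 0 ≤ b := by positivity
  -- The order of choices matters: `δ` makes the translation error small, it determines the bound
  -- `c'` on the space derivative of the mollifier, and only then is the layer width `ε` chosen
  -- against `c'`. The summands `+ 1` avoid division by zero.
  obtain ⟨δ, hδ, htr⟩ := exists_translation_le hy hM hK (η := η / (2 * (b + 1))) (by positivity)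
  obtain ⟨c', hc', hmol⟩ := exists_mollifier hδ
  obtain ⟨ε, hε, hlay⟩ := exists_setIntegral_initial_layer_lt hW
    (η := η / (2 * (A * B * c' + 1))) (by positivity)
  set S : Set ((ℝ × ℝ) × ℝ) := {z | 0 < z.1.1 ∧ z.1.1 < ε} with hS
  have hSm : MeasurableSet S :=
    (measurableSet_lt (f := fun _ => (0 : ℝ)) (g := fun z : (ℝ × ℝ) × ℝ => z.1.1)
      (by fun_prop) (by fun_prop)).inter (measurableSet_lt (f := fun z : (ℝ × ℝ) × ℝ => z.1.1)
      (g := fun _ => ε) (by fun_prop) (by fun_prop))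
  -- Time width below `δ` keeps the shifts within `‖w‖ ≤ δ` in the sup norm; below `ε` it confines
  -- the flux jump to the layer `S`.
  obtain ⟨J, hJ, hJ0, hJs, hJxs, hJ1, hJx1⟩ := hmol (min ε δ) (lt_min hε hδ)
  obtain ⟨D, hD, hJD⟩ := hJ.exists_bound
  have hJD' : ∀ p, |J p| ≤ D ∧ |timeDeriv J p| ≤ D ∧ |spaceDeriv J p| ≤ D := fun p =>
    have hi : (tsupport J).indicator (fun _ => D) p ≤ D := Set.indicator_le_self' (fun _ _ => hD) p
    ⟨(hJD p).1.trans hi, (hJD p).2.1.trans hi, (hJD p).2.2.trans hi⟩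
  have hφB' : ∀ p, |φ p| ≤ B ∧ |timeDeriv φ p| ≤ B ∧ |spaceDeriv φ p| ≤ B := fun p =>
    have hi : K.indicator (fun _ => B) p ≤ B := Set.indicator_le_self' (fun _ _ => hB) p
    ⟨(hφB p).1.trans hi, (hφB p).2.1.trans hi, (hφB p).2.2.trans hi⟩
  have hJoff : ∀ p ∉ tsupport J, J p = 0 ∧ timeDeriv J p = 0 ∧ spaceDeriv J p = 0 :=
    fun p hp => by simpa [hp] using hJD p
  have hφoff : ∀ p ∉ K, φ p = 0 ∧ timeDeriv φ p = 0 ∧ spaceDeriv φ p = 0 :=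
    fun p hp => by simpa [hp] using hφB p
  have hJi : Integrable J := hJ.contDiff.continuous.integrable_of_hasCompactSupport
    hJ.hasCompactSupport
  set K' : Set (ℝ × ℝ) := (fun s : (ℝ × ℝ) × (ℝ × ℝ) => s.1 - s.2) '' (K ×ˢ tsupport J) with hK'
  have hK'c : IsCompact K' := (hK.prod hJ.hasCompactSupport).image (by fun_prop)
  -- Common integrability criterion: for `p ∈ K` and `p - q` in the support of `J`, the point `q`
  -- lies in the compact set `K' = K - tsupport J`, so linear growth in `u` suffices.
  have hdom : ∀ (G : ((ℝ × ℝ) × ℝ) × (ℝ × ℝ) → ℝ) (a : ℝ), Measurable G →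
      (∀ z q, z.1 ∉ K → G (z, q) = 0) → (∀ z q, z.1 - q ∉ tsupport J → G (z, q) = 0) →
      (∀ᵐ z ∂m, ∀ q, |G (z, q)| ≤ a * (1 + |z.2|)) → Integrable G (m.prod volume) := by
    intro G a hG hGK hGJ hGa
    have hI : Integrable (K'.indicator fun _ => a) (volume : Measure (ℝ × ℝ)) :=
      (integrable_indicator_iff hK'c.measurableSet).2 (integrableOn_const hK'c.measure_lt_top.ne)
    refine (hW.mul_prod hI).mono' hG.aestronglyMeasurable ?_
    filter_upwards [Measure.quasiMeasurePreserving_fst.ae hGa] with s hs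
    by_cases hp : s.1.1 ∈ K
    · by_cases hq : s.1.1 - s.2 ∈ tsupport J
      · have hmem : s.2 ∈ K' := ⟨(s.1.1, s.1.1 - s.2), ⟨hp, hq⟩, sub_sub_cancel _ _⟩
        have := hs s.2
        simp only [hWdef, Set.indicator_of_mem hp, Set.indicator_of_mem hmem]
        rw [Real.norm_eq_abs]
        linarith
      · have h0 : G s = 0 := hGJ s.1 s.2 hq
        by_cases hmem : s.2 ∈ K'
        · have ha := (abs_nonneg _).trans (hs s.2)
          simp only [hWdef, Set.indicator_of_mem hp, Set.indicator_of_mem hmem, h0, norm_zero]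
          linarith
        · simp [hmem, h0]
    · have h0 : G s = 0 := hGK s.1 s.2 hp
      simp [hWdef, hp, h0]
  have hcf : ∀ᵐ z ∂m, ∀ k, |k| ≤ M → |causalFlux f z.1 z.2 k| ≤ A * (1 + |z.2|) := by
    filter_upwards [hκI] with z hz k hk
    unfold causalFlux
    split_ifs with h0
    · exact (hAb z.2 k hk).2 (hz h0)
    · rw [abs_zero]; positivity
  have mJ := hJ.contDiff.continuous.measurable
  have mJt := hJ.continuous_timeDeriv.measurable
  have mJx := hJ.continuous_spaceDeriv.measurable
  have mφ := hφ.contDiff.continuous.measurable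
  have mφt := hφ.continuous_timeDeriv.measurable
  have mφx := hφ.continuous_spaceDeriv.measurable
  have mcf := measurable_causalFlux hf.continuous
  have mc1 : Measurable fun s : ((ℝ × ℝ) × ℝ) × (ℝ × ℝ) => causalFlux f s.1.1 s.1.2 (y s.2) :=
    mcf.comp (f := fun s : ((ℝ × ℝ) × ℝ) × (ℝ × ℝ) => (s.1.1, s.1.2, y s.2)) (by fun_prop)
  have mc2 : Measurable fun s : ((ℝ × ℝ) × ℝ) × (ℝ × ℝ) => causalFlux f s.2 (y s.2) s.1.2 :=
    mcf.comp (f := fun s : ((ℝ × ℝ) × ℝ) × (ℝ × ℝ) => (s.2, y s.2, s.1.2)) (by fun_prop)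
  have mc3 : Measurable fun s : ((ℝ × ℝ) × ℝ) × (ℝ × ℝ) => causalFlux f s.1.1 s.1.2 (y s.1.1) :=
    mcf.comp (f := fun s : ((ℝ × ℝ) × ℝ) × (ℝ × ℝ) => (s.1.1, s.1.2, y s.1.1)) (by fun_prop)
  -- `F₁` comes from the inequality for `κ` in the variable `p` with `k = y q`, and `F₂` from the
  -- one for `y` in the variable `q` with `k = u`, both tested with `φ p * J (p - q)`. As `φ`
  -- depends on `p` only, `F₂` differentiates `J` alone, with a minus sign, and cancels the
  -- `timeDeriv J` part of `F₁`. `H` is the target; `E₁` pays for replacing `y q` by `y p`, and `E₂`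
  -- for the flux jump at time zero.
  set F₁ : ((ℝ × ℝ) × ℝ) × (ℝ × ℝ) → ℝ := fun s =>
    (timeDeriv φ s.1.1 * J (s.1.1 - s.2) + φ s.1.1 * timeDeriv J (s.1.1 - s.2)) * |s.1.2 - y s.2|
    + (spaceDeriv φ s.1.1 * J (s.1.1 - s.2) + φ s.1.1 * spaceDeriv J (s.1.1 - s.2))
      * causalFlux f s.1.1 s.1.2 (y s.2) with hF₁
  set F₂ : ((ℝ × ℝ) × ℝ) × (ℝ × ℝ) → ℝ := fun s =>
    -(φ s.1.1 * timeDeriv J (s.1.1 - s.2)) * |y s.2 - s.1.2|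
    + -(φ s.1.1 * spaceDeriv J (s.1.1 - s.2)) * causalFlux f s.2 (y s.2) s.1.2 with hF₂
  set H : ((ℝ × ℝ) × ℝ) × (ℝ × ℝ) → ℝ := fun s =>
    J (s.1.1 - s.2) * (timeDeriv φ s.1.1 * |s.1.2 - y s.1.1|
      + spaceDeriv φ s.1.1 * causalFlux f s.1.1 s.1.2 (y s.1.1)) with hH
  set E₁ : ((ℝ × ℝ) × ℝ) × (ℝ × ℝ) → ℝ := fun s =>
    J (s.1.1 - s.2) * (b * K.indicator (fun p => |y s.2 - y p|) s.1.1) with hE₁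
  set E₂ : ((ℝ × ℝ) × ℝ) × (ℝ × ℝ) → ℝ := fun s =>
    (A * B * S.indicator W s.1) * |spaceDeriv J (s.1.1 - s.2)| with hE₂
  have two_mul_bound : ∀ {a₁ a₂ x₁ x₂ d w : ℝ}, |a₁| ≤ d → |a₂| ≤ d → |x₁| ≤ w → |x₂| ≤ w →
      |a₁ * x₁ + a₂ * x₂| ≤ 2 * d * w := by
    intro a₁ a₂ x₁ x₂ d w e1 e2 e3 e4
    have hd := (abs_nonneg _).trans e1
    refine (abs_add_le _ _).trans ?_
    rw [abs_mul, abs_mul]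
    linarith [mul_le_mul e1 e3 (abs_nonneg _) hd, mul_le_mul e2 e4 (abs_nonneg _) hd]
  have hprod : ∀ {a₁ a₂ : ℝ}, |a₁| ≤ B → |a₂| ≤ D → |a₁ * a₂| ≤ B * D := fun e1 e2 => by
    rw [abs_mul]; exact mul_le_mul e1 e2 (abs_nonneg _) hB
  have iF₁ : Integrable F₁ (m.prod volume) := by
    refine hdom F₁ (2 * (2 * B * D) * A) (by fun_prop) (fun z q h => ?_) (fun z q h => ?_) ?_
    · simp [hF₁, hφoff _ h]
    · simp [hF₁, hJoff _ h]
    · filter_upwards [hcf] with z hz q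
      rw [mul_assoc _ A]
      exact two_mul_bound
        (two_mul_bound (hφB' _).2.1 (hφB' _).1 (hJD' _).1 (hJD' _).2.1)
        (two_mul_bound (hφB' _).2.2 (hφB' _).1 (hJD' _).1 (hJD' _).2.2)
        (by rw [abs_abs]; exact (hAb _ _ (hM q)).1) (hz _ (hM q))
  have iF₂ : Integrable F₂ (m.prod volume) := by
    refine hdom F₂ (2 * (B * D) * A) (by fun_prop) (fun z q h => ?_) (fun z q h => ?_) ?_
    · simp [hF₂, hφoff _ h]
    · simp [hF₂, hJoff _ h]
    · filter_upwards [hκI] with z hz q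
      rw [mul_assoc _ A]
      -- Where the space derivative of `J` is nonzero, `q` is earlier than `p`. Thus the flux at `q`
      -- is on only if `p` is in the future, and there `u ∈ I` gives the bound.
      by_cases h0 : spaceDeriv J (z.1 - q) = 0
      · have := two_mul_bound (d := B * D) (a₁ := -(φ z.1 * timeDeriv J (z.1 - q)))
          (x₁ := |y q - z.2|) (a₂ := 0) (x₂ := 0) (w := A * (1 + |z.2|))
          (by rw [abs_neg]; exact hprod (hφB' _).1 (hJD' _).2.1) (by rw [abs_zero]; positivity)
          (by rw [abs_abs, abs_sub_comm]; exact (hAb _ _ (hM q)).1) (by rw [abs_zero]; positivity)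
        simpa [hF₂, h0] using this
      · refine two_mul_bound (by rw [abs_neg]; exact hprod (hφB' _).1 (hJD' _).2.1)
          (by rw [abs_neg]; exact hprod (hφB' _).1 (hJD' _).2.2)
          (by rw [abs_abs, abs_sub_comm]; exact (hAb _ _ (hM q)).1) ?_
        have h3 := (hJxs _ h0).1
        rw [Prod.fst_sub] at h3
        simp only [causalFlux]
        split_ifs with hq
        · rw [kruzhkovFlux_comm]
          exact (hAb _ _ (hM q)).2 (hz (by linarith))
        · rw [abs_zero]; positivity
  have iH : Integrable H (m.prod volume) := by
    refine hdom H (D * (2 * B * A)) (by fun_prop) (fun z q h => ?_) (fun z q h => ?_) ?_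
    · simp [hH, hφoff _ h]
    · simp [hH, hJoff _ h]
    · filter_upwards [hcf] with z hz q
      simp only [hH]
      rw [abs_mul, mul_assoc D, mul_assoc _ A]
      exact mul_le_mul (hJD' _).1 (two_mul_bound (hφB' _).2.1 (hφB' _).2.2
        (by rw [abs_abs]; exact (hAb _ _ (hM _)).1) (hz _ (hM _))) (abs_nonneg _) hD
  have mE : Measurable fun s : ((ℝ × ℝ) × ℝ) × (ℝ × ℝ) =>
      K.indicator (fun p => |y s.2 - y p|) s.1.1 := by
    have : (fun s : ((ℝ × ℝ) × ℝ) × (ℝ × ℝ) => K.indicator (fun p => |y s.2 - y p|) s.1.1)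
        = ((K ×ˢ Set.univ) ×ˢ Set.univ).indicator fun s => |y s.2 - y s.1.1| := by
      funext s; by_cases hs : s.1.1 ∈ K <;> simp [hs]
    rw [this]
    exact Measurable.indicator (by fun_prop) ((hKm.prod .univ).prod .univ)
  have hE₁0 : ∀ s, 0 ≤ E₁ s := fun s => mul_nonneg (hJ0 _)
    (mul_nonneg hb0 (Set.indicator_nonneg (fun _ _ => abs_nonneg _) _))
  have hE₂0 : ∀ s, 0 ≤ E₂ s := fun s => mul_nonneg
    (mul_nonneg (by positivity) (Set.indicator_nonneg (fun _ _ => hW0 _) _)) (abs_nonneg _)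
  have iE₁ : Integrable E₁ (m.prod volume) := by
    refine hdom E₁ (D * (b * (2 * M))) (by fun_prop) (fun z q h => ?_) (fun z q h => ?_) ?_
    · simp [hE₁, h]
    · simp [hE₁, hJoff _ h]
    · refine ae_of_all _ fun z q => ?_
      rw [abs_of_nonneg (hE₁0 _)]
      have e1 : K.indicator (fun p => |y q - y p|) z.1 ≤ 2 * M := by
        refine (Set.indicator_le_self' (fun _ _ => abs_nonneg _) _).trans ?_
        linarith [abs_sub (y q) (y z.1), hM q, hM z.1]
      have e2 : E₁ (z, q) ≤ D * (b * (2 * M)) :=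
        mul_le_mul ((le_abs_self _).trans (hJD' _).1) (mul_le_mul_of_nonneg_left e1 hb0)
          (mul_nonneg hb0 (Set.indicator_nonneg (fun _ _ => abs_nonneg _) _)) hD
      have e3 : 0 ≤ D * (b * (2 * M)) := by positivity
      nlinarith [abs_nonneg z.2]
  have iE₂ : Integrable E₂ (m.prod volume) := by
    have mS : Measurable (S.indicator W) := hWm.indicator hSm
    refine hdom E₂ (A * B * D) (by fun_prop) (fun z q h => ?_) (fun z q h => ?_) ?_
    · have : S.indicator W z = 0 := by
        by_cases hz : z ∈ S <;> simp [hz, hWdef, h]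
      simp [hE₂, this]
    · simp [hE₂, hJoff _ h]
    · refine ae_of_all _ fun z q => ?_
      rw [abs_of_nonneg (hE₂0 _)]
      have e1 : S.indicator W z ≤ 1 + |z.2| :=
        (Set.indicator_le_self' (fun _ _ => hW0 _) _).trans (hWle z)
      calc E₂ (z, q) ≤ (A * B * (1 + |z.2|)) * D :=
            mul_le_mul (mul_le_mul_of_nonneg_left e1 (by positivity)) (hJD' _).2.2
              (abs_nonneg _) (by positivity)
        _ = A * B * D * (1 + |z.2|) := by ring
  have pF₁ : 0 ≤ ∫ s, F₁ s ∂(m.prod volume) := by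
    rw [integral_prod_symm _ iF₁]
    refine integral_nonneg fun q => ?_
    refine (h1 (y q) _ (hφ.mul_comp_sub hJ q) fun p => mul_nonneg (hφ0 _) (hJ0 _)).trans_eq ?_
    refine integral_congr_ae (ae_of_all _ fun z => ?_)
    simp only [hF₁, timeDeriv, spaceDeriv, fderiv_mul_comp_sub hφ hJ]
  have pF₂ : 0 ≤ ∫ s, F₂ s ∂(m.prod volume) := by
    rw [integral_prod _ iF₂]
    refine integral_nonneg fun z => ?_
    refine (h2 z.2 _ (hJ.const_mul_comp_sub (φ z.1) z.1)
      fun p => mul_nonneg (hφ0 _) (hJ0 _)).trans_eq ?_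
    refine integral_congr_ae (ae_of_all _ fun q => ?_)
    simp only [hF₂, timeDeriv, spaceDeriv, fderiv_const_mul_comp_sub hJ]
  have eH : ∫ s, H s ∂(m.prod volume) = ∫ z, (timeDeriv φ z.1 * |z.2 - y z.1|
      + spaceDeriv φ z.1 * causalFlux f z.1 z.2 (y z.1)) ∂m := by
    rw [integral_prod _ iH]
    refine integral_congr_ae (ae_of_all _ fun z => ?_)
    simp only [hH]
    rw [integral_mul_const, integral_sub_left_eq_self J volume z.1, hJ1, one_mul]
  have bE₁ : ∫ s, E₁ s ∂(m.prod volume) ≤ η / 2 := by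
    have hle := lintegral_mollified_increment_le (κ := κ) mJ hJ0 hJ1 hJi hy hKm
      (a := ENNReal.ofReal (η / (2 * (b + 1)))) fun w hw => by
        obtain ⟨e1, e2, e3⟩ := hJs w hw
        refine htr w ?_
        rw [Prod.norm_def, Real.norm_eq_abs, Real.norm_eq_abs, abs_of_pos e1]
        exact max_le (e2.le.trans (min_le_right _ _)) e3
    rw [integral_eq_lintegral_of_nonneg_ae (ae_of_all _ hE₁0) iE₁.aestronglyMeasurable]
    have e : ∀ s, ENNReal.ofReal (E₁ s) = ENNReal.ofReal b * (ENNReal.ofReal (J (s.1.1 - s.2))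
        * K.indicator (fun p => ‖y s.2 - y p‖ₑ) s.1.1) := fun s => by
      by_cases hs : s.1.1 ∈ K
      · simp only [hE₁, Set.indicator_of_mem hs]
        rw [ENNReal.ofReal_mul (hJ0 _), ENNReal.ofReal_mul hb0, Real.enorm_eq_ofReal_abs]
        ring
      · simp [hE₁, hs]
    simp only [e]
    rw [lintegral_const_mul' _ _ ENNReal.ofReal_ne_top]
    refine ENNReal.toReal_le_of_le_ofReal (by positivity) ((mul_le_mul_right hle _).trans ?_)
    rw [← ENNReal.ofReal_mul hb0]
    refine ENNReal.ofReal_le_ofReal ?_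
    rw [mul_div_assoc', div_le_div_iff₀ (by positivity) (by positivity)]
    nlinarith
  have bE₂ : ∫ s, E₂ s ∂(m.prod volume) ≤ η / 2 := by
    rw [integral_prod _ iE₂]
    have e : ∀ z : (ℝ × ℝ) × ℝ, ∫ q, E₂ (z, q)
        = (A * B * ∫ p, |spaceDeriv J p|) * S.indicator W z := fun z => by
      simp only [hE₂]
      rw [integral_const_mul, integral_sub_left_eq_self (fun p => |spaceDeriv J p|) volume z.1]
      ring
    simp only [e]
    rw [integral_const_mul, integral_indicator hSm]
    have e0 : 0 ≤ ∫ z in S, W z ∂m := integral_nonneg hW0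
    calc A * B * (∫ p, |spaceDeriv J p|) * ∫ z in S, W z ∂m
        ≤ A * B * c' * (η / (2 * (A * B * c' + 1))) :=
          mul_le_mul (mul_le_mul_of_nonneg_left hJx1 (by positivity)) hlay.le e0 (by positivity)
      _ ≤ η / 2 := by
          have : 0 ≤ A * B * c' := by positivity
          rw [mul_div_assoc', div_le_div_iff₀ (by positivity) (by positivity)]
          nlinarith
  have hpt : ∀ᵐ s ∂(m.prod volume), F₁ s + F₂ s ≤ H s + (E₁ s + E₂ s) := by
    filter_upwards [Measure.quasiMeasurePreserving_fst.ae hκI] with ⟨⟨p, u⟩, q⟩ hs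
    simp only at hs
    simp only [hF₁, hF₂, hH]
    have hIcc : ∀ p, y p ∈ Set.Icc (-M) M := fun p => abs_le.1 (hM p)
    have e1 : J (p - q) * ((timeDeriv φ p * |u - y q| + spaceDeriv φ p * causalFlux f p u (y q))
        - (timeDeriv φ p * |u - y p| + spaceDeriv φ p * causalFlux f p u (y p)))
        ≤ E₁ ((p, u), q) := by
      refine mul_le_mul_of_nonneg_left ?_ (hJ0 _)
      by_cases hp : p ∈ K
      · simp only [Set.indicator_of_mem hp]
        have d1 : |(|u - y q| - |u - y p|)| ≤ |y q - y p| := by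
          have := abs_abs_sub_abs_le_abs_sub (u - y q) (u - y p)
          rwa [sub_sub_sub_cancel_left, abs_sub_comm (y p)] at this
        have d2 : |causalFlux f p u (y q) - causalFlux f p u (y p)| ≤ L * |y q - y p| := by
          unfold causalFlux
          split_ifs
          · exact abs_kruzhkovFlux_sub_le Set.ordConnected_Icc hL u (hIcc q) (hIcc p)
          · rw [sub_zero, abs_zero]; positivity
        have d3 := mul_le_mul (hφB' p).2.1 d1 (abs_nonneg _) hB
        have d4 := mul_le_mul (hφB' p).2.2 d2 (abs_nonneg _) hB
        rw [← abs_mul] at d3 d4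
        have d5 := le_abs_self (timeDeriv φ p * (|u - y q| - |u - y p|))
        have d6 := le_abs_self (spaceDeriv φ p
          * (causalFlux f p u (y q) - causalFlux f p u (y p)))
        rw [hb]
        linarith
      · simp [hφoff p hp, hp]
    -- If `p` and `q` are on the same side of time zero, the two fluxes agree by symmetry or both
    -- vanish. Since `q` is earlier than `p` by less than `ε`, the only other case is `q.1 ≤ 0 < p.1
    -- < ε`, which is the layer `S`.
    have e2 : φ p * spaceDeriv J (p - q) * (causalFlux f p u (y q) - causalFlux f q (y q) u)
        ≤ E₂ ((p, u), q) := by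
      by_cases h0 : spaceDeriv J (p - q) = 0
      · simpa [h0] using hE₂0 ((p, u), q)
      by_cases hp : p ∈ K
      swap
      · simpa [hφoff p hp] using hE₂0 ((p, u), q)
      obtain ⟨d1, d2⟩ := hJxs _ h0
      rw [Prod.fst_sub] at d1 d2
      have d3 := d2.trans_le (min_le_left ε δ)
      rcases le_or_gt p.1 0 with hp0 | hp0
      · have hq0 : ¬ 0 < q.1 := by linarith
        simpa [causalFlux, hp0.not_gt, hq0] using hE₂0 ((p, u), q)
      · by_cases hq0 : 0 < q.1
        · simpa [causalFlux, hp0, hq0, kruzhkovFlux_comm f u] using hE₂0 ((p, u), q)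
        · have hmem : ((p, u) : (ℝ × ℝ) × ℝ) ∈ S := ⟨hp0, by simp only; linarith⟩
          simp only [causalFlux, hp0, hq0, if_true, if_false, sub_zero, hE₂,
            Set.indicator_of_mem hmem]
          have hWz : W (p, u) = 1 + |u| := by simp [hWdef, hp]
          rw [hWz]
          calc φ p * spaceDeriv J (p - q) * kruzhkovFlux f u (y q)
              ≤ |φ p| * |spaceDeriv J (p - q)| * |kruzhkovFlux f u (y q)| := by
                rw [← abs_mul, ← abs_mul]; exact le_abs_self _
            _ ≤ B * |spaceDeriv J (p - q)| * (A * (1 + |u|)) := by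
                have := (hAb u (y q) (hM q)).2 (hs hp0)
                have := (hφB' p).1
                gcongr
            _ = A * B * (1 + |u|) * |spaceDeriv J (p - q)| := by ring
    rw [abs_sub_comm (y q) u]
    linarith
  have key := integral_mono_ae (iF₁.add iF₂) (iH.add (iE₁.add iE₂)) hpt
  rw [integral_add' iF₁ iF₂, integral_add' iH (iE₁.add iE₂), integral_add' iE₁ iE₂, eH] at key
  linarith

/-! ### The cone of dependence -/

/-- A smooth cutoff for the cone `|x| ≤ R - C t`, nonincreasing along its characteristics. -/
noncomputable def coneCutoff (C R δ : ℝ) (p : ℝ × ℝ) : ℝ :=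
  Real.smoothTransition (1 - (√(p.2 ^ 2 + δ ^ 2) + C * p.1 - R) / δ)

theorem contDiff_coneCutoff (C R : ℝ) {δ : ℝ} (hδ : 0 < δ) : ContDiff ℝ 1 (coneCutoff C R δ) := by
  refine Real.smoothTransition.contDiff.comp ?_
  have h : ContDiff ℝ 1 fun p : ℝ × ℝ => √(p.2 ^ 2 + δ ^ 2) :=
    ContDiff.sqrt (by fun_prop) fun p => by positivity
  fun_prop

theorem coneCutoff_nonneg (C R δ : ℝ) (p : ℝ × ℝ) : 0 ≤ coneCutoff C R δ p :=
  Real.smoothTransition.nonneg _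

theorem coneCutoff_le_one (C R δ : ℝ) (p : ℝ × ℝ) : coneCutoff C R δ p ≤ 1 :=
  Real.smoothTransition.le_one _

theorem coneCutoff_eq_one {C R δ : ℝ} (hδ : 0 < δ) {p : ℝ × ℝ} (h : |p.2| + δ + C * p.1 ≤ R) :
    coneCutoff C R δ p = 1 := by
  refine Real.smoothTransition.one_of_one_le ?_
  have h1 : √(p.2 ^ 2 + δ ^ 2) ≤ |p.2| + δ := by
    rw [Real.sqrt_le_left (by positivity), ← sq_abs p.2]
    nlinarith [mul_nonneg (abs_nonneg p.2) hδ.le]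
  have : (√(p.2 ^ 2 + δ ^ 2) + C * p.1 - R) / δ ≤ 0 :=
    div_nonpos_of_nonpos_of_nonneg (by linarith) hδ.le
  linarith

theorem abs_le_of_coneCutoff_ne_zero {C R δ : ℝ} (hδ : 0 < δ) {p : ℝ × ℝ}
    (h : coneCutoff C R δ p ≠ 0) : |p.2| ≤ R + δ - C * p.1 := by
  have h1 : |p.2| ≤ √(p.2 ^ 2 + δ ^ 2) := Real.abs_le_sqrt (by nlinarith)
  by_contra! h2
  refine h (Real.smoothTransition.zero_of_nonpos ?_)
  rw [sub_nonpos, le_div_iff₀ hδ]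
  linarith

/-- Both derivatives carry the same nonnegative factor `s / δ`; beyond it the time slope is `-C`,
while the smoothed modulus `√(x² + δ²)` has slope at most one in `x`. -/
theorem abs_spaceDeriv_coneCutoff_mul_le {C R δ : ℝ} (hC : 0 ≤ C) (hδ : 0 < δ) (p : ℝ × ℝ) :
    |spaceDeriv (coneCutoff C R δ) p| * C ≤ -timeDeriv (coneCutoff C R δ) p := by
  set r := √(p.2 ^ 2 + δ ^ 2) with hr
  have hpos : 0 < p.2 ^ 2 + δ ^ 2 := by positivity
  have hr0 : 0 < r := Real.sqrt_pos.2 hpos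
  set s := deriv Real.smoothTransition (1 - (r + C * p.1 - R) / δ) with hs
  have hs0 : 0 ≤ s := Real.smoothTransition.monotone.deriv_nonneg
  have hsd : HasDerivAt Real.smoothTransition s (1 - (r + C * p.1 - R) / δ) :=
    (Real.smoothTransition.contDiff (n := 1)).differentiable one_ne_zero _ |>.hasDerivAt
  have h1 : timeDeriv (coneCutoff C R δ) p = s * (-(C / δ)) := by
    have hline : HasDerivAt (fun t : ℝ => (t, p.2)) (1, 0) p.1 :=
      (hasDerivAt_id _).prodMk (hasDerivAt_const _ _)
    have e1 := ((contDiff_coneCutoff C R hδ).differentiable one_ne_zero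
      p).hasFDerivAt.comp_hasDerivAt p.1 hline
    have e2 : HasDerivAt (fun t : ℝ => 1 - (r + C * t - R) / δ) (-(C / δ)) p.1 := by
      have := (((((hasDerivAt_id p.1).const_mul C).const_add r).sub_const R).div_const δ).const_sub 1
      simpa using this
    exact e1.unique (hsd.comp p.1 e2)
  have h2 : spaceDeriv (coneCutoff C R δ) p = s * (-(p.2 / r / δ)) := by
    have hline : HasDerivAt (fun x : ℝ => (p.1, x)) (0, 1) p.2 :=
      (hasDerivAt_const _ _).prodMk (hasDerivAt_id _)
    have e1 := ((contDiff_coneCutoff C R hδ).differentiable one_ne_zero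
      p).hasFDerivAt.comp_hasDerivAt p.2 hline
    have e0 : HasDerivAt (fun x : ℝ => √(x ^ 2 + δ ^ 2)) (p.2 / r) p.2 := by
      have e : HasDerivAt (fun x : ℝ => x ^ 2 + δ ^ 2) (2 * p.2) p.2 := by
        simpa using (hasDerivAt_pow 2 p.2).add_const (δ ^ 2)
      have := e.sqrt hpos.ne'
      rwa [mul_div_mul_left _ _ two_ne_zero] at this
    have e2 : HasDerivAt (fun x : ℝ => 1 - (√(x ^ 2 + δ ^ 2) + C * p.1 - R) / δ)
        (-(p.2 / r / δ)) p.2 :=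
      (((e0.add_const (C * p.1)).sub_const R).div_const δ).const_sub 1
    exact e1.unique (hsd.comp p.2 e2)
  have h3 : |p.2 / r| ≤ 1 := by
    rw [abs_div, abs_of_pos hr0, div_le_one hr0]
    exact Real.abs_le_sqrt (by nlinarith)
  rw [h1, h2]
  rw [abs_mul, abs_of_nonneg hs0, abs_neg, abs_div, abs_of_pos hδ]
  calc s * (|p.2 / r| / δ) * C = s * (C / δ) * |p.2 / r| := by ring
    _ ≤ s * (C / δ) * 1 := mul_le_mul_of_nonneg_left h3 (by positivity)
    _ = -(s * -(C / δ)) := by ring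

theorem isTestFunction_coneCutoff {θ : ℝ → ℝ} (hθ : ContDiff ℝ 1 θ) (hθs : HasCompactSupport θ)
    {C : ℝ} (hC : 0 ≤ C) (R : ℝ) {δ : ℝ} (hδ : 0 < δ) :
    IsTestFunction fun p => θ p.1 * coneCutoff C R δ p := by
  refine ⟨(hθ.comp contDiff_fst).mul (contDiff_coneCutoff C R hδ), ?_⟩
  obtain ⟨N, hN⟩ := hθs.isCompact.isBounded.subset_closedBall 0
  refine HasCompactSupport.intro ((isCompact_closedBall (0 : ℝ) N).prod
    (isCompact_closedBall (0 : ℝ) (R + δ + C * N))) fun p hp => ?_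
  by_contra h0
  refine hp ⟨hN (subset_tsupport _ (left_ne_zero_of_mul h0)), ?_⟩
  have h1 := abs_le_of_coneCutoff_ne_zero hδ (right_ne_zero_of_mul h0)
  have h2 : |p.1| ≤ N := by
    simpa using hN (subset_tsupport _ (left_ne_zero_of_mul h0))
  rw [mem_closedBall_zero_iff, Real.norm_eq_abs]
  nlinarith [(abs_le.1 h2).1]

theorem HasLocalMoment.integrable_mul_abs_sub {κ : Kernel (ℝ × ℝ) ℝ} [IsMarkovKernel κ]
    (hm : HasLocalMoment volume κ) {y : ℝ × ℝ → ℝ} (hy : Measurable y) {M : ℝ}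
    (hM : ∀ p, |y p| ≤ M) {g : ℝ × ℝ → ℝ} (hg : Continuous g) (hgs : HasCompactSupport g) :
    Integrable (fun z : (ℝ × ℝ) × ℝ => g z.1 * |z.2 - y z.1|) (volume ⊗ₘ κ) := by
  have hM0 : 0 ≤ M := (abs_nonneg _).trans (hM 0)
  obtain ⟨B, hB⟩ := hgs.isCompact.exists_bound_of_continuousOn hg.continuousOn
  refine (hm.integrable hgs.isCompact (B * (1 + M))).mono' ?_ (ae_of_all _ fun z => ?_)
  · have := hg.measurable
    exact Measurable.aestronglyMeasurable (by fun_prop)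
  · by_cases hz : z.1 ∈ tsupport g
    · rw [norm_mul, Set.indicator_of_mem hz, mul_assoc]
      refine mul_le_mul (hB _ hz) ?_ (norm_nonneg _) ((norm_nonneg _).trans (hB _ hz))
      rw [Real.norm_eq_abs, abs_abs]
      have := abs_sub z.2 (y z.1)
      nlinarith [hM z.1, mul_nonneg hM0 (abs_nonneg z.2)]
    · simp [hz, image_eq_zero_of_notMem_tsupport hz]

/-- In Kato's inequality for `θ` times the cutoff, the terms that differentiate the cutoff add up to
something nonpositive, because the flux is at most `C |u - y|` and the cutoff decreases in time at
least `C` times as fast as it varies in space. -/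
theorem cone_inequality {f : ℝ → ℝ} (hf : Continuous f) {κ : Kernel (ℝ × ℝ) ℝ} [IsMarkovKernel κ]
    (hm : HasLocalMoment volume κ) {y : ℝ × ℝ → ℝ} (hy : Measurable y) {M : ℝ}
    (hM : ∀ p, |y p| ≤ M) {C : ℝ} (hC : 0 ≤ C)
    (hcone : ∀ᵐ z ∂((volume : Measure (ℝ × ℝ)) ⊗ₘ κ),
      |causalFlux f z.1 z.2 (y z.1)| ≤ C * |z.2 - y z.1|)
    (hkato : ∀ φ : ℝ × ℝ → ℝ, IsTestFunction φ → (∀ p, 0 ≤ φ p) →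
      0 ≤ ∫ z, (timeDeriv φ z.1 * |z.2 - y z.1|
        + spaceDeriv φ z.1 * causalFlux f z.1 z.2 (y z.1)) ∂(volume ⊗ₘ κ))
    {θ : ℝ → ℝ} (hθ : ContDiff ℝ 1 θ) (hθs : HasCompactSupport θ) (hθ0 : ∀ t, 0 ≤ θ t)
    (R : ℝ) {δ : ℝ} (hδ : 0 < δ) :
    0 ≤ ∫ z, deriv θ z.1.1 * coneCutoff C R δ z.1 * |z.2 - y z.1| ∂(volume ⊗ₘ κ) := by
  have hM0 : 0 ≤ M := (abs_nonneg _).trans (hM 0)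
  have hφ := isTestFunction_coneCutoff hθ hθs hC R hδ
  have hd : ∀ p v, fderiv ℝ (fun p => θ p.1 * coneCutoff C R δ p) p v
      = deriv θ p.1 * v.1 * coneCutoff C R δ p + θ p.1 * fderiv ℝ (coneCutoff C R δ) p v := by
    intro p v
    have e1 : HasFDerivAt (fun p : ℝ × ℝ => θ p.1)
        (deriv θ p.1 • ContinuousLinearMap.fst ℝ ℝ ℝ) p :=
      (hθ.differentiable one_ne_zero p.1).hasDerivAt.comp_hasFDerivAt p hasFDerivAt_fst
    have e2 := ((contDiff_coneCutoff C R hδ).differentiable one_ne_zero p).hasFDerivAt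
    have e3 : HasFDerivAt (fun p => θ p.1 * coneCutoff C R δ p) _ p := e1.mul e2
    rw [e3.fderiv]
    simp
    ring
  refine (hkato _ hφ fun p => mul_nonneg (hθ0 _) (coneCutoff_nonneg _ _ _ _)).trans ?_
  refine integral_mono_ae ?_ ?_ ?_
  · refine hφ.integrable hm (a := fun z => |z.2 - y z.1|)
      (b := fun z => causalFlux f z.1 z.2 (y z.1)) (A := (1 + C) * (1 + M)) (by fun_prop)
      ((measurable_causalFlux hf).comp (f := fun z : (ℝ × ℝ) × ℝ => (z.1, z.2, y z.1))
        (by fun_prop)) ?_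
    filter_upwards [hcone] with z hz
    have h1 : |z.2 - y z.1| ≤ (1 + M) * (1 + |z.2|) := by
      have := abs_sub z.2 (y z.1)
      nlinarith [hM z.1, mul_nonneg hM0 (abs_nonneg z.2)]
    have h2 := mul_le_mul_of_nonneg_left h1 hC
    rw [abs_abs, mul_assoc, add_mul, one_mul]
    have h3 : 0 ≤ (1 + M) * (1 + |z.2|) := by positivity
    exact ⟨by nlinarith, by linarith⟩
  · refine hm.integrable_mul_abs_sub hy hM (g := fun p => deriv θ p.1 * coneCutoff C R δ p) ?_ ?_
    · exact ((hθ.continuous_deriv le_rfl).comp continuous_fst).mul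
        (contDiff_coneCutoff C R hδ).continuous
    -- Off the support of the product, the product and its time derivative vanish. If `θ = 0` there,
    -- the derivative reduces to `θ'` times the cutoff; otherwise the cutoff is zero. Either way
    -- `θ'` times the cutoff is zero.
    · refine hφ.hasCompactSupport.mono' fun p hp => ?_
      by_contra hp'
      have h0 : fderiv ℝ (fun p => θ p.1 * coneCutoff C R δ p) p (1, 0) = 0 := by
        rw [Function.notMem_support.1 fun h' => hp' (support_fderiv_subset ℝ h')]; rfl
      have h1 : θ p.1 * coneCutoff C R δ p = 0 :=
        image_eq_zero_of_notMem_tsupport (f := fun p : ℝ × ℝ => θ p.1 * coneCutoff C R δ p) hp'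
      rw [hd] at h0
      rcases mul_eq_zero.1 h1 with h2 | h2
      · simp only [h2, zero_mul, add_zero, mul_one] at h0
        exact hp h0
      · exact hp (by simp [h2])
  · filter_upwards [hcone] with z hz
    simp only [timeDeriv, spaceDeriv, hd, mul_one, mul_zero, zero_mul, zero_add]
    have h2 := abs_spaceDeriv_coneCutoff_mul_le (R := R) hC hδ z.1
    have h3 : spaceDeriv (coneCutoff C R δ) z.1 * causalFlux f z.1 z.2 (y z.1)
        ≤ -timeDeriv (coneCutoff C R δ) z.1 * |z.2 - y z.1| := by
      calc _ ≤ |spaceDeriv (coneCutoff C R δ) z.1| * |causalFlux f z.1 z.2 (y z.1)| := by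
            rw [← abs_mul]; exact le_abs_self _
        _ ≤ |spaceDeriv (coneCutoff C R δ) z.1| * (C * |z.2 - y z.1|) :=
            mul_le_mul_of_nonneg_left hz (abs_nonneg _)
        _ ≤ _ := by
            rw [← mul_assoc]
            exact mul_le_mul_of_nonneg_right h2 (abs_nonneg _)
    have h4 := mul_le_mul_of_nonneg_left h3 (hθ0 z.1.1)
    simp only [timeDeriv, spaceDeriv] at h4
    linarith

/-! ### Time cutoffs and the averaged cone estimate -/

theorem exists_time_cutoff {ρ₀ ρ₁ : ℝ → ℝ} (h₀ : Continuous ρ₀) (h₁ : Continuous ρ₁)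
    (hs₀ : HasCompactSupport ρ₀) (hs₁ : HasCompactSupport ρ₁) (hp₀ : ∀ t, 0 ≤ ρ₀ t)
    (hp₁ : ∀ t, 0 ≤ ρ₁ t) (hz₀ : ∀ t, 0 ≤ t → ρ₀ t = 0) (hz₁ : ∀ t ≤ 0, ρ₁ t = 0)
    (heq : ∫ t, ρ₀ t = ∫ t, ρ₁ t) :
    ∃ θ : ℝ → ℝ, ContDiff ℝ 1 θ ∧ HasCompactSupport θ ∧ (∀ t, 0 ≤ θ t) ∧
      ∀ t, deriv θ t = ρ₀ t - ρ₁ t := by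
  have i₀ : Integrable ρ₀ := h₀.integrable_of_hasCompactSupport hs₀
  have i₁ : Integrable ρ₁ := h₁.integrable_of_hasCompactSupport hs₁
  have hdiff : ∀ {ρ : ℝ → ℝ}, Continuous ρ → Integrable ρ → ∀ t,
      HasDerivAt (fun t => ∫ s in Set.Iic t, ρ s) (ρ t) t := by
    intro ρ h i t
    have e : (fun t => ∫ s in Set.Iic t, ρ s) = fun t => (∫ s in (0 : ℝ)..t, ρ s)
        + ∫ s in Set.Iic (0 : ℝ), ρ s := by
      funext t
      rw [← intervalIntegral.integral_Iic_sub_Iic i.integrableOn i.integrableOn]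
      ring
    rw [e]
    exact (h.integral_hasStrictDerivAt 0 t).hasDerivAt.add_const _
  -- Equal masses make this primitive of `ρ₀ - ρ₁` compactly supported. It is nonnegative because
  -- all of `ρ₀` is collected before time zero and `ρ₁` is spent only afterwards.
  set θ : ℝ → ℝ := fun t => (∫ s in Set.Iic t, ρ₀ s) - ∫ s in Set.Iic t, ρ₁ s with hθ
  have hd : ∀ t, HasDerivAt θ (ρ₀ t - ρ₁ t) t := fun t => (hdiff h₀ i₀ t).sub (hdiff h₁ i₁ t)
  have hfull : ∀ {ρ : ℝ → ℝ} {t : ℝ}, (∀ s, t < s → ρ s = 0) →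
      ∫ s in Set.Iic t, ρ s = ∫ s, ρ s := fun {ρ t} h =>
    setIntegral_eq_integral_of_forall_compl_eq_zero fun s hs => h s (not_le.1 hs)
  have hnone : ∀ {ρ : ℝ → ℝ} {t : ℝ}, (∀ s ≤ t, ρ s = 0) →
      ∫ s in Set.Iic t, ρ s = 0 := fun {ρ t} h => by
    rw [setIntegral_congr_fun measurableSet_Iic (g := fun _ => (0 : ℝ)) fun s hs => h s hs]; simp
  refine ⟨θ, ?_, ?_, fun t => ?_, fun t => (hd t).deriv⟩
  · rw [contDiff_one_iff_deriv]
    refine ⟨fun t => (hd t).differentiableAt, ?_⟩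
    rw [funext fun t => (hd t).deriv]
    exact h₀.sub h₁
  · obtain ⟨N₀, hN₀⟩ := hs₀.isCompact.isBounded.subset_closedBall 0
    obtain ⟨N₁, hN₁⟩ := hs₁.isCompact.isBounded.subset_closedBall 0
    have key : ∀ s, max N₀ N₁ < |s| → ρ₀ s = 0 ∧ ρ₁ s = 0 := fun s hs => by
      constructor <;> by_contra h0
      · have := hN₀ (subset_tsupport _ h0)
        rw [mem_closedBall_zero_iff, Real.norm_eq_abs] at this
        exact absurd (this.trans (le_max_left _ _)) hs.not_ge
      · have := hN₁ (subset_tsupport _ h0)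
        rw [mem_closedBall_zero_iff, Real.norm_eq_abs] at this
        exact absurd (this.trans (le_max_right _ _)) hs.not_ge
    refine HasCompactSupport.intro (isCompact_closedBall (0 : ℝ) (max N₀ N₁)) fun t ht => ?_
    rw [mem_closedBall_zero_iff, Real.norm_eq_abs, not_le, lt_abs] at ht
    rcases ht with ht | ht
    · have h : ∀ s, t < s → max N₀ N₁ < |s| := fun s hs => (ht.trans hs).trans_le (le_abs_self s)
      simp only [hθ]
      rw [hfull fun s hs => (key s (h s hs)).1, hfull fun s hs => (key s (h s hs)).2, heq, sub_self]
    · have h : ∀ s ≤ t, max N₀ N₁ < |s| := fun s hs =>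
        (ht.trans_le (neg_le_neg hs)).trans_le (neg_le_abs s)
      simp only [hθ]
      rw [hnone fun s hs => (key s (h s hs)).1, hnone fun s hs => (key s (h s hs)).2, sub_self]
  · simp only [hθ]
    rcases le_total t 0 with ht | ht
    · rw [hnone (ρ := ρ₁) fun s hs => hz₁ s (hs.trans ht), sub_zero]
      exact integral_nonneg hp₀
    · rw [hfull (ρ := ρ₀) fun s hs => hz₀ s (ht.trans hs.le), heq, sub_nonneg]
      exact setIntegral_le_integral i₁ (ae_of_all _ hp₁)

/-- A bump that dominates the indicator of `[a, b]`, together with a bump of the same mass in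
negative times. -/
theorem exists_time_bumps {a b δ : ℝ} (hδ : 0 < δ) (hδa : δ < a) (hab : a < b) :
    ∃ ρ₀ ρ₁ θ : ℝ → ℝ, Continuous ρ₀ ∧ Continuous ρ₁ ∧ HasCompactSupport ρ₀ ∧
      HasCompactSupport ρ₁ ∧ (∀ t, 0 ≤ ρ₀ t) ∧ (∀ t, 0 ≤ ρ₁ t) ∧
      (∀ t, ρ₀ t ≠ 0 → -δ < t ∧ t < 0) ∧ (∀ t ∈ Set.Icc a b, ρ₁ t = 1) ∧
      ∫ t, ρ₀ t ≤ b - a + 2 * δ ∧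
      ContDiff ℝ 1 θ ∧ HasCompactSupport θ ∧ (∀ t, 0 ≤ θ t) ∧ ∀ t, deriv θ t = ρ₀ t - ρ₁ t := by
  -- `β₁` is one exactly on the margin-free interval `[a, b]` demanded and lives within distance `δ`
  -- of it, hence in positive times as `δ < a`; `β₀` lives in `(-δ, 0)` and is rescaled to the same
  -- mass `c`.
  let β₁ : ContDiffBump ((a + b) / 2) := ⟨(b - a) / 2, (b - a) / 2 + δ, by linarith, by linarith⟩
  let β₀ : ContDiffBump (-δ / 2) := ⟨δ / 8, δ / 4, by positivity, by linarith⟩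
  set c := ∫ t, β₁ t with hc
  have hc0 : 0 ≤ c := integral_nonneg fun t => β₁.nonneg
  have hc1 : c ≤ b - a + 2 * δ := by
    have := β₁.integral_le_measure_closedBall (μ := volume)
    have e : β₁.rOut = (b - a) / 2 + δ := rfl
    rw [e, Real.closedBall_eq_Icc, Real.volume_real_Icc_of_le (by linarith)] at this
    linarith
  have hcont₀ : Continuous fun t => c * β₀.normed volume t := continuous_const.mul β₀.continuous_normed
  have hs₀ : HasCompactSupport fun t => c * β₀.normed volume t :=
    (β₀.hasCompactSupport_normed (μ := volume)).mul_left (f := fun _ => c)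
  have hp₀ : ∀ t, 0 ≤ c * β₀.normed volume t := fun t => mul_nonneg hc0 (β₀.nonneg_normed t)
  have hsupp₀ : ∀ t, c * β₀.normed volume t ≠ 0 → -δ < t ∧ t < 0 := fun t ht => by
    have : t ∈ Function.support (β₀.normed volume) := right_ne_zero_of_mul ht
    rw [β₀.support_normed_eq, Metric.mem_ball, Real.dist_eq, abs_lt] at this
    have e : β₀.rOut = δ / 4 := rfl
    rw [e] at this
    constructor <;> linarith [this.1, this.2]
  have hint₀ : ∫ t, c * β₀.normed volume t = c := by
    rw [integral_const_mul, β₀.integral_normed, mul_one]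
  obtain ⟨θ, h1, h2, h3, h4⟩ := exists_time_cutoff hcont₀ β₁.continuous hs₀ β₁.hasCompactSupport
    hp₀ (fun t => β₁.nonneg) (fun t ht => by
      by_contra h; exact absurd (hsupp₀ t h).2 ht.not_gt) (fun t ht => by
      refine β₁.zero_of_le_dist ?_
      have e : β₁.rOut = (b - a) / 2 + δ := rfl
      rw [e, Real.dist_eq, abs_of_nonpos (by linarith)]
      linarith) hint₀
  refine ⟨_, _, θ, hcont₀, β₁.continuous, hs₀, β₁.hasCompactSupport, hp₀, fun t => β₁.nonneg, hsupp₀,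
    fun t ht => ?_, hint₀.trans_le hc1, h1, h2, h3, h4⟩
  refine β₁.one_of_mem_closedBall ?_
  have e : β₁.rIn = (b - a) / 2 := rfl
  rw [e, Real.closedBall_eq_Icc]
  constructor <;> linarith [ht.1, ht.2]

theorem measurableSet_abs_le (R : ℝ) : MeasurableSet {x : ℝ | |x| ≤ R} :=
  measurableSet_le (by fun_prop) measurable_const

theorem cone_estimate_approx {κ : Kernel (ℝ × ℝ) ℝ} [IsMarkovKernel κ]
    (hm : HasLocalMoment volume κ) {y : ℝ × ℝ → ℝ} (hy : Measurable y) {M : ℝ}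
    (hM : ∀ p, |y p| ≤ M) {C : ℝ} (hC : 0 ≤ C)
    (hcone : ∀ θ : ℝ → ℝ, ContDiff ℝ 1 θ → HasCompactSupport θ → (∀ t, 0 ≤ θ t) → ∀ R δ : ℝ,
      0 < δ → 0 ≤ ∫ z, deriv θ z.1.1 * coneCutoff C R δ z.1 * |z.2 - y z.1| ∂(volume ⊗ₘ κ))
    {Φ₀ : ℝ → ℝ≥0∞} (hΦ₀ : ∀ t < 0, ∀ x,
      ∫⁻ u, ENNReal.ofReal |u - y (t, x)| ∂κ (t, x) = Φ₀ x)
    {a b δ : ℝ} (hδ : 0 < δ) (hδa : δ < a) (hab : a < b) (R : ℝ) :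
    ∫⁻ t in Set.Icc a b, ∫⁻ x in {x | |x| ≤ R - C * t},
        ∫⁻ u, ENNReal.ofReal |u - y (t, x)| ∂κ (t, x)
      ≤ ENNReal.ofReal (b - a + 2 * δ) * ∫⁻ x in {x | |x| ≤ R + (2 + C) * δ}, Φ₀ x := by
  obtain ⟨ρ₀, ρ₁, θ, hc₀, hc₁, hs₀, hs₁, hp₀, hp₁, hsupp₀, hone, hmass, hθ, hθs, hθ0, hθd⟩ :=
    exists_time_bumps hδ hδa hab
  -- With the radius `R + δ`, the cutoff equals one on `|x| ≤ R - C t` and vanishes unless `|x| ≤ R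
  -- + 2 δ - C t`. For `-δ < t < 0` the latter is below `R + (2 + C) δ`.
  have hineq := hcone θ hθ hθs hθ0 (R + δ) δ hδ
  set m := (volume : Measure (ℝ × ℝ)) ⊗ₘ κ with hmdef
  set G := coneCutoff C (R + δ) δ with hG
  have hGc : Continuous G := (contDiff_coneCutoff C (R + δ) hδ).continuous
  have hcs : ∀ {ρ : ℝ → ℝ}, HasCompactSupport ρ →
      HasCompactSupport fun p : ℝ × ℝ => ρ p.1 * G p := fun {ρ} hs => by
    obtain ⟨N, hN⟩ := hs.isCompact.isBounded.subset_closedBall 0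
    refine HasCompactSupport.intro ((isCompact_closedBall (0 : ℝ) N).prod
      (isCompact_closedBall (0 : ℝ) (R + δ + δ + C * N))) fun p hp => ?_
    by_contra h0
    have hpN := hN (subset_tsupport _ (left_ne_zero_of_mul h0))
    refine hp ⟨hpN, ?_⟩
    have h1 := abs_le_of_coneCutoff_ne_zero hδ (right_ne_zero_of_mul h0)
    have h2 : |p.1| ≤ N := by simpa using hpN
    rw [mem_closedBall_zero_iff, Real.norm_eq_abs]
    nlinarith [(abs_le.1 h2).1]
  have i₀ := hm.integrable_mul_abs_sub hy hM (g := fun p => ρ₀ p.1 * G p)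
    ((hc₀.comp continuous_fst).mul hGc) (hcs hs₀)
  have i₁ := hm.integrable_mul_abs_sub hy hM (g := fun p => ρ₁ p.1 * G p)
    ((hc₁.comp continuous_fst).mul hGc) (hcs hs₁)
  have hle : ∫ z, ρ₁ z.1.1 * G z.1 * |z.2 - y z.1| ∂m
      ≤ ∫ z, ρ₀ z.1.1 * G z.1 * |z.2 - y z.1| ∂m := by
    rw [← sub_nonneg, ← integral_sub i₀ i₁]
    refine hineq.trans_eq (integral_congr_ae (ae_of_all _ fun z => ?_))
    simp only [hθd]
    ring
  have hle' : ∫⁻ z, ENNReal.ofReal (ρ₁ z.1.1 * G z.1 * |z.2 - y z.1|) ∂m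
      ≤ ∫⁻ z, ENNReal.ofReal (ρ₀ z.1.1 * G z.1 * |z.2 - y z.1|) ∂m := by
    rw [← ofReal_integral_eq_lintegral_ofReal i₁ (ae_of_all _ fun z => mul_nonneg
      (mul_nonneg (hp₁ _) (coneCutoff_nonneg _ _ _ _)) (abs_nonneg _)),
      ← ofReal_integral_eq_lintegral_ofReal i₀ (ae_of_all _ fun z => mul_nonneg
      (mul_nonneg (hp₀ _) (coneCutoff_nonneg _ _ _ _)) (abs_nonneg _))]
    exact ENNReal.ofReal_le_ofReal hle
  have hGm := hGc.measurable
  have hm₀ := hc₀.measurable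
  have hm₁ := hc₁.measurable
  have hprod : ∀ {ρ : ℝ → ℝ}, Measurable ρ → (∀ t, 0 ≤ ρ t) →
      ∫⁻ z, ENNReal.ofReal (ρ z.1.1 * G z.1 * |z.2 - y z.1|) ∂m
      = ∫⁻ t, ∫⁻ x, ENNReal.ofReal (ρ t * G (t, x))
          * ∫⁻ u, ENNReal.ofReal |u - y (t, x)| ∂κ (t, x) := by
    intro ρ hρ hρ0
    have hmeas : Measurable fun z : (ℝ × ℝ) × ℝ =>
      ENNReal.ofReal (ρ z.1.1 * G z.1 * |z.2 - y z.1|) := by fun_prop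
    rw [hmdef, Measure.lintegral_compProd hmeas, Measure.volume_eq_prod,
      lintegral_prod _ (hmeas.lintegral_kernel_prod_right').aemeasurable]
    refine lintegral_congr fun t => lintegral_congr fun x => ?_
    have hpos : 0 ≤ ρ t * G (t, x) := mul_nonneg (hρ0 t) (coneCutoff_nonneg C (R + δ) δ (t, x))
    simp only [ENNReal.ofReal_mul hpos]
    rw [lintegral_const_mul' _ _ ENNReal.ofReal_ne_top]
  rw [hprod hm₁ hp₁, hprod hm₀ hp₀] at hle'
  calc ∫⁻ t in Set.Icc a b, ∫⁻ x in {x | |x| ≤ R - C * t},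
        ∫⁻ u, ENNReal.ofReal |u - y (t, x)| ∂κ (t, x)
      ≤ ∫⁻ t, ∫⁻ x, ENNReal.ofReal (ρ₁ t * G (t, x))
          * ∫⁻ u, ENNReal.ofReal |u - y (t, x)| ∂κ (t, x) := by
        rw [← lintegral_indicator measurableSet_Icc]
        refine lintegral_mono fun t => ?_
        by_cases ht : t ∈ Set.Icc a b
        · rw [Set.indicator_of_mem ht, ← lintegral_indicator (measurableSet_abs_le _)]
          refine lintegral_mono fun x => ?_
          by_cases hx : |x| ≤ R - C * t
          · rw [Set.indicator_of_mem (show x ∈ {x : ℝ | |x| ≤ R - C * t} from hx), hone t ht, hG,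
              coneCutoff_eq_one hδ (by simp only; linarith)]
            simp
          · rw [Set.indicator_of_notMem (show x ∉ {x : ℝ | |x| ≤ R - C * t} from hx)]
            exact zero_le
        · rw [Set.indicator_of_notMem ht]
          exact zero_le
    _ ≤ ∫⁻ t, ∫⁻ x, ENNReal.ofReal (ρ₀ t * G (t, x))
          * ∫⁻ u, ENNReal.ofReal |u - y (t, x)| ∂κ (t, x) := hle'
    _ ≤ ∫⁻ t, ENNReal.ofReal (ρ₀ t) * ∫⁻ x in {x | |x| ≤ R + (2 + C) * δ}, Φ₀ x := by
        refine lintegral_mono fun t => ?_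
        by_cases ht : ρ₀ t = 0
        · simp [ht]
        obtain ⟨h1, h2⟩ := hsupp₀ t ht
        rw [← lintegral_const_mul' _ _ ENNReal.ofReal_ne_top,
          ← lintegral_indicator (measurableSet_abs_le _)]
        refine lintegral_mono fun x => ?_
        simp only [hΦ₀ t h2 x]
        by_cases hx : G (t, x) = 0
        · simp [hx]
        · have h3 := abs_le_of_coneCutoff_ne_zero hδ hx
          simp only at h3
          have h4 : |x| ≤ R + (2 + C) * δ := by nlinarith
          rw [Set.indicator_of_mem (show x ∈ {x : ℝ | |x| ≤ R + (2 + C) * δ} from h4)]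
          refine mul_le_mul_left (ENNReal.ofReal_le_ofReal ?_) _
          exact mul_le_of_le_one_right (hp₀ t) (coneCutoff_le_one _ _ _ _)
    _ ≤ ENNReal.ofReal (b - a + 2 * δ) * ∫⁻ x in {x | |x| ≤ R + (2 + C) * δ}, Φ₀ x := by
        rw [lintegral_mul_const _ (by fun_prop), ← ofReal_integral_eq_lintegral_ofReal
          (hc₀.integrable_of_hasCompactSupport hs₀) (ae_of_all _ hp₀)]
        exact mul_le_mul_left (ENNReal.ofReal_le_ofReal hmass) _

/-! ### Contraction at almost every time -/

theorem tendsto_setLIntegral_abs_le {Φ₀ : ℝ → ℝ≥0∞}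
    (hfin : ∀ R, ∫⁻ x in {x : ℝ | |x| ≤ R}, Φ₀ x < ∞) (R : ℝ) :
    Tendsto (fun r => ∫⁻ x in {x : ℝ | |x| ≤ r}, Φ₀ x) (𝓝[>] R)
      (𝓝 (∫⁻ x in {x : ℝ | |x| ≤ R}, Φ₀ x)) := by
  have h := tendsto_measure_biInter_gt (μ := volume.withDensity Φ₀) (a := R)
    (s := fun r => {x : ℝ | |x| ≤ r}) (fun r _ => (measurableSet_abs_le r).nullMeasurableSet)
    (fun i j _ hij x hx => le_trans hx hij) ⟨R + 1, by simp, by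
      rw [withDensity_apply _ (measurableSet_abs_le _)]; exact (hfin _).ne⟩
  have e : ⋂ r > R, {x : ℝ | |x| ≤ r} = {x : ℝ | |x| ≤ R} := by
    ext x
    simp only [Set.mem_iInter]
    exact ⟨fun h => le_of_forall_gt_imp_ge_of_dense h, fun h r hr => le_trans h (le_of_lt hr)⟩
  rw [e, withDensity_apply _ (measurableSet_abs_le _)] at h
  refine h.congr fun r => ?_
  exact withDensity_apply _ (measurableSet_abs_le _)

/-- Lebesgue differentiation along the intervals `[t, s]`, `s ↓ t`. The hypothesis itself provides
integrability on compact subintervals of `(0, ∞)`; the endpoint `n + 2` leaves room to the right of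
every `t < n + 1`. -/
theorem ae_le_of_forall_setLIntegral_Icc_le {V : ℝ → ℝ≥0∞} (hV : Measurable V) {c : ℝ≥0∞}
    (hc : c ≠ ∞) (h : ∀ a b, 0 < a → a < b → ∫⁻ t in Set.Icc a b, V t ≤ ENNReal.ofReal (b - a) * c) :
    ∀ᵐ t : ℝ, 0 < t → V t ≤ c := by
  have key : ∀ n : ℕ, ∀ᵐ t : ℝ, 1 / ((n : ℝ) + 1) < t → t < n + 1 → V t ≤ c := fun n => by
    have hn : (0 : ℝ) < 1 / ((n : ℝ) + 1) := by positivity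
    set S := Set.Icc (1 / ((n : ℝ) + 1)) (n + 2) with hS
    have hlt : 1 / ((n : ℝ) + 1) < n + 2 := by
      rw [div_lt_iff₀ (by positivity)]
      nlinarith [(Nat.cast_nonneg n : (0 : ℝ) ≤ n)]
    have hfin : ∫⁻ t, S.indicator V t ≠ ∞ := by
      rw [lintegral_indicator measurableSet_Icc]
      exact ((h _ _ hn hlt).trans_lt (ENNReal.mul_lt_top ENNReal.ofReal_lt_top hc.lt_top)).ne
    filter_upwards [VitaliFamily.ae_tendsto_lintegral_div'
      (IsUnifLocDoublingMeasure.vitaliFamily (volume : Measure ℝ) 1)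
      (hV.indicator (measurableSet_Icc (a := 1 / ((n : ℝ) + 1)) (b := (n : ℝ) + 2))) hfin]
      with t ht h1 h2
    have hmem : t ∈ S := ⟨h1.le, by linarith⟩
    have hlim := ht.comp (Real.tendsto_Icc_vitaliFamily_right t)
    rw [Set.indicator_of_mem hmem] at hlim
    refine le_of_tendsto hlim ?_
    filter_upwards [Ioo_mem_nhdsGT (show t < n + 2 by linarith)] with s hs
    have hpos : 0 < s - t := by linarith [hs.1]
    rw [Function.comp_apply, Real.volume_Icc]
    refine ENNReal.div_le_of_le_mul ?_
    rw [mul_comm]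
    refine le_trans ?_ (h t s (hn.trans h1) hs.1)
    exact lintegral_mono fun x => Set.indicator_le_self _ _ _
  filter_upwards [ae_all_iff.2 key] with t ht h0
  obtain ⟨n, hn⟩ := exists_nat_one_div_lt h0
  obtain ⟨k, hk⟩ := exists_nat_gt t
  refine ht (max n k) (lt_of_le_of_lt ?_ hn) (hk.trans_le ?_)
  · refine one_div_le_one_div_of_le (by positivity) ?_
    have : (n : ℝ) ≤ (max n k : ℕ) := by exact_mod_cast le_max_left n k
    linarith
  · have : (k : ℝ) ≤ (max n k : ℕ) := by exact_mod_cast le_max_right n k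
    linarith

/-- Contraction at almost every time, for all radii. -/
theorem ae_contraction {κ : Kernel (ℝ × ℝ) ℝ} [IsMarkovKernel κ]
    (hm : HasLocalMoment volume κ) {y : ℝ × ℝ → ℝ} (hy : Measurable y) {M : ℝ}
    (hM : ∀ p, |y p| ≤ M) {C : ℝ} (hC : 0 ≤ C)
    (hcone : ∀ θ : ℝ → ℝ, ContDiff ℝ 1 θ → HasCompactSupport θ → (∀ t, 0 ≤ θ t) → ∀ R δ : ℝ,
      0 < δ → 0 ≤ ∫ z, deriv θ z.1.1 * coneCutoff C R δ z.1 * |z.2 - y z.1| ∂(volume ⊗ₘ κ))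
    {Φ₀ : ℝ → ℝ≥0∞} (hΦ₀ : ∀ t < 0, ∀ x,
      ∫⁻ u, ENNReal.ofReal |u - y (t, x)| ∂κ (t, x) = Φ₀ x)
    (hfin : ∀ R, ∫⁻ x in {x : ℝ | |x| ≤ R}, Φ₀ x < ∞) :
    ∀ᵐ t : ℝ, 0 < t → ∀ r, ∫⁻ x in {x | |x| ≤ r}, ∫⁻ u, ENNReal.ofReal |u - y (t, x)| ∂κ (t, x)
      ≤ ∫⁻ x in {x | |x| ≤ r + C * t}, Φ₀ x := by
  have hΦm : Measurable fun p : ℝ × ℝ => ∫⁻ u, ENNReal.ofReal |u - y p| ∂κ p := by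
    have : Measurable fun z : (ℝ × ℝ) × ℝ => ENNReal.ofReal |z.2 - y z.1| := by fun_prop
    exact this.lintegral_kernel_prod_right'
  have hint : ∀ R a b, 0 < a → a < b → ∫⁻ t in Set.Icc a b, ∫⁻ x in {x | |x| ≤ R - C * t},
      ∫⁻ u, ENNReal.ofReal |u - y (t, x)| ∂κ (t, x)
      ≤ ENNReal.ofReal (b - a) * ∫⁻ x in {x | |x| ≤ R}, Φ₀ x := by
    intro R a b ha hab
    -- The factor `2 + C` is positive even for `C = 0`, so the radii approach `R` strictly from the
    -- right, where continuity from above applies.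
    have hshift : Tendsto (fun δ : ℝ => R + (2 + C) * δ) (𝓝[>] 0) (𝓝[>] R) := by
      refine tendsto_nhdsWithin_iff.2 ⟨?_, ?_⟩
      · have : ContinuousAt (fun δ : ℝ => R + (2 + C) * δ) 0 := by fun_prop
        simpa using this.tendsto.mono_left nhdsWithin_le_nhds
      · filter_upwards [self_mem_nhdsWithin] with δ hδ
        have : 0 < (2 + C) * δ := mul_pos (by linarith) hδ
        simpa using this
    have h1 := (tendsto_setLIntegral_abs_le hfin R).comp hshift
    have h2 : Tendsto (fun δ : ℝ => ENNReal.ofReal (b - a + 2 * δ)) (𝓝[>] 0)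
        (𝓝 (ENNReal.ofReal (b - a))) := by
      refine ENNReal.tendsto_ofReal ?_
      have : ContinuousAt (fun δ : ℝ => b - a + 2 * δ) 0 := by fun_prop
      simpa using this.tendsto.mono_left nhdsWithin_le_nhds
    have h3 := ENNReal.Tendsto.mul h2 (Or.inr (hfin R).ne) h1 (Or.inr ENNReal.ofReal_ne_top)
    refine ge_of_tendsto h3 ?_
    filter_upwards [Ioo_mem_nhdsGT ha] with δ hδ
    exact cone_estimate_approx hm hy hM hC hcone hΦ₀ hδ.1 hδ.2 hab R
  have hVm : ∀ R, Measurable fun t => ∫⁻ x in {x | |x| ≤ R - C * t},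
      ∫⁻ u, ENNReal.ofReal |u - y (t, x)| ∂κ (t, x) := fun R => by
    have hS : MeasurableSet {p : ℝ × ℝ | |p.2| ≤ R - C * p.1} :=
      measurableSet_le (by fun_prop) (by fun_prop)
    have e : (fun t => ∫⁻ x in {x | |x| ≤ R - C * t},
        ∫⁻ u, ENNReal.ofReal |u - y (t, x)| ∂κ (t, x)) = fun t => ∫⁻ x,
        {p : ℝ × ℝ | |p.2| ≤ R - C * p.1}.indicator
          (fun p => ∫⁻ u, ENNReal.ofReal |u - y p| ∂κ p) (t, x) := by
      funext t
      rw [← lintegral_indicator (measurableSet_abs_le _)]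
      rfl
    rw [e]
    exact (hΦm.indicator hS).lintegral_prod_right'
  -- Rational radii give a single null set of times. Any `r` is then reached by rationals decreasing
  -- to `r + C * t`, using right continuity of the initial deviation in the radius.
  have hae := ae_all_iff.2 fun q : ℚ =>
    ae_le_of_forall_setLIntegral_Icc_le (hVm q) (hfin q).ne (hint q)
  filter_upwards [hae] with t ht h0 r
  refine ge_of_tendsto (tendsto_setLIntegral_abs_le hfin (r + C * t)) ?_
  filter_upwards [self_mem_nhdsWithin] with s hs
  obtain ⟨q, hq1, hq2⟩ := exists_rat_btwn (Set.mem_Ioi.1 hs)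
  refine le_trans ?_ ((ht q h0).trans (lintegral_mono_set fun x hx => le_trans hx hq2.le))
  refine lintegral_mono_set fun x hx => ?_
  have hx' : |x| ≤ r := hx
  change |x| ≤ q - C * t
  linarith

/-! ### Lower semicontinuity at right limits in time -/

/-- Compactly supported continuous functions increasing to the absolute value. -/
noncomputable def absTent (n : ℕ) (v : ℝ) : ℝ := max 0 (min |v| (n - |v|))

theorem continuous_absTent (n : ℕ) : Continuous (absTent n) := by
  unfold absTent; fun_prop

theorem absTent_nonneg (n : ℕ) (v : ℝ) : 0 ≤ absTent n v := le_max_left _ _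

theorem absTent_le (n : ℕ) (v : ℝ) : absTent n v ≤ |v| := max_le (abs_nonneg v) (min_le_left _ _)

theorem absTent_mono (v : ℝ) : Monotone fun n => absTent n v := fun m n h => by
  have : (m : ℝ) ≤ n := by exact_mod_cast h
  exact max_le_max le_rfl (min_le_min le_rfl (by linarith))

theorem hasCompactSupport_absTent_sub (n : ℕ) (c : ℝ) :
    HasCompactSupport fun u => absTent n (u - c) := by
  refine HasCompactSupport.intro (isCompact_closedBall c (n : ℝ)) fun u hu => ?_
  rw [Metric.mem_closedBall, Real.dist_eq, not_le] at hu
  exact max_eq_left ((min_le_right _ _).trans (by linarith))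

theorem iSup_ofReal_absTent (v : ℝ) : ⨆ n, ENNReal.ofReal (absTent n v) = ENNReal.ofReal |v| := by
  refine le_antisymm (iSup_le fun n => ENNReal.ofReal_le_ofReal (absTent_le n v)) ?_
  obtain ⟨n, hn⟩ := exists_nat_ge (2 * |v|)
  refine le_trans (le_of_eq ?_) (le_iSup (fun n => ENNReal.ofReal (absTent n v)) n)
  rw [absTent, min_eq_left (by linarith), max_eq_right (abs_nonneg v)]

instance neBot_rightAe (T : ℝ) : (𝓝[>] T ⊓ ae (volume : Measure ℝ)).NeBot := by
  rw [inf_neBot_iff]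
  intro s hs s' hs'
  obtain ⟨b, hb, hbs⟩ := mem_nhdsGT_iff_exists_Ioo_subset.1 hs
  by_contra hne
  rw [Set.not_nonempty_iff_eq_empty] at hne
  have h0 : volume (Set.Ioo T b) = 0 := by
    refine measure_mono_null (fun x hx => ?_) (mem_ae_iff.1 hs')
    intro hx'
    exact (Set.eq_empty_iff_forall_notMem.1 hne) x ⟨hbs hx, hx'⟩
  rw [Real.volume_Ioo, ENNReal.ofReal_eq_zero] at h0
  have : T < b := hb
  linarith

theorem eventually_rightAe {T : ℝ} {P : ℝ → Prop} (h : ∀ᵐ t : ℝ, T < t → P t) :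
    ∀ᶠ t in 𝓝[>] T ⊓ ae (volume : Measure ℝ), P t := by
  have h1 : ∀ᶠ t in 𝓝[>] T ⊓ ae (volume : Measure ℝ), T < t → P t := h.filter_mono inf_le_right
  have h2 : ∀ᶠ t in 𝓝[>] T ⊓ ae (volume : Measure ℝ), T < t :=
    Filter.Eventually.filter_mono inf_le_left self_mem_nhdsWithin
  filter_upwards [h1, h2] with t h1 h2 using h1 h2

theorem norm_integral_C₀_le (ν : ProbabilityMeasure ℝ) (g : C₀(ℝ, ℝ)) :
    ‖∫ u, g u ∂(ν : Measure ℝ)‖ ≤ ‖g‖ := by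
  have := norm_integral_le_of_norm_le_const (μ := (ν : Measure ℝ)) (C := ‖g‖)
    (ae_of_all _ fun u => g.toBCF.norm_coe_le_norm u)
  simpa using this

/-- The indicator of `A` is approximated in L¹ by continuous compactly supported functions. The
error is uniform in time, since pairings of probability measures with `g` are bounded by `‖g‖`. -/
theorem IsRightYoungTrace.tendsto_setIntegral {μ : ℝ × ℝ → ProbabilityMeasure ℝ} {T : ℝ}
    (h : IsRightYoungTrace μ T)
    (hY : ∀ᵐ t : ℝ, T < t → IsYoungMeasure volume fun x => μ (t, x)) {A : Set ℝ}
    (hA : MeasurableSet A) (hAf : volume A ≠ ∞) (g : C₀(ℝ, ℝ)) :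
    Tendsto (fun t => ∫ x in A, ∫ u, g u ∂(μ (t, x) : Measure ℝ)) (𝓝[>] T ⊓ ae volume)
      (𝓝 (∫ x in A, ∫ u, g u ∂(μ (T, x) : Measure ℝ))) := by
  rw [Metric.tendsto_nhds]
  intro ε hε
  have hind : Integrable (A.indicator fun _ => (1 : ℝ)) (volume : Measure ℝ) :=
    (integrable_indicator_iff hA).2 (integrableOn_const hAf)
  obtain ⟨φ, hφs, hφε, hφc, hφi⟩ := hind.exists_hasCompactSupport_integral_sub_le
    (ε := ε / (3 * (‖g‖ + 1))) (by positivity)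
  have key : ∀ ν : ℝ → ProbabilityMeasure ℝ, IsYoungMeasure volume ν →
      dist (∫ x in A, ∫ u, g u ∂(ν x : Measure ℝ)) (∫ x, φ x * ∫ u, g u ∂(ν x : Measure ℝ))
        ≤ ε / 3 := by
    intro ν hν
    have hb : ∀ᵐ x, ‖∫ u, g u ∂(ν x : Measure ℝ)‖ ≤ ‖g‖ :=
      ae_of_all _ fun x => norm_integral_C₀_le _ g
    have hm := (hν g).aestronglyMeasurable
    have i1 := hind.mul_bdd hm hb
    have i2 := hφi.mul_bdd hm hb
    have e : ∫ x in A, ∫ u, g u ∂(ν x : Measure ℝ)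
        = ∫ x, A.indicator (fun _ => (1 : ℝ)) x * ∫ u, g u ∂(ν x : Measure ℝ) := by
      rw [← integral_indicator hA]
      refine integral_congr_ae (ae_of_all _ fun x => ?_)
      by_cases hx : x ∈ A <;> simp [hx]
    rw [e, dist_eq_norm, ← integral_sub i1 i2]
    calc ‖∫ x, (A.indicator (fun _ => (1 : ℝ)) x * ∫ u, g u ∂(ν x : Measure ℝ)
          - φ x * ∫ u, g u ∂(ν x : Measure ℝ))‖
        ≤ ∫ x, ‖A.indicator (fun _ => (1 : ℝ)) x - φ x‖ * ‖g‖ := by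
          refine norm_integral_le_of_norm_le ((hind.sub hφi).norm.mul_const _) ?_
          filter_upwards [hb] with x hx
          rw [← sub_mul, norm_mul]
          exact mul_le_mul_of_nonneg_left hx (norm_nonneg _)
      _ ≤ ε / (3 * (‖g‖ + 1)) * ‖g‖ := by
          rw [integral_mul_const]
          exact mul_le_mul_of_nonneg_right hφε (norm_nonneg _)
      _ ≤ ε / 3 := by
          rw [div_mul_eq_mul_div, div_le_div_iff₀ (by positivity) (by positivity)]
          nlinarith [norm_nonneg g]
  filter_upwards [eventually_rightAe hY,
    Metric.tendsto_nhds.1 (h.2 φ hφc hφs g) (ε / 3) (by positivity)] with t h1 h2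
  have h3 := key _ h1
  have h4 := key _ h.1
  rw [dist_comm] at h4
  have h5 := dist_triangle4 (∫ x in A, ∫ u, g u ∂(μ (t, x) : Measure ℝ))
    (∫ x, φ x * ∫ u, g u ∂(μ (t, x) : Measure ℝ)) (∫ x, φ x * ∫ u, g u ∂(μ (T, x) : Measure ℝ))
    (∫ x in A, ∫ u, g u ∂(μ (T, x) : Measure ℝ))
  linarith

theorem lintegral_eq_ofReal_integral_C₀ {ν : ℝ → ProbabilityMeasure ℝ}
    (hν : IsYoungMeasure volume ν) {A : Set ℝ} (hAf : volume A ≠ ∞) {g : C₀(ℝ, ℝ)}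
    (hg : ∀ u, 0 ≤ g u) :
    ∫⁻ x in A, ∫⁻ u, ENNReal.ofReal (g u) ∂(ν x : Measure ℝ)
      = ENNReal.ofReal (∫ x in A, ∫ u, g u ∂(ν x : Measure ℝ)) := by
  have hint : ∀ x, Integrable (fun u => g u) (ν x : Measure ℝ) := fun x =>
    Integrable.of_bound g.continuous.aestronglyMeasurable ‖g‖
      (ae_of_all _ fun u => g.toBCF.norm_coe_le_norm u)
  rw [ofReal_integral_eq_lintegral_ofReal]
  · refine lintegral_congr fun x => ?_
    rw [ofReal_integral_eq_lintegral_ofReal (hint x) (ae_of_all _ hg)]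
  · exact Measure.integrableOn_of_bounded hAf (hν g).aestronglyMeasurable
      (ae_of_all _ fun x => norm_integral_C₀_le _ g)
  · exact ae_of_all _ fun x => integral_nonneg hg

theorem IsRightYoungTrace.tendsto_setLIntegral {μ : ℝ × ℝ → ProbabilityMeasure ℝ} {T : ℝ}
    (h : IsRightYoungTrace μ T)
    (hY : ∀ᵐ t : ℝ, T < t → IsYoungMeasure volume fun x => μ (t, x)) {A : Set ℝ}
    (hA : MeasurableSet A) (hAf : volume A ≠ ∞) {g : C₀(ℝ, ℝ)} (hg : ∀ u, 0 ≤ g u) :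
    Tendsto (fun t => ∫⁻ x in A, ∫⁻ u, ENNReal.ofReal (g u) ∂(μ (t, x) : Measure ℝ))
      (𝓝[>] T ⊓ ae volume)
      (𝓝 (∫⁻ x in A, ∫⁻ u, ENNReal.ofReal (g u) ∂(μ (T, x) : Measure ℝ))) := by
  rw [lintegral_eq_ofReal_integral_C₀ h.1 hAf hg]
  refine (ENNReal.tendsto_ofReal (h.tendsto_setIntegral hY hA hAf g)).congr' ?_
  filter_upwards [eventually_rightAe hY] with t ht
  exact (lintegral_eq_ofReal_integral_C₀ ht hAf hg).symm

/-- A pairing with a simple function splits into finitely many pieces. -/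
theorem setLIntegral_simpleFunc_eq_sum (s : SimpleFunc ℝ ℝ) {A : Set ℝ} (hA : MeasurableSet A)
    (F : ℝ → ℝ → ℝ≥0∞) :
    ∫⁻ x in A, F x (s x) = ∑ c ∈ s.range, ∫⁻ x in A ∩ s ⁻¹' {c}, F x c := by
  have hU : A = ⋃ c ∈ s.range, A ∩ s ⁻¹' {c} := by
    ext x
    simp only [Set.mem_iUnion, Set.mem_inter_iff, Set.mem_preimage, Set.mem_singleton_iff]
    exact ⟨fun hx => ⟨s x, s.mem_range_self x, hx, rfl⟩, fun ⟨_, _, hx, _⟩ => hx⟩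
  conv_lhs => rw [hU]
  rw [lintegral_biUnion_finset]
  · refine Finset.sum_congr rfl fun c _ => ?_
    refine setLIntegral_congr_fun (hA.inter (s.measurableSet_fiber c)) fun x hx => ?_
    have : s x = c := hx.2
    simp only [this]
  · intro c _ d _ hcd
    refine Set.disjoint_left.2 fun x hx hx' => hcd ?_
    exact (hx.2 : s x = c).symm.trans hx'.2
  · exact fun c _ => hA.inter (s.measurableSet_fiber c)

theorem lintegral_abs_sub_le (ν : ProbabilityMeasure ℝ) (a b : ℝ) :
    ∫⁻ u, ENNReal.ofReal |u - a| ∂(ν : Measure ℝ)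
      ≤ (∫⁻ u, ENNReal.ofReal |u - b| ∂(ν : Measure ℝ)) + ‖a - b‖ₑ := by
  calc ∫⁻ u, ENNReal.ofReal |u - a| ∂(ν : Measure ℝ)
      ≤ ∫⁻ u, (ENNReal.ofReal |u - b| + ‖a - b‖ₑ) ∂(ν : Measure ℝ) := by
        refine lintegral_mono fun u => ?_
        rw [Real.enorm_eq_ofReal_abs, ← ENNReal.ofReal_add (abs_nonneg _) (abs_nonneg _)]
        refine ENNReal.ofReal_le_ofReal ?_
        rw [abs_sub_comm a b]
        exact abs_sub_le u b a |>.trans_eq rfl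
    _ = _ := by rw [lintegral_add_right _ measurable_const]; simp

/-- Lower semicontinuity of the mean deviation at right limits in time. -/
theorem meanDeviation_le_of_isRightTrace {y : ℝ × ℝ → ℝ} {μ : ℝ × ℝ → ProbabilityMeasure ℝ} {T : ℝ}
    (hy : IsRightTrace y T) (hμ : IsRightYoungTrace μ T)
    (hY : ∀ᵐ t : ℝ, T < t → IsYoungMeasure volume fun x => μ (t, x))
    (hym : ∀ᵐ t : ℝ, T < t → AEMeasurable (fun x => y (t, x)) volume) {M : ℝ}
    (hyM : ∀ᵐ t : ℝ, T < t → ∀ᵐ x : ℝ, |y (t, x)| ≤ M) (r : ℝ) {a : ℝ → ℝ≥0∞} {b : ℝ≥0∞}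
    (hle : ∀ᵐ t : ℝ, T < t → meanDeviation (fun x => μ (t, x)) (fun x => y (t, x)) r ≤ a t)
    (ha : Tendsto a (𝓝[>] T) (𝓝 b)) :
    meanDeviation (fun x => μ (T, x)) (fun x => y (T, x)) r ≤ b := by
  set A := {x : ℝ | |x| ≤ r} with hAdef
  have hA : MeasurableSet A := measurableSet_abs_le r
  have hAf : volume A ≠ ∞ := by
    have : A ⊆ Set.Icc (-r) r := fun x hx => abs_le.1 hx
    exact ((measure_mono this).trans_lt measure_Icc_lt_top).ne
  set w : ℝ → ℝ := fun x => y (T, x) with hw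
  have hwm : AEMeasurable w (volume.restrict A) := hy.1.restrict
  have hlim := hy.2 r
  -- The limit is integrable on `A` because it is at finite L¹ distance from some bounded slice `y
  -- (t, ·)`.
  have hwint : MemLp w 1 (volume.restrict A) := by
    refine ⟨hwm.aestronglyMeasurable, ?_⟩
    rw [eLpNorm_one_eq_lintegral_enorm]
    obtain ⟨t, ⟨h1, h2⟩, h3⟩ := (((hlim.eventually_lt_const zero_lt_one).and
      (eventually_rightAe hym)).and (eventually_rightAe hyM)).exists
    calc ∫⁻ x in A, ‖w x‖ₑ ≤ ∫⁻ x in A, (‖y (t, x) - w x‖ₑ + ‖y (t, x)‖ₑ) := by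
          refine lintegral_mono fun x => ?_
          have : w x = -(y (t, x) - w x) + y (t, x) := by ring
          calc ‖w x‖ₑ = ‖-(y (t, x) - w x) + y (t, x)‖ₑ := by rw [← this]
            _ ≤ ‖-(y (t, x) - w x)‖ₑ + ‖y (t, x)‖ₑ := enorm_add_le _ _
            _ = _ := by rw [enorm_neg]
      _ = (∫⁻ x in A, ‖y (t, x) - w x‖ₑ) + ∫⁻ x in A, ‖y (t, x)‖ₑ :=
          lintegral_add_right' _ h2.restrict.enorm
      _ < ∞ := by
          refine ENNReal.add_lt_top.2 ⟨h1.trans ENNReal.one_lt_top, ?_⟩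
          calc ∫⁻ x in A, ‖y (t, x)‖ₑ ≤ ∫⁻ _ in A, ENNReal.ofReal M := by
                refine lintegral_mono_ae (ae_restrict_of_ae ?_)
                filter_upwards [h3] with x hx
                rw [Real.enorm_eq_ofReal_abs]
                exact ENNReal.ofReal_le_ofReal hx
            _ < ∞ := by
                rw [lintegral_const, Measure.restrict_apply_univ]
                exact ENNReal.mul_lt_top ENNReal.ofReal_lt_top hAf.lt_top
  refine ENNReal.le_of_forall_pos_le_add fun ε hε _ => ?_
  have hε2 : (ε : ℝ≥0∞) / 2 ≠ 0 := by simpa using hε.ne'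
  -- A weak-* limit handles integrands `g u` with `g` in `C₀`, whereas `|u - w x|` depends on `x`
  -- and is unbounded. The simple function `s` freezes the dependence on `x` on finitely many sets,
  -- and the tents truncate in `u`.
  obtain ⟨s, hs, -⟩ := hwint.exists_simpleFunc_eLpNorm_sub_lt ENNReal.one_ne_top hε2
  rw [eLpNorm_one_eq_lintegral_enorm] at hs
  set e := ∫⁻ x in A, ‖w x - s x‖ₑ with he
  have hes : e ≤ (ε : ℝ≥0∞) / 2 := hs.le
  have hwsm : AEMeasurable (fun x => ‖w x - s x‖ₑ) (volume.restrict A) :=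
    (hwm.sub s.measurable.aemeasurable).enorm
  have htent : ∀ n : ℕ, ∫⁻ x in A, ∫⁻ u, ENNReal.ofReal (absTent n (u - s x))
      ∂(μ (T, x) : Measure ℝ) ≤ b + e := by
    intro n
    have h1 : Tendsto (fun t => ∫⁻ x in A, ∫⁻ u, ENNReal.ofReal (absTent n (u - s x))
        ∂(μ (t, x) : Measure ℝ)) (𝓝[>] T ⊓ ae volume)
        (𝓝 (∫⁻ x in A, ∫⁻ u, ENNReal.ofReal (absTent n (u - s x)) ∂(μ (T, x) : Measure ℝ))) := by
      have hsum := fun t => setLIntegral_simpleFunc_eq_sum s hA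
        fun x c => ∫⁻ u, ENNReal.ofReal (absTent n (u - c)) ∂(μ (t, x) : Measure ℝ)
      simp only [hsum]
      refine tendsto_finsetSum _ fun c _ => ?_
      exact hμ.tendsto_setLIntegral hY (hA.inter (s.measurableSet_fiber c))
        ((measure_mono Set.inter_subset_left).trans_lt hAf.lt_top).ne
        (g := compactSupportC₀ _ ((continuous_absTent n).comp (continuous_id.sub continuous_const))
          (hasCompactSupport_absTent_sub n c)) fun u => absTent_nonneg _ _
    have h2 : Tendsto (fun t => a t + ∫⁻ x in A, ‖y (t, x) - w x‖ₑ) (𝓝[>] T ⊓ ae volume)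
        (𝓝 (b + 0)) := (ha.mono_left inf_le_left).add hlim
    rw [add_zero] at h2
    -- At time `t` the deviation from `s` exceeds that from `y (t, ·)` by at most the L¹ distance
    -- between `y (t, ·)` and `w`, which tends to zero, plus the fixed error `e`.
    refine le_of_tendsto_of_tendsto h1 (h2.add_const e) ?_
    filter_upwards [eventually_rightAe hle, eventually_rightAe hym] with t ht htm
    have hyw : AEMeasurable (fun x => ‖y (t, x) - w x‖ₑ) (volume.restrict A) :=
      (htm.restrict.sub hwm).enorm
    calc ∫⁻ x in A, ∫⁻ u, ENNReal.ofReal (absTent n (u - s x)) ∂(μ (t, x) : Measure ℝ)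
        ≤ ∫⁻ x in A, ((∫⁻ u, ENNReal.ofReal |u - y (t, x)| ∂(μ (t, x) : Measure ℝ))
            + ‖y (t, x) - w x‖ₑ + ‖w x - s x‖ₑ) := by
          refine lintegral_mono fun x => ?_
          calc ∫⁻ u, ENNReal.ofReal (absTent n (u - s x)) ∂(μ (t, x) : Measure ℝ)
              ≤ ∫⁻ u, ENNReal.ofReal |u - s x| ∂(μ (t, x) : Measure ℝ) :=
                lintegral_mono fun u => ENNReal.ofReal_le_ofReal (absTent_le _ _)
            _ ≤ (∫⁻ u, ENNReal.ofReal |u - y (t, x)| ∂(μ (t, x) : Measure ℝ))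
                + ‖s x - y (t, x)‖ₑ := lintegral_abs_sub_le _ _ _
            _ ≤ _ := by
                rw [add_assoc]
                gcongr
                have : s x - y (t, x) = -(y (t, x) - w x) + -(w x - s x) := by ring
                rw [this]
                refine (enorm_add_le _ _).trans_eq ?_
                rw [enorm_neg, enorm_neg]
      _ = (∫⁻ x in A, ∫⁻ u, ENNReal.ofReal |u - y (t, x)| ∂(μ (t, x) : Measure ℝ))
            + (∫⁻ x in A, ‖y (t, x) - w x‖ₑ) + e := by
          rw [lintegral_add_right' _ hwsm, lintegral_add_right' _ hyw]
      _ ≤ a t + (∫⁻ x in A, ‖y (t, x) - w x‖ₑ) + e := by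
          gcongr
          exact ht
  have hsup : ∫⁻ x in A, ∫⁻ u, ENNReal.ofReal |u - s x| ∂(μ (T, x) : Measure ℝ) ≤ b + e := by
    -- Monotone convergence as the tents increase to the modulus, on each level set of `s`, where
    -- the pairings are measurable in `x`.
    have h1 : ∫⁻ x in A, ∫⁻ u, ENNReal.ofReal |u - s x| ∂(μ (T, x) : Measure ℝ)
        = ⨆ n : ℕ, ∫⁻ x in A, ∫⁻ u, ENNReal.ofReal (absTent n (u - s x))
          ∂(μ (T, x) : Measure ℝ) := by
      have hsum := fun n : ℕ => setLIntegral_simpleFunc_eq_sum s hA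
        fun x c => ∫⁻ u, ENNReal.ofReal (absTent n (u - c)) ∂(μ (T, x) : Measure ℝ)
      have hmono : ∀ c x, Monotone fun (n : ℕ) =>
          ∫⁻ u, ENNReal.ofReal (absTent n (u - c)) ∂(μ (T, x) : Measure ℝ) := fun c x m n h =>
        lintegral_mono fun u => ENNReal.ofReal_le_ofReal (absTent_mono _ h)
      simp only [hsum]
      rw [← ENNReal.finsetSum_iSup_of_monotone (s := s.range) (f := fun c (n : ℕ) =>
          ∫⁻ x in A ∩ s ⁻¹' {c}, ∫⁻ u, ENNReal.ofReal (absTent n (u - c)) ∂(μ (T, x) : Measure ℝ))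
          fun c m n h => lintegral_mono fun x => hmono c x h,
        setLIntegral_simpleFunc_eq_sum s hA
          fun x c => ∫⁻ u, ENNReal.ofReal |u - c| ∂(μ (T, x) : Measure ℝ)]
      refine Finset.sum_congr rfl fun c _ => ?_
      rw [← lintegral_iSup']
      · refine lintegral_congr fun x => ?_
        rw [← lintegral_iSup]
        · exact lintegral_congr fun u => (iSup_ofReal_absTent _).symm
        · intro n
          have := continuous_absTent n
          fun_prop
        · exact fun m n h u => ENNReal.ofReal_le_ofReal (absTent_mono _ h)
      · intro n
        have hg := hμ.1 (compactSupportC₀ _ ((continuous_absTent n).comp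
          (continuous_id.sub continuous_const)) (hasCompactSupport_absTent_sub n c))
        refine (hg.restrict.ennreal_ofReal).congr (ae_of_all _ fun x => ?_)
        refine ofReal_integral_eq_lintegral_ofReal ?_ (ae_of_all _ fun u => absTent_nonneg _ _)
        exact ((continuous_absTent n).comp (continuous_id.sub continuous_const)
          ).integrable_of_hasCompactSupport (hasCompactSupport_absTent_sub n c)
      · exact ae_of_all _ fun x => hmono c x
    rw [h1]
    exact iSup_le htent
  calc meanDeviation (fun x => μ (T, x)) (fun x => y (T, x)) r
      ≤ ∫⁻ x in A, ((∫⁻ u, ENNReal.ofReal |u - s x| ∂(μ (T, x) : Measure ℝ))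
          + ‖w x - s x‖ₑ) := lintegral_mono fun x => lintegral_abs_sub_le _ _ _
    _ = (∫⁻ x in A, ∫⁻ u, ENNReal.ofReal |u - s x| ∂(μ (T, x) : Measure ℝ)) + e :=
        lintegral_add_right' _ hwsm
    _ ≤ b + (ε / 2 + ε / 2) := by
        rw [← add_assoc]
        exact add_le_add (hsup.trans (add_le_add le_rfl hes)) hes
    _ = b + ε := by rw [ENNReal.add_halves]

/-! ### Measurable representatives, Dirac masses and the assembled contraction -/

theorem exists_bounded_representative {X : Type*} [MeasurableSpace X] {ν : Measure X} {y : X → ℝ}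
    (h : AEMeasurable y ν) {M : ℝ} (hM : 0 ≤ M) (hb : ∀ᵐ p ∂ν, |y p| ≤ M) :
    ∃ y' : X → ℝ, Measurable y' ∧ (∀ p, |y' p| ≤ M) ∧ y =ᵐ[ν] y' := by
  refine ⟨fun p => max (-M) (min M (h.mk y p)), ?_, fun p => abs_le.2 ⟨le_max_left _ _, ?_⟩, ?_⟩
  · have := h.measurable_mk
    fun_prop
  · exact max_le (by linarith) (min_le_left _ _)
  · filter_upwards [hb, h.ae_eq_mk] with p hp he
    obtain ⟨h1, h2⟩ := abs_le.1 hp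
    rw [← he, min_eq_right h2, max_eq_right h1]

theorem MeasureTheory.MemLp.exists_ae_abs_le {X : Type*} [MeasurableSpace X] {ν : Measure X}
    {y : X → ℝ} (h : MemLp y ∞ ν) : ∃ M : ℝ, 0 ≤ M ∧ ∀ᵐ p ∂ν, |y p| ≤ M := by
  have hfin := h.2
  rw [eLpNorm_exponent_top] at hfin
  refine ⟨(eLpNormEssSup y ν).toReal, ENNReal.toReal_nonneg, ?_⟩
  filter_upwards [enorm_ae_le_eLpNormEssSup y ν] with p hp
  have := ENNReal.toReal_mono hfin.ne hp
  simpa using this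

theorem ae_halfVol_iff {P : ℝ × ℝ → Prop} :
    (∀ᵐ p ∂halfVol, P p) ↔ ∀ᵐ p : ℝ × ℝ, 0 < p.1 → P p := by
  rw [halfVol, ae_restrict_iff' measurableSet_halfPlane]
  have h0 : ∀ᵐ p : ℝ × ℝ, p.1 ≠ 0 :=
    (Measure.quasiMeasurePreserving_fst (μ := (volume : Measure ℝ)) (ν := (volume : Measure ℝ))).ae
      (p := fun t => t ≠ 0) (by simp [ae_iff])
  constructor <;> intro h <;> filter_upwards [h, h0] with p hp h0 hp'
  · exact hp ⟨hp'.le, trivial⟩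
  · exact hp (lt_of_le_of_ne hp'.1 (Ne.symm h0))

theorem ae_slice_of_ae_halfVol {P : ℝ × ℝ → Prop} (h : ∀ᵐ p ∂halfVol, P p) :
    ∀ᵐ t : ℝ, 0 < t → ∀ᵐ x : ℝ, P (t, x) := by
  have h1 := Measure.ae_ae_of_ae_prod (ae_halfVol_iff.1 h)
  filter_upwards [h1] with t ht h0
  filter_upwards [ht] with x hx using hx h0

instance neBot_ae_halfVol : (ae halfVol).NeBot := by
  rw [ae_neBot, halfVol, Ne, Measure.restrict_eq_zero, halfPlane, Measure.volume_eq_prod,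
    Measure.prod_prod]
  simp

theorem kruzhkovIneq_deterministic {f : ℝ → ℝ} (hf : Continuous f) {y : ℝ × ℝ → ℝ}
    (hy : Measurable y) (h : KruzhkovIneq f (Kernel.deterministic y hy)) (k : ℝ) {ψ : ℝ × ℝ → ℝ}
    (hψ : IsTestFunction ψ) (hψ0 : ∀ p, 0 ≤ ψ p) :
    0 ≤ ∫ p, (timeDeriv ψ p * |y p - k| + spaceDeriv ψ p * causalFlux f p (y p) k) := by
  have := h k ψ hψ hψ0
  rw [Measure.compProd_deterministic, integral_map (by fun_prop)] at this
  · exact this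
  · have h1 := hψ.continuous_timeDeriv.measurable
    have h2 := hψ.continuous_spaceDeriv.measurable
    have h3 : Measurable fun z : (ℝ × ℝ) × ℝ => causalFlux f z.1 z.2 k :=
      (measurable_causalFlux hf).comp (f := fun z : (ℝ × ℝ) × ℝ => (z.1, z.2, k)) (by fun_prop)
    exact Measurable.aestronglyMeasurable (by fun_prop)

theorem hasLocalMoment_deterministic {X : Type*} [MeasurableSpace X] [TopologicalSpace X]
    {ν : Measure X} [IsFiniteMeasureOnCompacts ν] {y : X → ℝ} (hy : Measurable y) {M : ℝ}
    (hM : ∀ p, |y p| ≤ M) : HasLocalMoment ν (Kernel.deterministic y hy) := by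
  intro K hK
  calc ∫⁻ ξ in K, ∫⁻ u, ‖u‖ₑ ∂Kernel.deterministic y hy ξ ∂ν
      ≤ ∫⁻ _ in K, ENNReal.ofReal M ∂ν := by
        refine lintegral_mono fun ξ => ?_
        rw [Kernel.deterministic_apply, lintegral_dirac, Real.enorm_eq_ofReal_abs]
        exact ENNReal.ofReal_le_ofReal (hM ξ)
    _ < ∞ := by
        rw [lintegral_const, Measure.restrict_apply_univ]
        exact ENNReal.mul_lt_top ENNReal.ofReal_lt_top hK.measure_lt_top

instance : IsFiniteMeasureOnCompacts halfVol := by unfold halfVol; infer_instance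

/-- The Kruzhkov inequalities for an entropy solution, extended by its initial datum. -/
theorem IsEntropySolution.kruzhkov {f y₀ : ℝ → ℝ} {y : ℝ × ℝ → ℝ} (hf : ContDiff ℝ 1 f)
    (h : IsEntropySolution f y₀ y) {C : ℝ≥0} {I : Set ℝ} (hI : I.OrdConnected)
    (hC : LipschitzOnWith C f I) {c : ℝ} (hc : c ∈ I) (hyI : ∀ᵐ p ∂halfVol, y p ∈ I)
    {v₀ : ℝ → ℝ} (hv₀ : Measurable v₀) {v : ℝ × ℝ → ℝ} (hv : Measurable v) {M : ℝ}
    (hM₀ : ∀ x, |v₀ x| ≤ M) (hM : ∀ p, |v p| ≤ M) (he₀ : y₀ =ᵐ[volume] v₀) (he : y =ᵐ[halfVol] v)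
    (k : ℝ) {ψ : ℝ × ℝ → ℝ} (hψ : IsTestFunction ψ) (hψ0 : ∀ p, 0 ≤ ψ p) :
    0 ≤ ∫ p, (timeDeriv ψ p * |(if p.1 < 0 then v₀ p.2 else v p) - k|
      + spaceDeriv ψ p * causalFlux f p (if p.1 < 0 then v₀ p.2 else v p) k) := by
  have hV : Measurable fun p : ℝ × ℝ => if p.1 < 0 then v₀ p.2 else v p :=
    Measurable.ite measurableSet_past (hv₀.comp measurable_snd) hv
  refine kruzhkovIneq_deterministic hf.continuous hV ?_ k hψ hψ0
  -- A function is a kernel of Dirac masses, compatibly with the extension to negative times, so the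
  -- argument for Young measures also covers `y`.
  have hK : Kernel.deterministic (fun p : ℝ × ℝ => if p.1 < 0 then v₀ p.2 else v p) hV
      = pastExtension (Kernel.deterministic v₀ hv₀) (Kernel.deterministic v hv) := by
    refine Kernel.ext fun p => ?_
    by_cases hp : p.1 < 0
    · rw [pastExtension_of_neg _ _ hp, Kernel.deterministic_apply, Kernel.deterministic_apply,
        if_pos hp]
    · rw [pastExtension_of_nonneg _ _ (not_lt.1 hp), Kernel.deterministic_apply,
        Kernel.deterministic_apply, if_neg hp]
  rw [hK]
  refine kruzhkovIneq_pastExtension hf (hasLocalMoment_deterministic hv₀ hM₀)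
    (hasLocalMoment_deterministic hv hM) hI hC hc ?_ fun η q hηq ψ hψ hψ0 => ?_
  · filter_upwards [hyI, he] with p hp hp'
    rw [Kernel.deterministic_apply, ae_dirac_eq]
    exact hp' ▸ hp
  · refine (h.entropy_ineq η q hηq ψ hψ hψ0).trans_eq ?_
    congr 1
    · refine integral_congr_ae ?_
      filter_upwards [he] with p hp
      rw [Kernel.deterministic_apply, integral_dirac, integral_dirac, hp]
    · refine integral_congr_ae ?_
      filter_upwards [he₀] with x hx
      rw [Kernel.deterministic_apply, integral_dirac, hx]

theorem HasLocalPairing.hasLocalMoment {X : Type*} [MeasurableSpace X] [TopologicalSpace X]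
    {ν : Measure X} {μ : X → ProbabilityMeasure ℝ} (h : HasLocalPairing ν μ fun u => u)
    {κ : Kernel X ℝ} (hκ : ∀ᵐ ξ ∂ν, κ ξ = μ ξ) : HasLocalMoment ν κ := by
  intro K hK
  refine lt_of_eq_of_lt (lintegral_congr_ae (ae_restrict_of_ae ?_)) (h K hK)
  filter_upwards [hκ] with ξ hξ
  rw [hξ]

theorem meanDeviation_congr {σ : ℝ → ProbabilityMeasure ℝ} {v w : ℝ → ℝ} {κ : ℝ → Measure ℝ}
    (hσ : ∀ᵐ x, κ x = σ x) (hv : w =ᵐ[volume] v) (R : ℝ) :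
    meanDeviation σ w R = ∫⁻ x in {x | |x| ≤ R}, ∫⁻ u, ENNReal.ofReal |u - v x| ∂κ x := by
  refine lintegral_congr_ae (ae_restrict_of_ae ?_)
  filter_upwards [hσ, hv] with x h1 h2
  rw [h1, h2]

theorem meanDeviation_lt_top {σ₀ : ℝ → ProbabilityMeasure ℝ} {y₀ : ℝ → ℝ}
    (hσ : HasLocalPairing volume σ₀ fun u => u) (hy₀ : MemLp y₀ 1 volume) (R : ℝ) :
    meanDeviation σ₀ y₀ R < ∞ := by
  have hK : IsCompact {x : ℝ | |x| ≤ R} := by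
    have : {x : ℝ | |x| ≤ R} = Set.Icc (-R) R :=
      Set.ext fun x => (abs_le : |x| ≤ R ↔ _)
    rw [this]; exact isCompact_Icc
  calc meanDeviation σ₀ y₀ R
      ≤ ∫⁻ x in {x : ℝ | |x| ≤ R}, ((∫⁻ u, ‖u‖ₑ ∂(σ₀ x : Measure ℝ)) + ‖y₀ x‖ₑ) := by
        refine lintegral_mono fun x => ?_
        have := lintegral_abs_sub_le (σ₀ x) (y₀ x) 0
        simpa [Real.enorm_eq_ofReal_abs] using this
    _ = (∫⁻ x in {x : ℝ | |x| ≤ R}, ∫⁻ u, ‖u‖ₑ ∂(σ₀ x : Measure ℝ))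
          + ∫⁻ x in {x : ℝ | |x| ≤ R}, ‖y₀ x‖ₑ :=
        lintegral_add_right' _ hy₀.aestronglyMeasurable.aemeasurable.restrict.enorm
    _ < ∞ := by
        refine ENNReal.add_lt_top.2 ⟨hσ _ hK, (setLIntegral_le_lintegral _ _).trans_lt ?_⟩
        have := hy₀.2
        rwa [eLpNorm_one_eq_lintegral_enorm] at this

theorem eq_dirac_of_lintegral_abs_sub_eq_zero {ν : Measure ℝ} [IsProbabilityMeasure ν] {a : ℝ}
    (h : ∫⁻ u, ENNReal.ofReal |u - a| ∂ν = 0) : ν = Measure.dirac a := by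
  rw [lintegral_eq_zero_iff (by fun_prop)] at h
  have h1 : (id : ℝ → ℝ) =ᵐ[ν] fun _ => a := by
    filter_upwards [h] with u hu
    have hu' : |u - a| ≤ 0 := ENNReal.ofReal_eq_zero.1 hu
    exact sub_eq_zero.1 (abs_nonpos_iff.1 hu')
  have h2 : ν.map id = ν.map fun _ => a := Measure.map_congr h1
  rwa [Measure.map_id, Measure.map_const, measure_univ, one_smul] at h2

theorem meanDeviation_eq_zero_of_dirac {σ₀ : ℝ → ProbabilityMeasure ℝ} {y₀ : ℝ → ℝ} {R : ℝ}
    (h : ∀ᵐ x : ℝ, |x| ≤ R → (σ₀ x : Measure ℝ) = Measure.dirac (y₀ x)) :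
    meanDeviation σ₀ y₀ R = 0 := by
  rw [meanDeviation, ← lintegral_zero (μ := volume.restrict {x : ℝ | |x| ≤ R})]
  refine lintegral_congr_ae ((ae_restrict_iff' (measurableSet_abs_le R)).2 ?_)
  filter_upwards [h] with x hx hxR
  rw [hx hxR, lintegral_dirac]
  simp

/-- A vanishing upper integral yields almost everywhere vanishing only for measurable integrands;
hence the passage to a kernel and a measurable representative of `w`. -/
theorem ae_eq_dirac_of_meanDeviation_eq_zero {σ : ℝ → ProbabilityMeasure ℝ} {w : ℝ → ℝ} {R : ℝ}
    (hσ : IsYoungMeasure volume σ) (hw : AEMeasurable w volume) (h : meanDeviation σ w R = 0) :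
    ∀ᵐ x : ℝ, |x| ≤ R → (σ x : Measure ℝ) = Measure.dirac (w x) := by
  obtain ⟨κ, hκ, hκσ⟩ := hσ.exists_kernel
  rw [meanDeviation_congr hκσ hw.ae_eq_mk R, lintegral_eq_zero_iff,
    EventuallyEq, ae_restrict_iff' (measurableSet_abs_le R)] at h
  · filter_upwards [h, hκσ, hw.ae_eq_mk] with x h1 h2 h3 hx
    rw [← h2, h3]
    exact eq_dirac_of_lintegral_abs_sub_eq_zero (h1 hx)
  · have h1 := hw.measurable_mk
    have : Measurable fun z : ℝ × ℝ => ENNReal.ofReal |z.2 - hw.mk w z.1| := by fun_prop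
    exact this.lintegral_kernel_prod_right'

/-- The contraction estimate in terms of a kernel and a function representing the two solutions. -/
theorem exists_contraction_representatives
    {f : ℝ → ℝ} (hf : ContDiff ℝ 1 f) {y₀ : ℝ → ℝ} (hy₀_one : MemLp y₀ 1 volume)
    (hy₀_top : MemLp y₀ ∞ volume) {y : ℝ × ℝ → ℝ} (hy : IsEntropySolution f y₀ y)
    {σ₀ : ℝ → ProbabilityMeasure ℝ} {μ : ℝ × ℝ → ProbabilityMeasure ℝ}
    (hμ : IsEntropyMVSolution f σ₀ μ) {C : ℝ≥0} {I : Set ℝ} (hI : I.OrdConnected)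
    (hC : LipschitzOnWith C f I) (hyI : ∀ᵐ p ∂halfVol, y p ∈ I)
    (hμI : ∀ᵐ p ∂halfVol, ∀ᵐ u ∂(μ p : Measure ℝ), u ∈ I) :
    ∃ (κ : Kernel (ℝ × ℝ) ℝ) (v : ℝ × ℝ → ℝ) (M : ℝ), IsMarkovKernel κ ∧ Measurable v ∧
      (∀ p, |v p| ≤ M) ∧ (∀ᵐ p ∂halfVol, κ p = μ p) ∧ y =ᵐ[halfVol] v ∧
      ∀ᵐ t : ℝ, 0 < t → ∀ r, ∫⁻ x in {x | |x| ≤ r}, ∫⁻ u, ENNReal.ofReal |u - v (t, x)| ∂κ (t, x)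
        ≤ meanDeviation σ₀ y₀ (r + C * t) := by
  obtain ⟨M₁, hM₁, hb₁⟩ := hy.memLp_top.exists_ae_abs_le
  obtain ⟨M₀, hM₀, hb₀⟩ := hy₀_top.exists_ae_abs_le
  set M := max M₀ M₁
  have hM : 0 ≤ M := hM₀.trans (le_max_left _ _)
  obtain ⟨v₁, hv₁, hv₁M, hev₁⟩ := exists_bounded_representative
    hy.memLp_top.aestronglyMeasurable.aemeasurable hM
    (hb₁.mono fun p hp => hp.trans (le_max_right _ _))
  obtain ⟨v₀, hv₀, hv₀M, hev₀⟩ := exists_bounded_representative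
    hy₀_top.aestronglyMeasurable.aemeasurable hM (hb₀.mono fun p hp => hp.trans (le_max_left _ _))
  obtain ⟨κ₁, hκ₁, hκμ⟩ := hμ.young.exists_kernel
  obtain ⟨σ, hσ, hσσ₀⟩ := hμ.young_init.exists_kernel
  -- A value of `y` in `I` serves as the base point `c` of all linear growth bounds.
  obtain ⟨p₀, hp₀⟩ := hyI.exists
  set κ := pastExtension σ κ₁ with hκ
  set v : ℝ × ℝ → ℝ := fun p => if p.1 < 0 then v₀ p.2 else v₁ p with hv
  have hvm : Measurable v := Measurable.ite measurableSet_past (hv₀.comp measurable_snd) hv₁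
  have hvM : ∀ p, |v p| ≤ M := fun p => by
    simp only [hv]; split_ifs
    exacts [hv₀M _, hv₁M _]
  have hκμ' : ∀ᵐ p ∂halfVol, κ p = μ p := by
    filter_upwards [hκμ, ae_halfVol_iff.2 (ae_of_all _ fun p (h : 0 < p.1) => h)] with p hp h0
    rw [hκ, pastExtension_of_nonneg _ _ h0.le, hp]
  have hev : y =ᵐ[halfVol] v := by
    filter_upwards [hev₁, ae_halfVol_iff.2 (ae_of_all _ fun p (h : 0 < p.1) => h)] with p hp h0
    rw [hp, hv]
    exact (if_neg h0.not_gt).symm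
  have hκ₁I : ∀ᵐ p ∂halfVol, ∀ᵐ u ∂κ₁ p, u ∈ I := by
    filter_upwards [hμI, hκμ] with p hp hp'
    rwa [hp']
  have hmσ := hμ.pairing_init.hasLocalMoment hσσ₀
  have hmκ₁ := hμ.pairing_id.hasLocalMoment hκμ
  have hm : HasLocalMoment volume κ := hmσ.pastExtension hmκ₁
  have hκI := ae_compProd_future hI (ae_pastExtension (σ := σ) hκ₁I)
  rw [← hκ] at hκI
  have hkr : KruzhkovIneq f κ := by
    refine kruzhkovIneq_pastExtension hf hmσ hmκ₁ hI hC hp₀ hκ₁I fun η q hηq ψ hψ hψ0 => ?_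
    refine (hμ.entropy_ineq η q hηq ψ hψ hψ0).trans_eq ?_
    congr 1
    · refine integral_congr_ae ?_
      filter_upwards [hκμ] with p hp
      rw [hp]
    · refine integral_congr_ae ?_
      filter_upwards [hσσ₀] with x hx
      rw [hx]
  have hkato := fun (φ : ℝ × ℝ → ℝ) (hφ : IsTestFunction φ) (hφ0 : ∀ p, 0 ≤ φ p) =>
    hkr.kato hf hm hC hp₀ hκI hvm hvM (fun k ψ hψ hψ0 =>
      hy.kruzhkov hf hI hC hp₀ hyI hv₀ hv₁ hv₀M hv₁M hev₀ hev₁ k hψ hψ0) hφ hφ0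
  have hvI : ∀ᵐ z ∂((volume : Measure (ℝ × ℝ)) ⊗ₘ κ), 0 < z.1.1 → v z.1 ∈ I := by
    refine Measure.ae_compProd_of_ae_fst κ (p := fun p => 0 < p.1 → v p ∈ I) ?_ ?_
    · exact (measurableSet_lt measurable_const measurable_fst).imp (hvm hI.measurableSet)
    · rw [← ae_halfVol_iff]
      filter_upwards [hyI, hev] with p hp hp'
      rwa [← hp']
  have hflux : ∀ᵐ z ∂((volume : Measure (ℝ × ℝ)) ⊗ₘ κ),
      |causalFlux f z.1 z.2 (v z.1)| ≤ C * |z.2 - v z.1| := by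
    filter_upwards [hκI, hvI] with z h1 h2
    unfold causalFlux
    split_ifs with h0
    · rw [abs_kruzhkovFlux]
      simpa [Real.dist_eq] using hC.dist_le_mul _ (h1 h0) _ (h2 h0)
    · rw [abs_zero]; positivity
  have hpast : ∀ t < 0, ∀ x, ∫⁻ u, ENNReal.ofReal |u - v (t, x)| ∂κ (t, x)
      = ∫⁻ u, ENNReal.ofReal |u - v₀ x| ∂σ x := fun t ht x => by
    rw [hκ, pastExtension_of_neg σ κ₁ (p := (t, x)) ht]
    simp only [hv, if_pos ht]
  have hdev : ∀ R, ∫⁻ x in {x : ℝ | |x| ≤ R}, ∫⁻ u, ENNReal.ofReal |u - v₀ x| ∂σ x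
      = meanDeviation σ₀ y₀ R := fun R => (meanDeviation_congr hσσ₀ hev₀ R).symm
  have hcontr := ae_contraction hm hvm hvM C.2 (fun θ hθ hθs hθ0 R δ hδ =>
    cone_inequality hf.continuous hm hvm hvM C.2 hflux hkato hθ hθs hθ0 R hδ) hpast
    fun R => (hdev R).trans_lt (meanDeviation_lt_top hμ.pairing_init hy₀_one R)
  refine ⟨κ, v, M, inferInstance, hvm, hvM, hκμ', hev, ?_⟩
  filter_upwards [hcontr] with t ht h0 r
  exact (ht h0 r).trans_eq (hdev _)

theorem tendsto_meanDeviation_add_mul {σ₀ : ℝ → ProbabilityMeasure ℝ} {y₀ : ℝ → ℝ}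
    (hfin : ∀ R, meanDeviation σ₀ y₀ R < ∞) (C : ℝ≥0) (r T : ℝ) :
    Tendsto (fun t => meanDeviation σ₀ y₀ (r + C * t)) (𝓝[>] T)
      (𝓝 (meanDeviation σ₀ y₀ (r + C * T))) := by
  rcases eq_or_ne C 0 with rfl | hC
  -- For `C = 0` the radius is constant and does not approach its limit strictly from the right, so
  -- this case is separate.
  · simp
  refine (tendsto_setLIntegral_abs_le hfin (r + C * T)).comp (tendsto_nhdsWithin_iff.2 ⟨?_, ?_⟩)
  · have : ContinuousAt (fun t : ℝ => r + C * t) T := by fun_prop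
    exact this.tendsto.mono_left nhdsWithin_le_nhds
  · filter_upwards [self_mem_nhdsWithin] with t ht
    have hC' : (0 : ℝ) < C := by exact_mod_cast pos_iff_ne_zero.2 hC
    have : (C : ℝ) * T < C * t := mul_lt_mul_of_pos_left ht hC'
    simpa using this

end

/-! ### Contraction and concentration -/

theorem theorem1
    (f : ℝ → ℝ) (hf : ContDiff ℝ 1 f)
    (y₀ : ℝ → ℝ) (hy₀_one : MemLp y₀ 1 volume) (hy₀_top : MemLp y₀ ∞ volume)
    (y : ℝ × ℝ → ℝ) (hy : IsEntropySolution f y₀ y)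
    (σ₀ : ℝ → ProbabilityMeasure ℝ) (μ : ℝ × ℝ → ProbabilityMeasure ℝ)
    (hμ : IsEntropyMVSolution f σ₀ μ)
    -- `C` is a Lipschitz constant of `f` on an interval `I` (possibly the whole line) in which
    -- `y` and `μ` take their values
    (C : ℝ≥0) (I : Set ℝ) (hI : I.OrdConnected) (hC : LipschitzOnWith C f I)
    (hyI : ∀ᵐ p ∂halfVol, y p ∈ I)
    (hμI : ∀ᵐ p ∂halfVol, ∀ᵐ u ∂(μ p : Measure ℝ), u ∈ I) :
    -- the right-hand side of the contraction inequality is finite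
    (∀ R : ℝ, meanDeviation σ₀ y₀ R < ∞) ∧
    -- contraction at almost every time, for all radii
    (∀ᵐ T : ℝ, 0 ≤ T → ∀ r : ℝ, 0 ≤ r →
      meanDeviation (fun x => μ (T, x)) (fun x => y (T, x)) r
        ≤ meanDeviation σ₀ y₀ (r + C * T)) ∧
    -- contraction at every time at which `y` and `μ` are normalized as right limits in time
    (∀ T : ℝ, 0 ≤ T → IsRightTrace y T → IsRightYoungTrace μ T → ∀ r : ℝ, 0 ≤ r →
      meanDeviation (fun x => μ (T, x)) (fun x => y (T, x)) r
        ≤ meanDeviation σ₀ y₀ (r + C * T)) ∧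
    -- concentration on the cone of dependence
    (∀ T : ℝ, 0 ≤ T → ∀ r : ℝ, 0 ≤ r →
      (∀ᵐ x : ℝ, |x| ≤ r + C * T → (σ₀ x : Measure ℝ) = Measure.dirac (y₀ x)) →
        (∀ᵐ p : ℝ × ℝ, 0 ≤ p.1 → p.1 ≤ T → |p.2| ≤ r + C * (T - p.1) →
          (μ p : Measure ℝ) = Measure.dirac (y p)) ∧
        (∀ t : ℝ, 0 ≤ t → t ≤ T → IsRightTrace y t → IsRightYoungTrace μ t →
          ∀ᵐ x : ℝ, |x| ≤ r + C * (T - t) →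
            (μ (t, x) : Measure ℝ) = Measure.dirac (y (t, x)))) := by
  have hfin := meanDeviation_lt_top hμ.pairing_init hy₀_one
  obtain ⟨κ, v, M, hκ, hv, hvM, hκμ, hyv, hcontr⟩ :=
    exists_contraction_representatives hf hy₀_one hy₀_top hy hμ hI hC hyI hμI
  have hκμ' := ae_slice_of_ae_halfVol hκμ
  have hyv' := ae_slice_of_ae_halfVol hyv
  have hae : ∀ᵐ t : ℝ, 0 < t → ∀ r, meanDeviation (fun x => μ (t, x)) (fun x => y (t, x)) r
      ≤ meanDeviation σ₀ y₀ (r + C * t) := by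
    filter_upwards [hcontr, hκμ', hyv'] with t h1 h2 h3 h0 r
    rw [meanDeviation_congr (h2 h0) (h3 h0) r]
    exact h1 h0 r
  have htrace : ∀ T : ℝ, 0 ≤ T → IsRightTrace y T → IsRightYoungTrace μ T → ∀ r : ℝ,
      meanDeviation (fun x => μ (T, x)) (fun x => y (T, x)) r
        ≤ meanDeviation σ₀ y₀ (r + C * T) := by
    intro T hT hyT hμT r
    refine meanDeviation_le_of_isRightTrace hyT hμT ?_ ?_ (M := M) ?_ r ?_
      (tendsto_meanDeviation_add_mul hfin C r T)
    -- Almost every slice of `μ` agrees almost everywhere with a slice of the kernel `κ`, hence is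
    -- itself a Young measure on the line.
    · filter_upwards [hκμ'] with t ht h0 g
      have hgm : StronglyMeasurable fun x : ℝ => ∫ u, g u ∂κ (t, x) :=
        (g.continuous.stronglyMeasurable.integral_kernel (κ := κ)).comp_measurable
          (measurable_const.prodMk measurable_id)
      refine hgm.measurable.aemeasurable.congr ?_
      filter_upwards [ht (hT.trans_lt h0)] with x hx
      rw [hx]
    · filter_upwards [hyv'] with t ht h0
      have hvt : Measurable fun x : ℝ => v (t, x) := by fun_prop
      refine hvt.aemeasurable.congr ?_
      filter_upwards [ht (hT.trans_lt h0)] with x hx using hx.symm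
    · filter_upwards [hyv'] with t ht h0
      filter_upwards [ht (hT.trans_lt h0)] with x hx
      rw [hx]
      exact hvM _
    · filter_upwards [hae] with t ht h0 using ht (hT.trans_lt h0) r
  refine ⟨hfin, ?_, fun T hT h1 h2 r _ => htrace T hT h1 h2 r, fun T hT r hr hdirac => ⟨?_, ?_⟩⟩
  · have h0 : ∀ᵐ t : ℝ, t ≠ 0 := by simp [ae_iff]
    filter_upwards [hae, h0] with t ht h0 h1 r _
    exact ht (lt_of_le_of_ne h1 (Ne.symm h0)) r
  · have hzero := meanDeviation_eq_zero_of_dirac hdirac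
    -- The cone without its base `t = 0`, a null set on which `κ` and `v` are unrelated to `μ` and
    -- `y`. By Tonelli it suffices that the deviation vanishes on almost every time slice.
    set S : Set (ℝ × ℝ) := {p | (0 < p.1 ∧ p.1 ≤ T) ∧ |p.2| ≤ r + C * (T - p.1)} with hS
    have hSm : MeasurableSet S :=
      ((measurableSet_lt measurable_const measurable_fst).inter
        (measurableSet_le measurable_fst measurable_const)).inter
        (measurableSet_le (f := fun p : ℝ × ℝ => |p.2|) (g := fun p => r + C * (T - p.1))
          (by fun_prop) (by fun_prop))
    have hΦm : Measurable fun p : ℝ × ℝ => ∫⁻ u, ENNReal.ofReal |u - v p| ∂κ p := by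
      have : Measurable fun z : (ℝ × ℝ) × ℝ => ENNReal.ofReal |z.2 - v z.1| := by fun_prop
      exact this.lintegral_kernel_prod_right'
    have hint : ∫⁻ p, S.indicator (fun p => ∫⁻ u, ENNReal.ofReal |u - v p| ∂κ p) p = 0 := by
      rw [Measure.volume_eq_prod, lintegral_prod _ (hΦm.indicator hSm).aemeasurable,
        ← lintegral_zero (μ := (volume : Measure ℝ))]
      refine lintegral_congr_ae ?_
      filter_upwards [hcontr] with t ht
      by_cases htT : 0 < t ∧ t ≤ T
      · refine le_antisymm ?_ zero_le
        have h1 := ht htT.1 (r + C * (T - t))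
        -- The slice of the cone at time `t` has radius `r + C * (T - t)`; the contraction enlarges
        -- it by `C * t` to exactly the base, where the initial deviation is zero.
        have e : r + C * (T - t) + C * t = r + C * T := by ring
        rw [e, hzero, ← lintegral_indicator (measurableSet_abs_le _)] at h1
        refine le_trans (lintegral_mono fun x => ?_) h1
        by_cases hx : |x| ≤ r + C * (T - t)
        · rw [Set.indicator_of_mem (show (t, x) ∈ S from ⟨htT, hx⟩),
            Set.indicator_of_mem (show x ∈ {x : ℝ | |x| ≤ r + C * (T - t)} from hx)]
        · rw [Set.indicator_of_notMem (show (t, x) ∉ S from fun h => hx h.2)]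
          exact zero_le
      · have : ∀ x, (t, x) ∉ S := fun x h => htT h.1
        simp [this]
    rw [lintegral_eq_zero_iff (hΦm.indicator hSm)] at hint
    have h0 : ∀ᵐ p : ℝ × ℝ, 0 < p.1 → κ p = μ p ∧ y p = v p := by
      rw [← ae_halfVol_iff]
      exact hκμ.and hyv
    have hne : ∀ᵐ p : ℝ × ℝ, p.1 ≠ 0 :=
      (Measure.quasiMeasurePreserving_fst (μ := (volume : Measure ℝ))
        (ν := (volume : Measure ℝ))).ae (p := fun t => t ≠ 0) (by simp [ae_iff])
    filter_upwards [hint, h0, hne] with p hp h0 hne h1 h2 h3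
    have hpos : 0 < p.1 := lt_of_le_of_ne h1 (Ne.symm hne)
    rw [Set.indicator_of_mem (show p ∈ S from ⟨⟨hpos, h2⟩, h3⟩)] at hp
    rw [← (h0 hpos).1, (h0 hpos).2]
    exact eq_dirac_of_lintegral_abs_sub_eq_zero hp
  · intro t ht htT hyt hμt
    refine ae_eq_dirac_of_meanDeviation_eq_zero hμt.1 hyt.1 (le_antisymm ?_ zero_le)
    refine (htrace t ht hyt hμt (r + C * (T - t))).trans_eq ?_
    have e : r + C * (T - t) + C * t = r + C * T := by ring
    rw [e, meanDeviation_eq_zero_of_dirac hdirac]
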